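/- Work over $\mathbb{C}$. Write $\mathrm{Gr}(k,n)$ for the Grassmannian of $k$-dimensional subspaces of $V_n=\mathbb{C}^n$ and $\mathrm{Fl}(k_1,k_2,n)\subset \mathrm{Gr}(k_1,n)\times\mathrm{Gr}(k_2,n)$ for the manifold of flags of subspaces of dimensions $k_1\le k_2$ (empty if $k_1>k_2$). Let $\mathcal{U}$ and $\mathcal{Q}$ be the tautological subbundle and quotient bundle on a Grassmannian, and let $\mathcal{Q}_2$ be the pull-back to $\mathrm{Fl}(k_1,k_2,n)$ of the quotient bundle of $\mathrm{Gr}(k_2,n)$. For a vector bundle $\mathcal{F}$ on $Y$, $\mathscr{Z}(Y,\mathcal{F})$ denotes the (scheme-theoretic) zero locus of a general section of $\mathcal{F}$, i.e. of any section in a suitable nonempty Zariski open subset of $H^0(Y,\mathcal{F})$. Let $0\le a\le m\le n$ and $0\le b\le n$ be integers and consider $$\mathscr{Z}=\mathscr{Z}\bigl(\mathrm{Gr}(a,m)\times\mathrm{Gr}(b,n),\ \mathcal{Q}\boxtimes\mathcal{U}^\vee\bigr).$$ 1. $\mathscr{Z}$ is isomorphic, over $\mathrm{Gr}(a,m)$,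 to the Grassmann bundle $\mathrm{Gr}(b,\mathcal{U}\oplus\mathcal{O}^{\oplus(n-m)})\to\mathrm{Gr}(a,m)$ of rank $b$ subbundles. It is also isomorphic to the zero locus $\mathscr{Z}\bigl(\mathrm{Fl}(b,a+n-m,n),\ \mathcal{Q}_2^{\oplus(n-m)}\bigr)$ of a general section. In particular $\mathscr{Z}$ is empty if $a+n<b+m$. 2. If $a=b$, there is a subspace $K\subset V_n$ of dimension $n-m$ such that the second projection $\mathscr{Z}\to\mathrm{Gr}(b,n)$ is birational, and its fibre over any $B\in\mathrm{Gr}(b,n)$ with $\dim(B\cap K)=d$ is isomorphic to $\mathrm{Gr}(d,m-a+d)$. 3. If moreover $m=n-1$ and $a\ge 1$ (so that $K$ is a line), the closed subscheme $\{B\in\mathrm{Gr}(a,n): K\subset B\}$ is isomorphic to $\mathrm{Gr}(a-1,n-1)$, and the second projection identifies $\mathscr{Z}$ with the blow-up of $\mathrm{Gr}(a,n)$ along it: $\mathscr{Z}\cong\mathrm{Bl}_{\mathrm{Gr}(a-1,n-1)}\mathrm{Gr}(a,n)$. -/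

import Mathlib

open CategoryTheory TensorProduct

noncomputable section

namespace FunctorOfPoints

/-! ### Base change along a ring homomorphism -/

section Algebra

variable {R S : Type} [CommRing R] [CommRing S] {φ : R →+* S}
  {M N : Type} [AddCommGroup M] [Module R M] [AddCommGroup N] [Module S N]

/-- A `φ`-semilinear map `ψ : M → N` exhibits `N` as the base change `S ⊗[R] M` of `M` along
`φ : R → S`. -/
def IsBaseChangeAlong (ψ : M →ₛₗ[φ] N) : Prop :=
  letI : Algebra R S := φ.toAlgebra
  letI : Module R N := Module.compHom N φ
  haveI : IsScalarTower R S N := ⟨fun r s v => mul_smul (φ r) s v⟩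
  IsBaseChange S
    ({ toFun := ψ, map_add' := ψ.map_add, map_smul' := fun r v => ψ.map_smulₛₗ r v } : M →ₗ[R] N)

/-- The extension of a linear form along a base change. -/
def IsBaseChangeAlong.dualMapAux {ψ : M →ₛₗ[φ] N} (h : IsBaseChangeAlong ψ)
    (l : Module.Dual R M) : Module.Dual S N :=
  letI : Algebra R S := φ.toAlgebra
  letI : Module R N := Module.compHom N φ
  haveI : IsScalarTower R S N := ⟨fun r s v => mul_smul (φ r) s v⟩
  IsBaseChange.lift h ((Algebra.linearMap R S).comp l)

theorem IsBaseChangeAlong.dualMapAux_apply {ψ : M →ₛₗ[φ] N} (h : IsBaseChangeAlong ψ)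
    (l : Module.Dual R M) (v : M) : h.dualMapAux l (ψ v) = φ (l v) := by
  let : Algebra R S := φ.toAlgebra
  let : Module R N := Module.compHom N φ
  have : IsScalarTower R S N := ⟨fun r s v => mul_smul (φ r) s v⟩
  exact IsBaseChange.lift_eq h ((Algebra.linearMap R S).comp l) v

theorem IsBaseChangeAlong.span_range {ψ : M →ₛₗ[φ] N} (h : IsBaseChangeAlong ψ) :
    Submodule.span S (Set.range ψ) = ⊤ := by
  let : Algebra R S := φ.toAlgebra
  let : Module R N := Module.compHom N φ
  have : IsScalarTower R S N := ⟨fun r s v => mul_smul (φ r) s v⟩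
  rw [eq_top_iff]
  rintro w -
  induction w using IsBaseChange.inductionOn h with
  | zero => exact zero_mem _
  | tmul m => exact Submodule.subset_span ⟨m, rfl⟩
  | smul s n hn => exact Submodule.smul_mem _ _ hn
  | add a b ha hb => exact add_mem ha hb

theorem IsBaseChangeAlong.ext {ψ : M →ₛₗ[φ] N} (h : IsBaseChangeAlong ψ)
    {P : Type} [AddCommGroup P] [Module S P] {g₁ g₂ : N →ₗ[S] P}
    (e : ∀ v, g₁ (ψ v) = g₂ (ψ v)) : g₁ = g₂ := by
  apply LinearMap.ext_on h.span_range
  rintro _ ⟨v, rfl⟩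
  exact e v

/-- The semilinear map between dual modules induced by a base change: it sends `l` to the unique
linear form `l'` with `l' (ψ v) = φ (l v)`. -/
def IsBaseChangeAlong.dualMap {ψ : M →ₛₗ[φ] N} (h : IsBaseChangeAlong ψ) :
    Module.Dual R M →ₛₗ[φ] Module.Dual S N where
  toFun := h.dualMapAux
  map_add' l l' := h.ext fun v => by simp [dualMapAux_apply]
  map_smul' r l := h.ext fun v => by simp [dualMapAux_apply]

@[simp] theorem IsBaseChangeAlong.dualMap_apply {ψ : M →ₛₗ[φ] N} (h : IsBaseChangeAlong ψ)
    (l : Module.Dual R M) (v : M) : h.dualMap l (ψ v) = φ (l v) :=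
  h.dualMapAux_apply l v

/-- A criterion for base change in terms of a dual basis. -/
theorem IsBaseChangeAlong.of_dualBasis {ψ : M →ₛₗ[φ] N} {ι : Type} [Fintype ι] (e : ι → M)
    (ε : ι → Module.Dual R M) (δ : ι → Module.Dual S N) (h₁ : ∀ v, ∑ i, ε i v • e i = v)
    (h₂ : ∀ i v, δ i (ψ v) = φ (ε i v)) (h₃ : ∀ w, ∑ i, δ i w • ψ (e i) = w) :
    IsBaseChangeAlong ψ := by
  let : Algebra R S := φ.toAlgebra
  let : Module R N := Module.compHom N φ
  have : IsScalarTower R S N := ⟨fun r s v => mul_smul (φ r) s v⟩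
  let ψ' : M →ₗ[R] N :=
    { toFun := ψ, map_add' := ψ.map_add, map_smul' := fun r v => ψ.map_smulₛₗ r v }
  let F : S ⊗[R] M →ₗ[S] N := LinearMap.liftBaseChange S ψ'
  let G : N →ₗ[S] S ⊗[R] M :=
    ∑ i, (LinearMap.toSpanSingleton S (S ⊗[R] M) (1 ⊗ₜ[R] e i)).comp (δ i)
  have hF : ∀ s v, F (s ⊗ₜ v) = s • ψ v := fun s v => LinearMap.liftBaseChange_tmul ..
  have hG : ∀ w, G w = ∑ i, (δ i w) ⊗ₜ[R] e i := fun w => by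
    simp [G, LinearMap.sum_apply, TensorProduct.smul_tmul']
  have hGF : ∀ z, G (F z) = z := by
    intro z
    induction z with
    | zero => simp
    | add a b ha hb => rw [map_add, map_add, ha, hb]
    | tmul s v =>
      rw [hF, map_smul, hG]
      simp only [h₂]
      have : ∀ i, φ (ε i v) ⊗ₜ[R] e i = (1 : S) ⊗ₜ[R] (ε i v • e i) := fun i => by
        rw [← TensorProduct.smul_tmul, Algebra.smul_def, mul_one]; rfl
      simp only [this]
      rw [← TensorProduct.tmul_sum, h₁, TensorProduct.smul_tmul', smul_eq_mul, mul_one]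
  have hFG : ∀ w, F (G w) = w := fun w => by
    rw [hG, map_sum]; simp only [hF]; exact h₃ w
  exact IsBaseChange.of_equiv (LinearEquiv.ofLinearMap F G (LinearMap.ext hFG) (LinearMap.ext hGF))
    fun v => by
      show F (1 ⊗ₜ v) = ψ v
      rw [hF, one_smul]

theorem exists_dualBasis (R M : Type) [CommRing R] [AddCommGroup M] [Module R M]
    [Module.Finite R M] [Module.Projective R M] :
    ∃ (k : ℕ) (e : Fin k → M) (ε : Fin k → Module.Dual R M), ∀ v, ∑ i, ε i v • e i = v := by
  obtain ⟨k, f, g, -, -, hfg⟩ := Module.Finite.exists_comp_eq_id_of_projective R M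
  refine ⟨k, fun i => f (Pi.single i 1), fun i => (LinearMap.proj i).comp g, fun v => ?_⟩
  have h := LinearMap.congr_fun hfg v
  conv_rhs => rw [← LinearMap.id_apply (R := R) v, ← h]
  simp only [LinearMap.comp_apply, LinearMap.proj_apply, ← map_smul, ← map_sum]
  congr 1
  ext j
  simp [Finset.sum_apply, Pi.single_apply]

/-- Over a base change a dual basis extends to a dual basis. -/
theorem IsBaseChangeAlong.sum_dualMap {ψ : M →ₛₗ[φ] N} (h : IsBaseChangeAlong ψ)
    {ι : Type} [Fintype ι] {e : ι → M} {ε : ι → Module.Dual R M}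
    (h₁ : ∀ v, ∑ i, ε i v • e i = v) (w : N) : ∑ i, h.dualMap (ε i) w • ψ (e i) = w := by
  have : (∑ i, (LinearMap.toSpanSingleton S N (ψ (e i))).comp (h.dualMap (ε i))) =
      LinearMap.id := h.ext fun v => by
    simp only [LinearMap.sum_apply, LinearMap.comp_apply, dualMap_apply,
      LinearMap.toSpanSingleton_apply, LinearMap.id_apply]
    conv_rhs => rw [← h₁ v]
    simp [map_sum]
  simpa [LinearMap.sum_apply] using LinearMap.congr_fun this w

theorem IsBaseChangeAlong.dual [Module.Finite R M] [Module.Projective R M] {ψ : M →ₛₗ[φ] N}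
    (h : IsBaseChangeAlong ψ) : IsBaseChangeAlong h.dualMap := by
  obtain ⟨k, e, ε, he⟩ := exists_dualBasis R M
  refine .of_dualBasis ε (fun i => Module.Dual.eval R M (e i))
    (fun i => Module.Dual.eval S N (ψ (e i))) (fun l => ?_) (fun i l => ?_) (fun l => ?_)
  · ext v
    conv_rhs => rw [← he v]
    simp [LinearMap.sum_apply, mul_comm]
  · simp
  · ext w
    conv_rhs => rw [← h.sum_dualMap he w]
    simp [LinearMap.sum_apply, mul_comm]

theorem IsBaseChangeAlong.tensor [Module.Finite R M] [Module.Projective R M]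
    {M' N' : Type} [AddCommGroup M'] [Module R M'] [AddCommGroup N'] [Module S N']
    [Module.Finite R M'] [Module.Projective R M']
    {ψ : M →ₛₗ[φ] N} {ψ' : M' →ₛₗ[φ] N'}
    (h : IsBaseChangeAlong ψ) (h' : IsBaseChangeAlong ψ') :
    IsBaseChangeAlong (TensorProduct.map ψ ψ') := by
  obtain ⟨k, e, ε, he⟩ := exists_dualBasis R M
  obtain ⟨k', e', ε', he'⟩ := exists_dualBasis R M'
  refine .of_dualBasis (ι := Fin k × Fin k') (fun i => e i.1 ⊗ₜ e' i.2)
    (fun i => TensorProduct.dualDistrib R M M' (ε i.1 ⊗ₜ ε' i.2))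
    (fun i => TensorProduct.dualDistrib S N N' (h.dualMap (ε i.1) ⊗ₜ h'.dualMap (ε' i.2)))
    (fun v => ?_) (fun i v => ?_) (fun v => ?_)
  · induction v with
    | zero => simp
    | add a b ha hb => simp only [map_add, add_smul, Finset.sum_add_distrib, ha, hb]
    | tmul a b =>
      conv_rhs => rw [← he a, ← he' b]
      simp only [TensorProduct.sum_tmul, TensorProduct.tmul_sum, TensorProduct.smul_tmul_smul,
        Fintype.sum_prod_type, TensorProduct.dualDistrib_apply]
      exact Finset.sum_comm
  · induction v with
    | zero => simp
    | add a b ha hb => simp only [map_add, ha, hb]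
    | tmul a b => simp
  · induction v with
    | zero => simp
    | add a b ha hb => simp only [map_add, add_smul, Finset.sum_add_distrib, ha, hb]
    | tmul a b =>
      conv_rhs => rw [← h.sum_dualMap he a, ← h'.sum_dualMap he' b]
      simp only [TensorProduct.sum_tmul, TensorProduct.tmul_sum, TensorProduct.smul_tmul_smul,
        Fintype.sum_prod_type, TensorProduct.dualDistrib_apply, TensorProduct.map_tmul]
      exact Finset.sum_comm

/-- The product of two semilinear maps. -/
def prodSemi {M' N' : Type} [AddCommGroup M'] [Module R M'] [AddCommGroup N'] [Module S N']
    (ψ : M →ₛₗ[φ] N) (ψ' : M' →ₛₗ[φ] N') : M × M' →ₛₗ[φ] N × N' where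
  toFun v := (ψ v.1, ψ' v.2)
  map_add' v w := by simp
  map_smul' r v := by simp

theorem IsBaseChangeAlong.prod [Module.Finite R M] [Module.Projective R M]
    {M' N' : Type} [AddCommGroup M'] [Module R M'] [AddCommGroup N'] [Module S N']
    [Module.Finite R M'] [Module.Projective R M']
    {ψ : M →ₛₗ[φ] N} {ψ' : M' →ₛₗ[φ] N'}
    (h : IsBaseChangeAlong ψ) (h' : IsBaseChangeAlong ψ') :
    IsBaseChangeAlong (prodSemi ψ ψ') := by
  obtain ⟨k, e, ε, he⟩ := exists_dualBasis R M
  obtain ⟨k', e', ε', he'⟩ := exists_dualBasis R M'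
  refine .of_dualBasis (ι := Fin k ⊕ Fin k')
    (Sum.elim (fun i => (e i, 0)) (fun i => (0, e' i)))
    (Sum.elim (fun i => (ε i).comp (LinearMap.fst R M M'))
      (fun i => (ε' i).comp (LinearMap.snd R M M')))
    (Sum.elim (fun i => (h.dualMap (ε i)).comp (LinearMap.fst S N N'))
      (fun i => (h'.dualMap (ε' i)).comp (LinearMap.snd S N N')))
    (fun v => ?_) (fun i v => ?_) (fun v => ?_)
  · ext <;> simp [Prod.fst_sum, Prod.snd_sum, he, he']
  · cases i <;> simp [prodSemi]
  · ext <;> simp [Prod.fst_sum, Prod.snd_sum, prodSemi, h.sum_dualMap he, h'.sum_dualMap he']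

/-- The `r`-th power of a semilinear map. -/
def powSemi (r : ℕ) (ψ : M →ₛₗ[φ] N) : (Fin r → M) →ₛₗ[φ] (Fin r → N) where
  toFun v := fun i => ψ (v i)
  map_add' v w := by ext; simp
  map_smul' c v := by ext; simp

theorem IsBaseChangeAlong.pow [Module.Finite R M] [Module.Projective R M] (r : ℕ)
    {ψ : M →ₛₗ[φ] N} (h : IsBaseChangeAlong ψ) : IsBaseChangeAlong (powSemi r ψ) := by
  obtain ⟨k, e, ε, he⟩ := exists_dualBasis R M
  refine .of_dualBasis (ι := Fin r × Fin k) (fun i => Pi.single i.1 (e i.2))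
    (fun i => (ε i.2).comp (LinearMap.proj i.1))
    (fun i => (h.dualMap (ε i.2)).comp (LinearMap.proj i.1))
    (fun v => ?_) (fun i v => ?_) (fun v => ?_)
  · ext j
    simp [Finset.sum_apply, Fintype.sum_prod_type, Pi.single_apply, he, smul_ite]
  · simp [powSemi]
  · ext j
    have : ∀ (i : Fin r) (x : Fin k), ψ (Pi.single (M := fun _ => M) i (e x) j) =
        if j = i then ψ (e x) else 0 := fun i x => by
      by_cases hj : j = i
      · subst hj; simp
      · simp [hj]
    simp [Finset.sum_apply, Fintype.sum_prod_type, this, powSemi, h.sum_dualMap he, smul_ite]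

theorem projective_pow [Module.Projective R M] (r : ℕ) : Module.Projective R (Fin r → M) :=
  .of_equiv (DFinsupp.linearEquivFunOnFintype (R := R) (M := fun _ : Fin r => M))

/-- A ring homomorphism as a semilinear map. -/
def ringSemi (φ : R →+* S) : R →ₛₗ[φ] S where
  toFun := φ
  map_add' := φ.map_add
  map_smul' r v := by simp

theorem isBaseChangeAlong_ringSemi (φ : R →+* S) : IsBaseChangeAlong (ringSemi φ) :=
  .of_dualBasis (ι := Unit) (fun _ => 1) (fun _ => LinearMap.id) (fun _ => LinearMap.id)
    (fun v => by simp) (fun _ v => rfl) (fun w => by simp [ringSemi])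

/-- The `S`-submodule of `N` generated by the image of a submodule `L` of `M`. -/
def pushSub (ψ : M →ₛₗ[φ] N) (L : Submodule R M) : Submodule S N :=
  Submodule.span S (ψ '' L)

theorem pushSub_mono (ψ : M →ₛₗ[φ] N) {L L' : Submodule R M} (h : L ≤ L') :
    pushSub ψ L ≤ pushSub ψ L' :=
  Submodule.span_mono (Set.image_mono h)

theorem mem_pushSub (ψ : M →ₛₗ[φ] N) {L : Submodule R M} {v : M} (h : v ∈ L) :
    ψ v ∈ pushSub ψ L :=
  Submodule.subset_span ⟨v, h, rfl⟩

/-- The map induced on submodules. -/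
def subSemi (ψ : M →ₛₗ[φ] N) (L : Submodule R M) (L' : Submodule S N) (hL : pushSub ψ L = L') :
    L →ₛₗ[φ] L' where
  toFun v := ⟨ψ v, hL ▸ Submodule.subset_span ⟨v, v.2, rfl⟩⟩
  map_add' v w := by ext; simp
  map_smul' r v := by ext; simp

/-- The map induced on quotient modules. -/
def quotSemi (ψ : M →ₛₗ[φ] N) (L : Submodule R M) (L' : Submodule S N) (hL : pushSub ψ L = L') :
    (M ⧸ L) →ₛₗ[φ] (N ⧸ L') :=
  L.mapQ L' ψ (fun v hv => hL ▸ Submodule.subset_span ⟨v, hv, rfl⟩)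

theorem exists_projection (L : Submodule R M) [Module.Projective R (M ⧸ L)] :
    ∃ π : M →ₗ[R] L, ∀ v : L, π v = v := by
  obtain ⟨σ, hσ⟩ := Module.projective_lifting_property L.mkQ (LinearMap.id) L.mkQ_surjective
  have key : ∀ v, v - σ (L.mkQ v) ∈ L := fun v => by
    have h := LinearMap.congr_fun hσ (L.mkQ v)
    rw [LinearMap.comp_apply, LinearMap.id_apply] at h
    rw [← Submodule.Quotient.mk_eq_zero, ← Submodule.mkQ_apply, map_sub, h, sub_self]
  refine ⟨(LinearMap.id - σ.comp L.mkQ).codRestrict L key, fun v => ?_⟩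
  ext
  have : L.mkQ (v : M) = 0 := by simp
  simp [this]

theorem finite_sub (L : Submodule R M) [Module.Projective R (M ⧸ L)] [Module.Finite R M] :
    Module.Finite R L := by
  obtain ⟨π, hπ⟩ := exists_projection L
  exact Module.Finite.of_surjective π fun v => ⟨v, hπ v⟩

theorem projective_sub (L : Submodule R M) [Module.Projective R (M ⧸ L)]
    [Module.Projective R M] : Module.Projective R L := by
  obtain ⟨π, hπ⟩ := exists_projection L
  exact Module.Projective.of_split L.subtype π (LinearMap.ext hπ)

theorem IsBaseChangeAlong.sub [Module.Finite R M] [Module.Projective R M] {ψ : M →ₛₗ[φ] N}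
    (h : IsBaseChangeAlong ψ) (L : Submodule R M) [Module.Projective R (M ⧸ L)]
    (L' : Submodule S N) (hL : pushSub ψ L = L') : IsBaseChangeAlong (subSemi ψ L L' hL) := by
  obtain ⟨k, e, ε, he⟩ := exists_dualBasis R M
  obtain ⟨π, hπ⟩ := exists_projection L
  have key : ∀ v : L, ∑ i, ε i v • π (e i) = v := fun v => by
    simp only [← map_smul, ← map_sum, he, hπ]
  refine .of_dualBasis (fun i => π (e i)) (fun i => (ε i).comp L.subtype)
    (fun i => (h.dualMap (ε i)).comp L'.subtype) key
    (fun i v => h.dualMap_apply _ _) (fun w => ?_)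
  have : Set.EqOn (∑ i, (LinearMap.toSpanSingleton S N (ψ (π (e i)))).comp (h.dualMap (ε i)) :
      N →ₗ[S] N) (LinearMap.id : N →ₗ[S] N) (Submodule.span S (ψ '' L)) := by
    apply LinearMap.eqOn_span
    rintro _ ⟨v, hv, rfl⟩
    have := congrArg (fun z : L => ψ (z : M)) (key ⟨v, hv⟩)
    simpa [LinearMap.sum_apply, map_sum] using this
  have hw := this (x := (w : N)) (hL.symm.le w.2)
  ext
  simpa [LinearMap.sum_apply, subSemi] using hw

theorem IsBaseChangeAlong.quot [Module.Finite R M] [Module.Projective R M] {ψ : M →ₛₗ[φ] N}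
    (h : IsBaseChangeAlong ψ) (L : Submodule R M) [Module.Projective R (M ⧸ L)]
    (L' : Submodule S N) (hL : pushSub ψ L = L') : IsBaseChangeAlong (quotSemi ψ L L' hL) := by
  obtain ⟨k, e, ε, he⟩ := exists_dualBasis R M
  obtain ⟨π, hπ⟩ := exists_projection L
  let β : Fin k → Module.Dual R M := fun i => (ε i).comp (LinearMap.id - L.subtype.comp π)
  have hβ : ∀ i, ∀ v ∈ L, β i v = 0 := fun i v hv => by
    have := hπ ⟨v, hv⟩
    simp only at this
    simp [β, this]
  have hβ' : ∀ i, L' ≤ LinearMap.ker (h.dualMap (β i)) := fun i => by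
    rw [← hL]
    refine Submodule.span_le.2 ?_
    rintro _ ⟨v, hv, rfl⟩
    simp [hβ i v hv]
  have key : ∀ v, ∑ i, β i v • e i = v - π v := fun v => he _
  refine .of_dualBasis (fun i => L.mkQ (e i)) (fun i => L.liftQ (β i) (hβ i))
    (fun i => L'.liftQ (h.dualMap (β i)) (hβ' i)) (fun v => ?_) (fun i v => ?_) (fun w => ?_)
  · obtain ⟨v, rfl⟩ := L.mkQ_surjective v
    have h1 := congrArg L.mkQ (key v)
    have h2 : L.mkQ (π v : M) = 0 := by simp
    rw [map_sub, h2, sub_zero] at h1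
    conv_rhs => rw [← h1]
    rw [map_sum]
    exact Finset.sum_congr rfl fun i _ => (map_smul L.mkQ _ _).symm
  · obtain ⟨v, rfl⟩ := L.mkQ_surjective v
    exact h.dualMap_apply (β i) v
  · obtain ⟨w, rfl⟩ := L'.mkQ_surjective w
    have : (∑ i, (LinearMap.toSpanSingleton S (N ⧸ L') (L'.mkQ (ψ (e i)))).comp
        (h.dualMap (β i))) = L'.mkQ := h.ext fun v => by
      have h1 := congrArg (fun z => L'.mkQ (ψ z)) (key v)
      have h2 : L'.mkQ (ψ (π v)) = 0 := by
        rw [Submodule.mkQ_apply, Submodule.Quotient.mk_eq_zero, ← hL]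
        exact Submodule.subset_span ⟨_, (π v).2, rfl⟩
      simp only [map_sub, h2, sub_zero] at h1
      rw [← h1]
      simp [LinearMap.sum_apply, map_sum]
    simpa [LinearMap.sum_apply, quotSemi] using LinearMap.congr_fun this w

theorem IsBaseChangeAlong.projective [Module.Finite R M] [Module.Projective R M]
    {ψ : M →ₛₗ[φ] N} (h : IsBaseChangeAlong ψ) : Module.Projective S N := by
  let : Algebra R S := φ.toAlgebra
  let : Module R N := Module.compHom N φ
  have : IsScalarTower R S N := ⟨fun r s v => mul_smul (φ r) s v⟩
  exact Module.Projective.of_equiv (IsBaseChange.equiv h)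

theorem IsBaseChangeAlong.rank [Module.Finite R M] [Module.Projective R M]
    {ψ : M →ₛₗ[φ] N} (h : IsBaseChangeAlong ψ) (k : ℕ)
    (hk : ∀ p, Module.rankAtStalk (R := R) M p = k) (p : PrimeSpectrum S) :
    Module.rankAtStalk (R := S) N p = k := by
  let : Algebra R S := φ.toAlgebra
  let : Module R N := Module.compHom N φ
  have : IsScalarTower R S N := ⟨fun r s v => mul_smul (φ r) s v⟩
  rw [Module.rankAtStalk_isBaseChange h, hk]

end Algebra

/-! ### Spaces over `ℂ` as functors of points -/

/-- Set-valued functors on commutative `ℂ`-algebras. A `ℂ`-scheme `X` is identified with its functor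
of points `R ↦ X(R) = Hom_ℂ(Spec R, X)`; this is a fully faithful embedding, so morphisms
(isomorphisms) of `ℂ`-schemes are natural transformations (isomorphisms) of these functors. -/
abbrev Space : Type 1 := CommAlgCat.{0} ℂ ⥤ Type

/-- The point `Spec ℂ`. -/
def pt : Space := (Functor.const _).obj PUnit

/-- The product of two spaces. -/
abbrev prod (X Y : Space) : Space := FunctorToTypes.prod X Y

/-- A space is empty if it has no points over nonzero algebras. -/
def IsEmptySpace (X : Space) : Prop :=
  ∀ R : CommAlgCat.{0} ℂ, Nontrivial R → IsEmpty (X.obj R)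

/-! ### Vector bundles -/

/-- A vector bundle on `X`: for every `R`-point `x` of `X` a finitely generated projective
`R`-module (the pull-back of the bundle along `x : Spec R → X`), compatibly with base change. -/
structure VectorBundle (X : Space) where
  fib : ∀ {R : CommAlgCat.{0} ℂ}, X.obj R → Type
  [addCommGroup : ∀ {R : CommAlgCat.{0} ℂ} (x : X.obj R), AddCommGroup (fib x)]
  [module : ∀ {R : CommAlgCat.{0} ℂ} (x : X.obj R), Module R (fib x)]
  [finite : ∀ {R : CommAlgCat.{0} ℂ} (x : X.obj R), Module.Finite R (fib x)]
  [projective : ∀ {R : CommAlgCat.{0} ℂ} (x : X.obj R), Module.Projective R (fib x)]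
  res : ∀ {R S : CommAlgCat.{0} ℂ} (f : R ⟶ S) {x : X.obj R} {y : X.obj S}, X.map f x = y →
    fib x →ₛₗ[f.hom.toRingHom] fib y
  res_id : ∀ {R : CommAlgCat.{0} ℂ} {x : X.obj R} (h : X.map (𝟙 R) x = x) (v : fib x),
    res (𝟙 R) h v = v
  res_comp : ∀ {R S T : CommAlgCat.{0} ℂ} (f : R ⟶ S) (g : S ⟶ T) {x : X.obj R} {y : X.obj S}
    {z : X.obj T} (h₁ : X.map f x = y) (h₂ : X.map g y = z) (h₃ : X.map (f ≫ g) x = z) (v : fib x),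
    res (f ≫ g) h₃ v = res g h₂ (res f h₁ v)
  isBaseChange : ∀ {R S : CommAlgCat.{0} ℂ} (f : R ⟶ S) {x : X.obj R} {y : X.obj S}
    (h : X.map f x = y), IsBaseChangeAlong (res f h)

namespace VectorBundle

attribute [instance] addCommGroup module finite projective

variable {X Y : Space}

/-- The trivial bundle of rank `r`. -/
def trivial (X : Space) (r : ℕ) : VectorBundle X where
  fib {R} _ := Fin r → R
  res f _ _ _ := powSemi r (ringSemi f.hom.toRingHom)
  res_id _ _ := rfl
  res_comp _ _ _ _ _ _ _ _ _ := rfl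
  isBaseChange _ _ _ _ := (isBaseChangeAlong_ringSemi _).pow r

/-- The pull-back of a vector bundle. -/
def pullback (p : Y ⟶ X) (E : VectorBundle X) : VectorBundle Y where
  fib {R} y := E.fib (p.app R y)
  res f _ _ h := E.res f (by rw [← h, NatTrans.naturality_apply])
  res_id _ v := E.res_id _ v
  res_comp f g _ _ _ _ _ _ v := E.res_comp f g _ _ _ v
  isBaseChange f _ _ _ := E.isBaseChange f _

/-- The dual bundle. -/
def dual (E : VectorBundle X) : VectorBundle X where
  fib {R} x := Module.Dual R (E.fib x)
  res f _ _ h := (E.isBaseChange f h).dualMap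
  res_id {R x} h l := (E.isBaseChange (𝟙 R) h).ext fun v => by
    rw [IsBaseChangeAlong.dualMap_apply, E.res_id h]; rfl
  res_comp f g _ _ _ h₁ h₂ h₃ l := (E.isBaseChange (f ≫ g) h₃).ext fun v => by
    rw [IsBaseChangeAlong.dualMap_apply, E.res_comp f g h₁ h₂ h₃,
      IsBaseChangeAlong.dualMap_apply, IsBaseChangeAlong.dualMap_apply]; rfl
  isBaseChange f _ _ h := (E.isBaseChange f h).dual

/-- The tensor product of two vector bundles. -/
def tensor (E F : VectorBundle X) : VectorBundle X where
  fib {R} x := E.fib x ⊗[R] F.fib x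
  res f _ _ h := TensorProduct.map (E.res f h) (F.res f h)
  res_id {R x} h v := by
    induction v with
    | zero => exact map_zero _
    | add a b ha hb => rw [map_add, ha, hb]
    | tmul a b => rw [TensorProduct.map_tmul, E.res_id, F.res_id]
  res_comp f g _ _ _ h₁ h₂ h₃ v := by
    induction v with
    | zero => rw [map_zero, map_zero, map_zero]
    | add a b ha hb => simp only [map_add, ha, hb]
    | tmul a b =>
      simp only [TensorProduct.map_tmul, E.res_comp f g h₁ h₂ h₃, F.res_comp f g h₁ h₂ h₃]
  isBaseChange f _ _ h := (E.isBaseChange f h).tensor (F.isBaseChange f h)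

/-- The direct sum of two vector bundles. -/
def directSum (E F : VectorBundle X) : VectorBundle X where
  fib x := E.fib x × F.fib x
  res f _ _ h := prodSemi (E.res f h) (F.res f h)
  res_id h _ := Prod.ext (E.res_id h _) (F.res_id h _)
  res_comp f g _ _ _ h₁ h₂ h₃ _ :=
    Prod.ext (E.res_comp f g h₁ h₂ h₃ _) (F.res_comp f g h₁ h₂ h₃ _)
  isBaseChange f _ _ h := (E.isBaseChange f h).prod (F.isBaseChange f h)

/-- The direct sum of `r` copies of a vector bundle. -/
def power (E : VectorBundle X) (r : ℕ) : VectorBundle X where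
  fib x := Fin r → E.fib x
  projective _ := projective_pow r
  res f _ _ h := powSemi r (E.res f h)
  res_id h _ := funext fun _ => E.res_id h _
  res_comp f g _ _ _ h₁ h₂ h₃ _ := funext fun _ => E.res_comp f g h₁ h₂ h₃ _
  isBaseChange f _ _ h := (E.isBaseChange f h).pow r

/-- The external tensor product `E ⊠ F` on `X × Y`. -/
def box (E : VectorBundle X) (F : VectorBundle Y) : VectorBundle (prod X Y) :=
  (E.pullback FunctorToTypes.prod.fst).tensor (F.pullback FunctorToTypes.prod.snd)

/-- The structure of `ℂ`-vector space on the fibres. -/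
instance complexModule (E : VectorBundle X) {R : CommAlgCat.{0} ℂ} (x : X.obj R) :
    Module ℂ (E.fib x) :=
  Module.compHom (E.fib x) (algebraMap ℂ R)

/-- The vector space `H⁰(X, E)` of global sections. -/
def sections (E : VectorBundle X) :
    Submodule ℂ (∀ (R : CommAlgCat.{0} ℂ) (x : X.obj R), E.fib x) where
  carrier := {s | ∀ {R S : CommAlgCat.{0} ℂ} (f : R ⟶ S) {x : X.obj R} {y : X.obj S}
    (h : X.map f x = y), E.res f h (s R x) = s S y}
  add_mem' hs ht R S f x y h := by
    simp only [Pi.add_apply, map_add, hs f h, ht f h]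
  zero_mem' f _ _ _ := map_zero _
  smul_mem' c s hs R S f x y h := by
    show E.res f h (algebraMap ℂ R c • s R x) = algebraMap ℂ S c • s S y
    rw [LinearMap.map_smulₛₗ, hs f h]
    congr 1
    exact f.hom.commutes c

/-- The zero locus of a section: a point `x : Spec R → X` factors through it if and only if the
pull-back of the section along `x` vanishes. -/
def zeroLocus {E : VectorBundle X} (s : E.sections) : Subfunctor X where
  obj R := {x | s.1 R x = 0}
  map {R S} f x hx := by
    show s.1 S (X.map f x) = 0
    rw [← s.2 f (x := x) rfl, show s.1 R x = 0 from hx, map_zero]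

end VectorBundle

/-- `P` holds for a general element of the complex vector space `H`, that is, on a nonempty
Zariski open subset: there is a polynomial function on `H`, not identically zero, outside the zero
set of which `P` holds. -/
def ForGeneral {H : Type*} [AddCommGroup H] [Module ℂ H] (P : H → Prop) : Prop :=
  ∃ (r : ℕ) (l : Fin r → Module.Dual ℂ H) (p : MvPolynomial (Fin r) ℂ),
    (∃ s, MvPolynomial.eval (fun i => l i s) p ≠ 0) ∧
      ∀ s, MvPolynomial.eval (fun i => l i s) p ≠ 0 → P s

/-! ### Grassmann bundles, Grassmannians and flag manifolds -/

/-- An `R`-point of the Grassmann bundle `Gr(k, E)`: an `R`-point `x` of `X` and a submodule of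
`E.fib x`, of constant rank `k` and with projective quotient (hence locally a direct factor). -/
structure GrassPoint {X : Space} (k : ℕ) (E : VectorBundle X) (R : CommAlgCat.{0} ℂ) where
  base : X.obj R
  sub : Submodule R (E.fib base)
  projective_quot : Module.Projective R (E.fib base ⧸ sub)
  rank_eq : ∀ p : PrimeSpectrum R, Module.rankAtStalk (R := R) sub p = k

namespace GrassPoint

attribute [instance] projective_quot

variable {X : Space} {k : ℕ} {E : VectorBundle X} {R S T : CommAlgCat.{0} ℂ}

instance (p : GrassPoint k E R) : Module.Finite R p.sub := finite_sub p.sub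
instance (p : GrassPoint k E R) : Module.Projective R p.sub := projective_sub p.sub

/-- The base change of a point of the Grassmann bundle along `f`, where `y` is the base change of
the base point. -/
def push (f : R ⟶ S) (p : GrassPoint k E R) (y : X.obj S) (h : X.map f p.base = y) :
    GrassPoint k E S where
  base := y
  sub := pushSub (E.res f h) p.sub
  projective_quot := ((E.isBaseChange f h).quot p.sub _ rfl).projective
  rank_eq := ((E.isBaseChange f h).sub p.sub _ rfl).rank k p.rank_eq

theorem push_congr (f : R ⟶ S) (p : GrassPoint k E R) {y y' : X.obj S} (h : X.map f p.base = y)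
    (h' : X.map f p.base = y') : p.push f y h = p.push f y' h' := by
  subst h; subst h'; rfl

theorem pushSub_comp (f : R ⟶ S) (g : S ⟶ T) {x : X.obj R} {y : X.obj S} {z : X.obj T}
    (h₁ : X.map f x = y) (h₂ : X.map g y = z) (h₃ : X.map (f ≫ g) x = z)
    (N : Submodule R (E.fib x)) :
    pushSub (E.res (f ≫ g) h₃) N = pushSub (E.res g h₂) (pushSub (E.res f h₁) N) := by
  apply le_antisymm
  · refine Submodule.span_le.2 ?_
    rintro _ ⟨v, hv, rfl⟩
    rw [E.res_comp f g h₁ h₂ h₃]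
    exact Submodule.subset_span ⟨_, Submodule.subset_span ⟨v, hv, rfl⟩, rfl⟩
  · refine Submodule.span_le.2 ?_
    rintro _ ⟨w, hw, rfl⟩
    induction hw using Submodule.span_induction with
    | mem w hw =>
      obtain ⟨v, hv, rfl⟩ := hw
      rw [← E.res_comp f g h₁ h₂ h₃]
      exact Submodule.subset_span ⟨v, hv, rfl⟩
    | zero => rw [map_zero]; exact zero_mem _
    | add a b _ _ ha hb => rw [map_add]; exact add_mem ha hb
    | smul c a _ ha => rw [LinearMap.map_smulₛₗ]; exact Submodule.smul_mem _ _ ha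

theorem push_comp (f : R ⟶ S) (g : S ⟶ T) (p : GrassPoint k E R) {y : X.obj S} {z : X.obj T}
    (h₁ : X.map f p.base = y) (h₂ : X.map g y = z) (h₃ : X.map (f ≫ g) p.base = z) :
    p.push (f ≫ g) z h₃ = (p.push f y h₁).push g z h₂ := by
  simp only [push, pushSub_comp f g h₁ h₂ h₃]
  rfl

theorem pushSub_id {x : X.obj R} (h : X.map (𝟙 R) x = x) (N : Submodule R (E.fib x)) :
    pushSub (E.res (𝟙 R) h) N = N := by
  apply le_antisymm
  · refine Submodule.span_le.2 ?_
    rintro _ ⟨v, hv, rfl⟩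
    rw [E.res_id h]
    exact hv
  · exact fun v hv => Submodule.subset_span ⟨v, hv, E.res_id h v⟩

theorem push_id (p : GrassPoint k E R) (h : X.map (𝟙 R) p.base = p.base) :
    p.push (𝟙 R) p.base h = p := by
  obtain ⟨x, N, _, _⟩ := p
  simp only [push, pushSub_id h]

end GrassPoint

section Grassmann

variable {X : Space}

/-- The Grassmann bundle `Gr(k, E)` over `X` of rank `k` subbundles of `E`. -/
def GrassBundle (k : ℕ) (E : VectorBundle X) : Space where
  obj R := GrassPoint k E R
  map f := ↾fun p => p.push f (X.map f p.base) rfl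
  map_id _ := by
    ext p
    have h : X.map (𝟙 _) p.base = p.base := by rw [X.map_id]; rfl
    exact (p.push_congr _ rfl h).trans (p.push_id h)
  map_comp f g := by
    ext p
    have h : X.map (f ≫ g) p.base = X.map g (X.map f p.base) := by rw [X.map_comp]; rfl
    exact (p.push_congr _ rfl h).trans (p.push_comp f g rfl rfl h)

/-- The projection `Gr(k, E) → X`. -/
def GrassBundle.proj (k : ℕ) (E : VectorBundle X) : GrassBundle k E ⟶ X where
  app R := ↾fun p => p.base
  naturality _ _ _ := rfl

/-- The tautological subbundle `U` on `Gr(k, E)`. -/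
def tautSub (k : ℕ) (E : VectorBundle X) : VectorBundle (GrassBundle k E) where
  fib {R} (p : GrassPoint k E R) := p.sub
  addCommGroup {R} (p : GrassPoint k E R) := inferInstanceAs (AddCommGroup p.sub)
  module {R} (p : GrassPoint k E R) := inferInstanceAs (Module R p.sub)
  finite {R} (p : GrassPoint k E R) := inferInstanceAs (Module.Finite R p.sub)
  projective {R} (p : GrassPoint k E R) := inferInstanceAs (Module.Projective R p.sub)
  res f p q h := subSemi (E.res f (congrArg GrassPoint.base h)) _ _ (by subst h; rfl)
  res_id h v := Subtype.ext (E.res_id _ _)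
  res_comp f g _ _ _ h₁ h₂ h₃ v := Subtype.ext (E.res_comp f g _ _ _ _)
  isBaseChange f p _ h :=
    have := GrassPoint.projective_quot p
    (E.isBaseChange f _).sub (GrassPoint.sub p) _ _

/-- The tautological quotient bundle `Q` on `Gr(k, E)`. -/
def tautQuot (k : ℕ) (E : VectorBundle X) : VectorBundle (GrassBundle k E) where
  fib {R} (p : GrassPoint k E R) := E.fib p.base ⧸ p.sub
  addCommGroup {R} (p : GrassPoint k E R) := inferInstanceAs (AddCommGroup (E.fib p.base ⧸ p.sub))
  module {R} (p : GrassPoint k E R) := inferInstanceAs (Module R (E.fib p.base ⧸ p.sub))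
  finite {R} (p : GrassPoint k E R) := inferInstanceAs (Module.Finite R (E.fib p.base ⧸ p.sub))
  projective {R} (p : GrassPoint k E R) := p.projective_quot
  res f p q h := quotSemi (E.res f (congrArg GrassPoint.base h)) _ _ (by subst h; rfl)
  res_id {R} {p : GrassPoint k E R} h v := by
    obtain ⟨v, rfl⟩ := Submodule.mkQ_surjective p.sub v
    exact congrArg (Submodule.mkQ p.sub) (E.res_id _ _)
  res_comp {R S T} f g (p : GrassPoint k E R) _ (r : GrassPoint k E T) h₁ h₂ h₃ v := by
    obtain ⟨v, rfl⟩ := Submodule.mkQ_surjective p.sub v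
    exact congrArg (Submodule.mkQ r.sub) (E.res_comp f g _ _ _ _)
  isBaseChange f p _ h :=
    have := GrassPoint.projective_quot p
    (E.isBaseChange f _).quot (GrassPoint.sub p) _ _

end Grassmann

/-- The Grassmannian `Gr(k, n)` of `k`-dimensional subspaces of `ℂⁿ`. -/
abbrev Gr (k n : ℕ) : Space := GrassBundle k (VectorBundle.trivial pt n)

/-- The submodule of `Rⁿ` given by an `R`-point of `Gr(k, n)`. -/
def Gr.toSubmodule {k n : ℕ} {R : CommAlgCat.{0} ℂ} (p : (Gr k n).obj R) :
    Submodule R (Fin n → R) :=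
  GrassPoint.sub p

/-- The tautological bundle on `Gr(k, n)`. -/
abbrev U (k n : ℕ) : VectorBundle (Gr k n) := tautSub k _

/-- The quotient bundle on `Gr(k, n)`. -/
abbrev Q (k n : ℕ) : VectorBundle (Gr k n) := tautQuot k _

theorem Gr.toSubmodule_map {k n : ℕ} {R S : CommAlgCat.{0} ℂ} (f : R ⟶ S) (p : (Gr k n).obj R) :
    Gr.toSubmodule ((Gr k n).map f p) =
      pushSub (powSemi n (ringSemi f.hom.toRingHom)) (Gr.toSubmodule p) :=
  rfl

/-- The flag manifold `Fl(k₁, k₂, n)`, inside `Gr(k₁, n) × Gr(k₂, n)`. It is empty if `k₁ > k₂`. -/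
def flagSub (k₁ k₂ n : ℕ) : Subfunctor (prod (Gr k₁ n) (Gr k₂ n)) where
  obj _ := {p | Gr.toSubmodule p.1 ≤ Gr.toSubmodule p.2}
  map f _ hp := pushSub_mono (powSemi n (ringSemi f.hom.toRingHom)) hp

/-- The flag manifold `Fl(k₁, k₂, n)` as a space. -/
abbrev Fl (k₁ k₂ n : ℕ) : Space := (flagSub k₁ k₂ n).toFunctor

/-- The pull-back to `Fl(k₁, k₂, n)` of the quotient bundle of `Gr(k₂, n)`. -/
def Fl.Q₂ (k₁ k₂ n : ℕ) : VectorBundle (Fl k₁ k₂ n) :=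
  (Q k₂ n).pullback ((flagSub k₁ k₂ n).ι ≫ FunctorToTypes.prod.snd)

/-- The closed subspace of `Gr(k, n)` of subspaces containing a given subspace `K` of `ℂⁿ`. -/
def Gr.containing (k n : ℕ) (K : Submodule ℂ (Fin n → ℂ)) : Subfunctor (Gr k n) where
  obj R := {p | ∀ v ∈ K, (fun i => algebraMap ℂ R (v i)) ∈ Gr.toSubmodule p}
  map {R S} f p hp v hv := by
    have h := mem_pushSub (powSemi n (ringSemi f.hom.toRingHom)) (hp v hv)
    have e : (powSemi n (ringSemi f.hom.toRingHom) fun i => algebraMap ℂ R (v i)) =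
        fun i => algebraMap ℂ S (v i) := funext fun i => f.hom.commutes (v i)
    rw [e] at h
    exact h

/-! ### Open and closed subspaces, fibres, birational morphisms, blow-ups -/

/-- `V` is open in `X`: for `x : Spec R → X`, the preimage of `V` is the open subset of `Spec R`
complementary to the zero set of an ideal. -/
def IsOpenSub {X : Space} (V : Subfunctor X) : Prop :=
  ∀ (R : CommAlgCat.{0} ℂ) (x : X.obj R), ∃ I : Ideal R, ∀ (S : CommAlgCat.{0} ℂ) (f : R ⟶ S),
    X.map f x ∈ V.obj S ↔ I.map f.hom = ⊤

/-- The preimage of `C` under `x : Spec R → X` is the closed subscheme `Spec (R ⧸ I)`. -/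
def PreimageIsCutBy {X : Space} (C : Subfunctor X) {R : CommAlgCat.{0} ℂ} (x : X.obj R)
    (I : Ideal R) : Prop :=
  ∀ (S : CommAlgCat.{0} ℂ) (f : R ⟶ S), X.map f x ∈ C.obj S ↔ I ≤ RingHom.ker f.hom

/-- `C` is a closed subspace of `X`. -/
def IsClosedSub {X : Space} (C : Subfunctor X) : Prop :=
  ∀ (R : CommAlgCat.{0} ℂ) (x : X.obj R), ∃ I : Ideal R, PreimageIsCutBy C x I

/-- An open subspace is (topologically) dense if it meets every nonempty open subspace. -/
def IsDenseSub {X : Space} (V : Subfunctor X) : Prop :=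
  ∀ W : Subfunctor X, IsOpenSub W → ¬ IsEmptySpace W.toFunctor →
    ¬ IsEmptySpace (V ⊓ W).toFunctor

/-- A morphism `p : Y → X` is birational if it restricts to an isomorphism `p⁻¹(V) ≅ V` over a
dense open subspace `V` of `X` with dense preimage. -/
def IsBirational {X Y : Space} (p : Y ⟶ X) : Prop :=
  ∃ V : Subfunctor X, IsOpenSub V ∧ IsDenseSub V ∧ IsDenseSub (V.preimage p) ∧
    IsIso (V.fromPreimage p)

/-- The (scheme-theoretic) fibre of `p : Y → X` over a complex point of `X`. -/
def fiber {X Y : Space} (p : Y ⟶ X) (x : X.obj (CommAlgCat.of ℂ ℂ)) : Subfunctor Y where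
  obj R := {y | p.app R y = X.map (CommAlgCat.ofHom (Algebra.ofId ℂ R)) x}
  map {R S} f y hy := by
    show p.app S (Y.map f y) = _
    rw [NatTrans.naturality_apply, show p.app R y = _ from hy, ← Functor.map_comp_apply]
    have e : CommAlgCat.ofHom (Algebra.ofId ℂ R) ≫ f = CommAlgCat.ofHom (Algebra.ofId ℂ S) :=
      CommAlgCat.hom_ext (AlgHom.ext fun c => f.hom.commutes c)
    rw [e]

/-- `y : Spec R → Y` is an open immersion. -/
def IsAffineChart {Y : Space} {R : CommAlgCat.{0} ℂ} (y : Y.obj R) : Prop :=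
  (∀ (S : CommAlgCat.{0} ℂ) (f g : R ⟶ S), Y.map f y = Y.map g y → f = g) ∧
    ∃ V : Subfunctor Y, IsOpenSub V ∧ ∀ S, V.obj S = {z | ∃ f : R ⟶ S, Y.map f y = z}

/-- The closed subscheme of `Spec R` obtained by pulling back `C` along `x : Spec R → X` is an
effective Cartier divisor, i.e. its ideal is an invertible module. -/
def IsCartierAt {X : Space} (C : Subfunctor X) {R : CommAlgCat.{0} ℂ} (x : X.obj R) : Prop :=
  ∃ I : Ideal R, PreimageIsCutBy C x I ∧ Module.Invertible R I

/-- `p : Y → X` is the blow-up of `X` along the closed subspace `C`, characterised by its universal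
property: the preimage of `C` in `Y` is an effective Cartier divisor, and every morphism
`T → X` such that the preimage of `C` in `T` is an effective Cartier divisor factors uniquely
through `p`. Both conditions are local, so the first is tested on an affine open cover of `Y`
and the second on affine schemes `T`. -/
structure IsBlowUp {X Y : Space} (p : Y ⟶ X) (C : Subfunctor X) : Prop where
  isClosed : IsClosedSub C
  cartier : ∃ (ι : Type) (R : ι → CommAlgCat.{0} ℂ) (y : ∀ i, Y.obj (R i)),
    (∀ i, IsAffineChart (y i)) ∧
    (∀ F : CommAlgCat.{0} ℂ, IsField F → ∀ z : Y.obj F, ∃ i, ∃ f : R i ⟶ F, Y.map f (y i) = z) ∧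
    ∀ i, IsCartierAt C (p.app _ (y i))
  universal : ∀ (R : CommAlgCat.{0} ℂ) (x : X.obj R), IsCartierAt C x → ∃! y : Y.obj R, p.app R y = x

/-! ### The zero loci -/

/-- The vector bundle `Q ⊠ U^∨` on `Gr(a, m) × Gr(b, n)`. -/
def QBoxUDual (a m b n : ℕ) : VectorBundle (prod (Gr a m) (Gr b n)) :=
  (Q a m).box (U b n).dual

/-- The first projection of a subspace of a product. -/
def fstOn {X Y : Space} (Z : Subfunctor (prod X Y)) : Z.toFunctor ⟶ X :=
  Z.ι ≫ FunctorToTypes.prod.fst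

/-- The second projection of a subspace of a product. -/
def sndOn {X Y : Space} (Z : Subfunctor (prod X Y)) : Z.toFunctor ⟶ Y :=
  Z.ι ≫ FunctorToTypes.prod.snd

end FunctorOfPoints
end

open FunctorOfPoints

open CategoryTheory TensorProduct

noncomputable section

namespace FunctorOfPoints

/-! ### Direct summands of constant rank -/

section Summand

variable {R : Type} [CommRing R] {M N : Type} [AddCommGroup M] [Module R M]
  [AddCommGroup N] [Module R N]

/-! A section of `Q ⊠ U^∨` amounts to a natural family of pairings `A^⊥ × B → R`. Every such family
has the form `(q, v) ↦ q · P v` for a complex `m × n` matrix `P` (`boxSec_surjective`), and its zero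
locus is `{(A, B) : P B ⊆ A}` over every algebra (`mem_zeroLocus_boxSec`). A general `P` is
surjective. Put `K = ker P` and split `ℂⁿ = ℂᵐ ⊕ K`. Then `P⁻¹(A) ≅ A ⊕ K`, and the choice of `B`
inside it gives the Grassmann bundle (`Splitting.bundleIso`). Moreover `A ↦ P⁻¹(A)` is a bijection
onto the `(a + n - m)`-dimensional subspaces containing `K`. Sections of `Q₂^{⊕(n-m)}` are `n - m`
vectors (`flSec_surjective`), and such a section vanishes at `B ⊆ C` when `C` contains these
vectors; this gives the flag model (`Splitting.nonempty_flagIso`). If `b > a + n - m` there is no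
room for `B`.

The computation of the global sections uses only projective lines. Over a field, a pencil of
subspaces is a point over `F[X]`, so a section is polynomial in the parameter `t` and, from the
other end of the pencil, in `1/t`; hence it is constant, or affine when it is twisted once. Any two
subspaces are joined by pencils, so the pairings do not depend on `A` and `B` and are bilinear in
`q` and `v`. A section vanishing over all fields is zero: points over local rings have frames,
frames are specialisations of frames over domains, and domains embed in their fraction fields.

For `a = b`, the fibre over `B` consists of the `A` containing `P(B)`, which has dimension `a - d`.
Where `P` is split injective on `B` the only choice is `A = P(B)`, and this locus is open by
Cramer's rule (`Gr.mem_injOn_iff_minorIdeal`). It is dense because each field point `(A, B)` of the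
zero locus deforms over `F⟦X⟧` to one with `P` generically injective on `B`
(`Splitting.exists_deformation`).

For `K` a line spanned by `k`, the condition `K ⊆ B` is cut out by the ideal of the values `q · k`
with `q ∈ B^⊥`. If this ideal is invertible, the kernel of `q ↦ q · k` on `B^⊥` is a summand of rank
one less, and its orthogonal complement is the only possible `P⁻¹(A)`; this is the universal
property (`Splitting.existsUnique_of_isCartierAt`). Conversely, in charts by pairs of graphs the
ideal is generated by one nonzero affine-linear polynomial (`incidenceIdeal_chartSnd`,
`chartEqn_ne_zero`), so the preimage of the centre is a Cartier divisor. -/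

theorem rank_add_rank_quot [Module.Finite R M] [Module.Projective R M] (L : Submodule R M)
    [Module.Projective R (M ⧸ L)] (p : PrimeSpectrum R) :
    Module.rankAtStalk (R := R) L p + Module.rankAtStalk (R := R) (M ⧸ L) p =
      Module.rankAtStalk (R := R) M p := by
  have := finite_sub L
  have := projective_sub L
  obtain ⟨σ, hσ⟩ := Module.projective_lifting_property L.mkQ LinearMap.id L.mkQ_surjective
  have e : (L × (M ⧸ L)) ≃ₗ[R] M := by
    refine LinearEquiv.ofBijective (L.subtype.coprod σ) ⟨?_, ?_⟩
    · rw [← LinearMap.ker_eq_bot, LinearMap.ker_eq_bot']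
      rintro ⟨x, y⟩ h
      have h1 := congrArg L.mkQ h
      have h2 := LinearMap.congr_fun hσ y
      simp only [LinearMap.comp_apply, LinearMap.id_apply] at h2
      simp only [LinearMap.coprod_apply, map_add, h2, map_zero] at h1
      have h3 : L.mkQ (L.subtype x) = 0 := by simp
      rw [h3, zero_add] at h1
      subst h1
      simp only [LinearMap.coprod_apply, map_zero, add_zero] at h
      simpa using h
    · intro v
      have h2 := LinearMap.congr_fun hσ (L.mkQ v)
      refine ⟨(⟨v - σ (L.mkQ v), ?_⟩, L.mkQ v), by simp⟩
      rw [← Submodule.Quotient.mk_eq_zero, ← Submodule.mkQ_apply, map_sub]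
      simp only [LinearMap.comp_apply, LinearMap.id_apply] at h2
      rw [h2, sub_self]
  rw [← Module.rankAtStalk_eq_of_equiv e, Module.rankAtStalk_prod, Pi.add_apply]

theorem projective_quot_of_retraction [Module.Projective R M] (L : Submodule R M)
    (π : M →ₗ[R] M) (h₁ : ∀ v, π v ∈ L) (h₂ : ∀ v ∈ L, π v = v) :
    Module.Projective R (M ⧸ L) := by
  refine Module.Projective.of_split (L.liftQ (LinearMap.id - π) fun v hv => ?_) L.mkQ ?_
  · simp [h₂ v hv]
  · ext v
    simp [h₁ v]

/-- A submodule `L` of `M` which is a direct summand of constant rank `k`. -/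
def IsSummand (k : ℕ) (L : Submodule R M) : Prop :=
  Module.Projective R (M ⧸ L) ∧ ∀ p, Module.rankAtStalk (R := R) L p = k

/-- `L` is also a summand of `L'`, and the quotient is projective of rank 0 at every prime, hence
zero. This is why points of Grassmannians can be compared by checking a single inclusion. -/
theorem IsSummand.eq_of_le [Module.Finite R M] [Module.Projective R M] {k : ℕ}
    {L L' : Submodule R M} (h : IsSummand k L) (h' : IsSummand k L') (hl : L ≤ L') : L = L' := by
  refine le_antisymm hl ?_
  have := h.1
  have := h'.1
  have := finite_sub L
  have := projective_sub L
  have := finite_sub L'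
  have := projective_sub L'
  obtain ⟨π, hπ⟩ := exists_projection L
  let L₀ : Submodule R L' := L.comap L'.subtype
  have : Module.Projective R (L' ⧸ L₀) := by
    refine projective_quot_of_retraction L₀
      ((Submodule.inclusion hl).comp (π.comp L'.subtype)) (fun v => ?_) (fun v hv => ?_)
    · simp [L₀]
    · ext
      simpa using congrArg Subtype.val (hπ ⟨v, hv⟩)
  have e : L₀ ≃ₗ[R] L := Submodule.comapSubtypeEquivOfLe hl
  have h0 : ∀ p, Module.rankAtStalk (R := R) (L' ⧸ L₀) p = 0 := fun p => by
    have := rank_add_rank_quot L₀ p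
    rw [Module.rankAtStalk_eq_of_equiv e, h.2, h'.2] at this
    omega
  have hs : Subsingleton (L' ⧸ L₀) :=
    Module.rankAtStalk_eq_zero_iff_subsingleton.1 (funext h0)
  rw [Submodule.Quotient.subsingleton_iff] at hs
  intro v hv
  have : (⟨v, hv⟩ : L') ∈ L₀ := hs ▸ Submodule.mem_top
  exact this

theorem projective_sub_quot [Module.Projective R M] {L L' : Submodule R M} (hl : L ≤ L')
    [Module.Projective R (M ⧸ L)] [Module.Projective R (M ⧸ L')] :
    Module.Projective R (L' ⧸ L.comap L'.subtype) := by
  have := projective_sub L'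
  obtain ⟨π, hπ⟩ := exists_projection L
  refine projective_quot_of_retraction _
      ((Submodule.inclusion hl).comp (π.comp L'.subtype)) (fun v => ?_) (fun v hv => ?_)
  · simp
  · ext
    simpa using congrArg Subtype.val (hπ ⟨v, hv⟩)

theorem projective_quot_trans [Module.Projective R M] {L L' : Submodule R M}
    [Module.Projective R (L' ⧸ L.comap L'.subtype)] [Module.Projective R (M ⧸ L')] (hl : L ≤ L') :
    Module.Projective R (M ⧸ L) := by
  have := projective_sub L'
  obtain ⟨π', hπ'⟩ := exists_projection L'
  obtain ⟨π, hπ⟩ := exists_projection (L.comap L'.subtype)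
  refine projective_quot_of_retraction L
    (L'.subtype ∘ₗ (L.comap L'.subtype).subtype ∘ₗ π ∘ₗ π') (fun v => ?_) (fun v hv => ?_)
  · exact (π (π' v)).2
  · have h1 := hπ' ⟨v, hl hv⟩
    have h2 := hπ ⟨⟨v, hl hv⟩, hv⟩
    simp only at h1 h2
    simp [h1, h2]

/-- The image of a summand under a split injection. -/
theorem projective_quot_map [Module.Projective R M] [Module.Projective R N] {L : Submodule R M}
    [Module.Projective R (M ⧸ L)] (i : M →ₗ[R] N) (r : N →ₗ[R] M) (h : ∀ v, r (i v) = v) :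
    Module.Projective R (N ⧸ L.map i) := by
  obtain ⟨π, hπ⟩ := exists_projection L
  refine projective_quot_of_retraction _ (i ∘ₗ L.subtype ∘ₗ π ∘ₗ r) (fun v => ?_) (fun v hv => ?_)
  · exact ⟨_, (π (r v)).2, rfl⟩
  · obtain ⟨w, hw, rfl⟩ := hv
    have := hπ ⟨w, hw⟩
    simp only at this
    simp [h, this]

theorem IsSummand.map [Module.Projective R M] [Module.Projective R N] {k : ℕ}
    {L : Submodule R M} (hL : IsSummand k L) (i : M →ₗ[R] N) (r : N →ₗ[R] M)
    (h : ∀ v, r (i v) = v) : IsSummand k (L.map i) := by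
  have := hL.1
  refine ⟨projective_quot_map i r h, fun p => ?_⟩
  have hi : Function.Injective i := Function.LeftInverse.injective h
  rw [← Module.rankAtStalk_eq_of_equiv (Submodule.equivMapOfInjective i hi L), hL.2]

theorem rank_eq_of_injective {k : ℕ} {L : Submodule R M} (i : M →ₗ[R] N)
    (hi : Function.Injective i) {L' : Submodule R N} (h : L.map i = L')
    (hL : ∀ p, Module.rankAtStalk (R := R) L' p = k) (p : PrimeSpectrum R) :
    Module.rankAtStalk (R := R) L p = k := by
  subst h
  rw [Module.rankAtStalk_eq_of_equiv (Submodule.equivMapOfInjective i hi L), hL]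

/-- The quotient by the preimage of a submodule under a surjection. -/
def quotComapEquiv (φ : M →ₗ[R] N) (hφ : Function.Surjective φ) (A : Submodule R N) :
    (M ⧸ A.comap φ) ≃ₗ[R] (N ⧸ A) :=
  (Submodule.quotEquivOfEq _ _ (by rw [LinearMap.ker_comp, Submodule.ker_mkQ])).trans
    ((A.mkQ.comp φ).quotKerEquivOfSurjective (A.mkQ_surjective.comp hφ))

/-! ### Direct summands of free modules -/

variable {m n : ℕ}

theorem rank_fun (p : PrimeSpectrum R) : Module.rankAtStalk (R := R) (Fin n → R) p = n := by
  have : Nontrivial R := p.nontrivial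
  rw [Module.rankAtStalk_eq_finrank_of_free]
  simp

/-- Additivity of the rank moves the condition to the quotient, which is unchanged by taking
preimages under surjections. -/
theorem isSummand_iff_rank_quot {k : ℕ} {L : Submodule R (Fin n → R)} :
    IsSummand k L ↔ Module.Projective R ((Fin n → R) ⧸ L) ∧
      ∀ p, k + Module.rankAtStalk (R := R) ((Fin n → R) ⧸ L) p = n := by
  refine and_congr_right fun h => forall_congr' fun p => ?_
  have := rank_add_rank_quot L p
  rw [rank_fun] at this
  omega

theorem IsSummand.le {k : ℕ} [Nontrivial R] {L : Submodule R (Fin n → R)} (h : IsSummand k L) :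
    k ≤ n := by
  obtain ⟨p⟩ : Nonempty (PrimeSpectrum R) := inferInstance
  have := (isSummand_iff_rank_quot.1 h).2 p
  omega

/-- Both submodules have the same quotient; `hk` is the equality of the two codimensions, written
without subtraction. -/
theorem isSummand_comap {k k' : ℕ} (φ : (Fin n → R) →ₗ[R] (Fin m → R))
    (hφ : Function.Surjective φ) (hk : k + m = k' + n) {A : Submodule R (Fin m → R)} :
    IsSummand k (A.comap φ) ↔ IsSummand k' A := by
  let e := quotComapEquiv φ hφ A
  rw [isSummand_iff_rank_quot, isSummand_iff_rank_quot]
  constructor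
  · rintro ⟨h₁, h₂⟩
    refine ⟨.of_equiv e, fun p => ?_⟩
    have := h₂ p
    rw [Module.rankAtStalk_eq_of_equiv e] at this
    omega
  · rintro ⟨h₁, h₂⟩
    refine ⟨.of_equiv e.symm, fun p => ?_⟩
    have := h₂ p
    rw [← Module.rankAtStalk_eq_of_equiv e] at this
    omega

theorem IsSummand.map_of_ker_le {k k' : ℕ} (φ : (Fin n → R) →ₗ[R] (Fin m → R))
    (hφ : Function.Surjective φ) (hk : k + m = k' + n) {C : Submodule R (Fin n → R)}
    (hC : IsSummand k C) (h : LinearMap.ker φ ≤ C) : IsSummand k' (C.map φ) := by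
  rw [← isSummand_comap φ hφ hk, Submodule.comap_map_eq, sup_eq_left.2 h]
  exact hC

/-- Dual bases of `M` and `N` expand `z` with coefficients that are its pairings with pure tensors
of forms. -/
theorem tensor_eq_zero_of_forall [Module.Finite R M] [Module.Projective R M] [Module.Finite R N]
    [Module.Projective R N] {z : M ⊗[R] N}
    (h : ∀ (q : Module.Dual R M) (r : Module.Dual R N),
      TensorProduct.dualDistrib R M N (q ⊗ₜ r) z = 0) : z = 0 := by
  obtain ⟨k, e, ε, he⟩ := exists_dualBasis R M
  obtain ⟨k', e', ε', he'⟩ := exists_dualBasis R N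
  have key : ∑ i, ∑ j, TensorProduct.dualDistrib R M N (ε i ⊗ₜ ε' j) z • (e i ⊗ₜ[R] e' j) = z := by
    clear h
    induction z with
    | zero => simp
    | add a b ha hb =>
      conv_rhs => rw [← ha, ← hb]
      simp only [map_add, add_smul, Finset.sum_add_distrib]
    | tmul a b =>
      conv_rhs => rw [← he a, ← he' b]
      simp only [TensorProduct.sum_tmul, TensorProduct.tmul_sum, TensorProduct.smul_tmul_smul,
        TensorProduct.dualDistrib_apply]
      exact Finset.sum_comm
  rw [← key]
  simp [h]

end Summand

/-! ### Points of Grassmannians -/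

section GrPoints

variable {k n : ℕ} {R S : CommAlgCat.{0} ℂ}

/-- The point of the Grassmannian given by a direct summand. -/
def Gr.mk (L : Submodule R (Fin n → R)) (h : IsSummand k L) : (Gr k n).obj R where
  base := PUnit.unit
  sub := L
  projective_quot := h.1
  rank_eq := h.2

theorem Gr.isSummand (A : (Gr k n).obj R) : IsSummand k (Gr.toSubmodule A) :=
  ⟨GrassPoint.projective_quot A, GrassPoint.rank_eq A⟩

instance Gr.projective_quot (A : (Gr k n).obj R) :
    Module.Projective R ((Fin n → R) ⧸ Gr.toSubmodule A) := (Gr.isSummand A).1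

theorem Gr.ext {A B : (Gr k n).obj R} (h : Gr.toSubmodule A = Gr.toSubmodule B) : A = B := by
  obtain ⟨x, L, _, _⟩ := A
  obtain ⟨y, L', _, _⟩ := B
  obtain rfl : L = L' := h
  rfl

theorem Gr.ext_of_le {A B : (Gr k n).obj R} (h : Gr.toSubmodule A ≤ Gr.toSubmodule B) : A = B :=
  Gr.ext ((Gr.isSummand A).eq_of_le (Gr.isSummand B) h)

/-- The entrywise application of `f : R → S` to vectors. -/
abbrev vmap (n : ℕ) (f : R ⟶ S) : (Fin n → R) →ₛₗ[f.hom.toRingHom] (Fin n → S) :=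
  powSemi n (ringSemi f.hom.toRingHom)

theorem vmap_apply (f : R ⟶ S) (v : Fin n → R) (i : Fin n) : vmap n f v i = f.hom (v i) := rfl

theorem Gr.toSubmodule_map' (f : R ⟶ S) (A : (Gr k n).obj R) :
    Gr.toSubmodule ((Gr k n).map f A) = pushSub (vmap n f) (Gr.toSubmodule A) := rfl

theorem pushSub_le {R S : Type} [CommRing R] [CommRing S] {φ : R →+* S}
    {M N : Type} [AddCommGroup M] [Module R M] [AddCommGroup N] [Module S N]
    {ψ : M →ₛₗ[φ] N} {L : Submodule R M} {L' : Submodule S N} :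
    pushSub ψ L ≤ L' ↔ ∀ v ∈ L, ψ v ∈ L' := by
  rw [pushSub, Submodule.span_le, Set.image_subset_iff]
  rfl

theorem Gr.map_mem (f : R ⟶ S) (A : (Gr k n).obj R) {v : Fin n → R} (h : v ∈ Gr.toSubmodule A) :
    vmap n f v ∈ Gr.toSubmodule ((Gr k n).map f A) :=
  mem_pushSub _ h

/-- To identify the base change of a point it suffices to check one inclusion. -/
theorem Gr.map_eq_of_forall_mem (f : R ⟶ S) (A : (Gr k n).obj R) (B : (Gr k n).obj S)
    (h : ∀ v ∈ Gr.toSubmodule A, vmap n f v ∈ Gr.toSubmodule B) : (Gr k n).map f A = B :=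
  Gr.ext_of_le (pushSub_le.2 h)

theorem Gr.le_of_nontrivial [Nontrivial R] (A : (Gr k n).obj R) : k ≤ n := (Gr.isSummand A).le

/-! ### The action of complex matrices -/

variable {l m : ℕ} (R)

/-- The linear map `Rⁿ → Rᵐ` given by a complex matrix. -/
def act (P : Matrix (Fin m) (Fin n) ℂ) : (Fin n → R) →ₗ[R] (Fin m → R) :=
  (P.map (algebraMap ℂ R)).mulVecLin

theorem act_apply (P : Matrix (Fin m) (Fin n) ℂ) (v : Fin n → R) (i : Fin m) :
    act R P v i = ∑ j, algebraMap ℂ R (P i j) * v j := rfl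

theorem act_mul (P : Matrix (Fin m) (Fin n) ℂ) (Q : Matrix (Fin n) (Fin l) ℂ)
    (v : Fin l → R) : act R (P * Q) v = act R P (act R Q v) := by
  simp [act, Matrix.map_mul, Matrix.mulVec_mulVec]

theorem act_one (v : Fin n → R) : act R (1 : Matrix (Fin n) (Fin n) ℂ) v = v := by
  simp [act]

theorem act_zero (v : Fin n → R) : act R (0 : Matrix (Fin m) (Fin n) ℂ) v = 0 := by
  ext i; simp [act_apply]

theorem act_add (P P' : Matrix (Fin m) (Fin n) ℂ) (v : Fin n → R) :
    act R (P + P') v = act R P v + act R P' v := by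
  ext i; simp [act_apply, add_mul, Finset.sum_add_distrib]

variable {R}

theorem vmap_act (f : R ⟶ S) (P : Matrix (Fin m) (Fin n) ℂ) (v : Fin n → R) :
    vmap m f (act R P v) = act S P (vmap n f v) := by
  ext i
  simp only [vmap_apply, act_apply, map_sum, map_mul]
  refine Finset.sum_congr rfl fun j _ => ?_
  rw [f.hom.commutes]

theorem act_of_mul_eq_one {P : Matrix (Fin m) (Fin n) ℂ} {Q : Matrix (Fin n) (Fin m) ℂ}
    (h : P * Q = 1) (v : Fin m → R) : act R P (act R Q v) = v := by
  rw [← act_mul, h, act_one]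

theorem act_surjective {P : Matrix (Fin m) (Fin n) ℂ} {Q : Matrix (Fin n) (Fin m) ℂ}
    (h : P * Q = 1) : Function.Surjective (act R P) :=
  fun v => ⟨_, act_of_mul_eq_one h v⟩

end GrPoints

/-! ### Evaluating sections -/

section Evaluation

variable {R S : CommAlgCat.{0} ℂ} {m n a b c r : ℕ}

/-- `q` vanishes on the submodule `A`. -/
def Annihilates {R : Type} [CommRing R] {m : ℕ} (q : Fin m → R) (A : Submodule R (Fin m → R)) :
    Prop :=
  ∀ w ∈ A, q ⬝ᵥ w = 0

/-- The linear form on the quotient by `A` given by a vector annihilating `A`. -/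
def annForm {R : Type} [CommRing R] {m : ℕ} (A : Submodule R (Fin m → R)) (q : Fin m → R)
    (hq : Annihilates q A) : Module.Dual R ((Fin m → R) ⧸ A) :=
  A.liftQ (dotProductBilin R R q) hq

@[simp] theorem annForm_mk {R : Type} [CommRing R] {m : ℕ} (A : Submodule R (Fin m → R))
    (q : Fin m → R) (hq : Annihilates q A) (w : Fin m → R) :
    annForm A q hq (Submodule.Quotient.mk w) = q ⬝ᵥ w := rfl

theorem dual_quot_eq_annForm {R : Type} [CommRing R] {m : ℕ} {A : Submodule R (Fin m → R)}
    (l : Module.Dual R ((Fin m → R) ⧸ A)) : ∃ q hq, l = annForm A q hq := by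
  have key : ∀ w, (fun i => l (Submodule.Quotient.mk (Pi.single i 1))) ⬝ᵥ w =
      l (Submodule.Quotient.mk w) := fun w => by
    conv_rhs => rw [← Submodule.mkQ_apply, pi_eq_sum_univ' w, map_sum, map_sum]
    refine Finset.sum_congr rfl fun i _ => ?_
    rw [map_smul, map_smul, smul_eq_mul, mul_comm]
    rfl
  refine ⟨fun i => l (Submodule.Quotient.mk (Pi.single i 1)), fun w hw => ?_, ?_⟩
  · rw [key, (Submodule.Quotient.mk_eq_zero A).2 hw, map_zero]
  · ext w
    exact (key (Pi.single w 1)).symm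

theorem vmap_dotProduct (f : R ⟶ S) (q w : Fin m → R) :
    vmap m f q ⬝ᵥ vmap m f w = f.hom (q ⬝ᵥ w) := by
  simp only [dotProduct, map_sum, map_mul]
  rfl

theorem Annihilates.map (f : R ⟶ S) {A : (Gr a m).obj R} {q : Fin m → R}
    (hq : Annihilates q (Gr.toSubmodule A)) :
    Annihilates (vmap m f q) (Gr.toSubmodule ((Gr a m).map f A)) := by
  intro w hw
  rw [Gr.toSubmodule_map', pushSub] at hw
  induction hw using Submodule.span_induction with
  | mem w hw =>
    obtain ⟨w, hw, rfl⟩ := hw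
    rw [vmap_dotProduct, hq w hw, map_zero]
  | zero => simp
  | add x y _ _ hx hy => rw [dotProduct_add, hx, hy, add_zero]
  | smul t x _ hx => rw [dotProduct_smul, hx, smul_zero]

/-- The value of a section of `Q ⊠ U^∨` as an element of a tensor product. -/
def boxVal (s : (QBoxUDual a m b n).sections) (A : (Gr a m).obj R) (B : (Gr b n).obj R) :
    ((Fin m → R) ⧸ Gr.toSubmodule A) ⊗[R] Module.Dual R (Gr.toSubmodule B) :=
  s.1 R (A, B)

/-- The value of a section of `Q ⊠ U^∨`, paired with `q ∈ A^⊥` and `v ∈ B`. -/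
def boxEval (s : (QBoxUDual a m b n).sections) (A : (Gr a m).obj R) (B : (Gr b n).obj R)
    (q : Fin m → R) (hq : Annihilates q (Gr.toSubmodule A)) (v : Fin n → R)
    (hv : v ∈ Gr.toSubmodule B) : R :=
  TensorProduct.dualDistrib R _ _ (annForm _ q hq ⊗ₜ Module.Dual.eval R _ ⟨v, hv⟩) (boxVal s A B)

instance (B : (Gr b n).obj R) : Module.Finite R (Gr.toSubmodule B) := finite_sub _
instance (B : (Gr b n).obj R) : Module.Projective R (Gr.toSubmodule B) := projective_sub _

/-- Forms on `R^m / A` are vectors of `A^⊥`, and forms on the dual of `B` are elements of `B`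
because `B` is reflexive. So the pairings with `A^⊥ × B` determine the value of a section. -/
theorem boxVal_eq_zero {s : (QBoxUDual a m b n).sections} {A : (Gr a m).obj R}
    {B : (Gr b n).obj R} (h : ∀ q hq v hv, boxEval s A B q hq v hv = 0) : boxVal s A B = 0 := by
  refine tensor_eq_zero_of_forall fun q r => ?_
  obtain ⟨q, hq, rfl⟩ := dual_quot_eq_annForm q
  obtain ⟨⟨v, hv⟩, rfl⟩ := (Module.bijective_dual_eval R (Gr.toSubmodule B)).2 r
  exact h q hq v hv

theorem mem_zeroLocus_box {s : (QBoxUDual a m b n).sections} {A : (Gr a m).obj R}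
    {B : (Gr b n).obj R} :
    ((A, B) : (prod (Gr a m) (Gr b n)).obj R) ∈ (VectorBundle.zeroLocus s).obj R ↔
      ∀ q hq v hv, boxEval s A B q hq v hv = 0 := by
  constructor
  · intro h q hq v hv
    have : boxVal s A B = 0 := h
    rw [boxEval, this, map_zero]
  · exact boxVal_eq_zero

theorem dualDistrib_map {R S : Type} [CommRing R] [CommRing S] {φ : R →+* S}
    {M M' N N' : Type} [AddCommGroup M] [Module R M] [AddCommGroup N] [Module S N]
    [AddCommGroup M'] [Module R M'] [AddCommGroup N'] [Module S N']
    (ψ : M →ₛₗ[φ] N) (ψ' : M' →ₛₗ[φ] N')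
    {q : Module.Dual R M} {q' : Module.Dual S N} (hq : ∀ v, q' (ψ v) = φ (q v))
    {t : Module.Dual R M'} {t' : Module.Dual S N'} (ht : ∀ v, t' (ψ' v) = φ (t v)) (z : M ⊗[R] M') :
    TensorProduct.dualDistrib S N N' (q' ⊗ₜ t') (TensorProduct.map ψ ψ' z) =
      φ (TensorProduct.dualDistrib R M M' (q ⊗ₜ t) z) := by
  induction z with
  | zero => simp
  | add a b ha hb => simp only [map_add, ha, hb]
  | tmul a b => simp [hq, ht]

/-- The base change property of the tautological subbundle. -/
theorem isBaseChangeAlong_sub (f : R ⟶ S) (B : (Gr b n).obj R) :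
    IsBaseChangeAlong
      (subSemi (vmap n f) (Gr.toSubmodule B) (Gr.toSubmodule ((Gr b n).map f B)) rfl) :=
  ((isBaseChangeAlong_ringSemi f.hom.toRingHom).pow n).sub _ _ rfl

theorem boxVal_map (s : (QBoxUDual a m b n).sections) (f : R ⟶ S) (A : (Gr a m).obj R)
    (B : (Gr b n).obj R) : boxVal s ((Gr a m).map f A) ((Gr b n).map f B) =
      TensorProduct.map (quotSemi (vmap m f) (Gr.toSubmodule A)
          (Gr.toSubmodule ((Gr a m).map f A)) rfl)
        (isBaseChangeAlong_sub f B).dualMap (boxVal s A B) :=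
  (s.2 f (x := (A, B)) (y := ((Gr a m).map f A, (Gr b n).map f B)) rfl).symm

/-- The compatibility of a section with base change, in terms of pairings. It is used for evaluation
of polynomials, for the passage to fraction fields and for localisation. -/
theorem boxEval_map (s : (QBoxUDual a m b n).sections) (f : R ⟶ S) (A : (Gr a m).obj R)
    (B : (Gr b n).obj R) (q : Fin m → R) (hq : Annihilates q (Gr.toSubmodule A)) (v : Fin n → R)
    (hv : v ∈ Gr.toSubmodule B) :
    boxEval s ((Gr a m).map f A) ((Gr b n).map f B) (vmap m f q) (hq.map f) (vmap n f v)
      (Gr.map_mem f B hv) = f.hom (boxEval s A B q hq v hv) := by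
  rw [boxEval, boxVal_map, boxEval]
  refine dualDistrib_map _ _ (fun w => ?_) (fun l => ?_) _
  · obtain ⟨w, rfl⟩ := Submodule.mkQ_surjective _ w
    exact vmap_dotProduct f q w
  · exact (isBaseChangeAlong_sub f B).dualMap_apply l ⟨v, hv⟩

theorem boxVal_add (s t : (QBoxUDual a m b n).sections) (A : (Gr a m).obj R)
    (B : (Gr b n).obj R) : boxVal (s + t) A B = boxVal s A B + boxVal t A B := rfl

theorem boxVal_smul (c : ℂ) (s : (QBoxUDual a m b n).sections) (A : (Gr a m).obj R)
    (B : (Gr b n).obj R) : boxVal (c • s) A B = algebraMap ℂ R c • boxVal s A B := rfl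

theorem boxVal_zero (A : (Gr a m).obj R) (B : (Gr b n).obj R) :
    boxVal (0 : (QBoxUDual a m b n).sections) A B = 0 := rfl

theorem boxEval_add (s t : (QBoxUDual a m b n).sections) (A : (Gr a m).obj R)
    (B : (Gr b n).obj R) (q hq v hv) :
    boxEval (s + t) A B q hq v hv = boxEval s A B q hq v hv + boxEval t A B q hq v hv := by
  rw [boxEval, boxVal_add, map_add]
  rfl

theorem boxEval_smul (c : ℂ) (s : (QBoxUDual a m b n).sections) (A : (Gr a m).obj R)
    (B : (Gr b n).obj R) (q hq v hv) :
    boxEval (c • s) A B q hq v hv = algebraMap ℂ R c * boxEval s A B q hq v hv := by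
  rw [boxEval, boxVal_smul, map_smul]
  rfl

theorem boxEval_sum {ι : Type} (I : Finset ι) (s : ι → (QBoxUDual a m b n).sections)
    (A : (Gr a m).obj R) (B : (Gr b n).obj R) (q hq v hv) :
    boxEval (∑ i ∈ I, s i) A B q hq v hv = ∑ i ∈ I, boxEval (s i) A B q hq v hv := by
  classical
  induction I using Finset.induction_on with
  | empty =>
    rw [Finset.sum_empty, Finset.sum_empty, boxEval, boxVal_zero, map_zero]
  | insert i I hi ih => rw [Finset.sum_insert hi, Finset.sum_insert hi, boxEval_add, ih]

theorem box_ext {s t : (QBoxUDual a m b n).sections}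
    (h : ∀ (R : CommAlgCat.{0} ℂ) (A : (Gr a m).obj R) (B : (Gr b n).obj R) q hq v hv,
      boxEval s A B q hq v hv = boxEval t A B q hq v hv) : s = t := by
  rw [← sub_eq_zero]
  ext R ⟨A, B⟩
  refine boxVal_eq_zero (s := s - t) (A := A) (B := B) fun q hq v hv => ?_
  have h1 := boxEval_add (s - t) t A B q hq v hv
  rw [sub_add_cancel, h] at h1
  simpa using h1

theorem vmap_single (f : R ⟶ S) (i : Fin m) : vmap m f (Pi.single i 1) = Pi.single i 1 := by
  ext j
  rw [vmap_apply]
  by_cases h : j = i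
  · subst h; simp
  · simp [h]

/-- The section `e_i ⊠ e_j^∨` of `Q ⊠ U^∨`. -/
def boxBasic (a b : ℕ) (i : Fin m) (j : Fin n) : (QBoxUDual a m b n).sections where
  val R x := (show ((Fin m → R) ⧸ Gr.toSubmodule x.1) ⊗[R] Module.Dual R (Gr.toSubmodule x.2) from
    Submodule.Quotient.mk (Pi.single i 1) ⊗ₜ
      (LinearMap.proj j : (Fin n → R) →ₗ[R] R).comp (Gr.toSubmodule x.2).subtype)
  property := by
    intro R S f x y h
    subst h
    refine congrArg₂ (fun (u : (Fin m → S) ⧸ Gr.toSubmodule ((Gr a m).map f x.1))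
      (w : Module.Dual S (Gr.toSubmodule ((Gr b n).map f x.2))) => u ⊗ₜ[S] w)
      (congrArg (Submodule.mkQ _) (vmap_single f i)) ?_
    exact (isBaseChangeAlong_sub f x.2).ext fun v =>
      (isBaseChangeAlong_sub f x.2).dualMap_apply _ v

theorem boxEval_basic (i : Fin m) (j : Fin n) (A : (Gr a m).obj R) (B : (Gr b n).obj R)
    (q hq v hv) : boxEval (boxBasic a b i j) A B q hq v hv = q i * v j := by
  have : boxVal (boxBasic a b i j) A B = Submodule.Quotient.mk (Pi.single i 1) ⊗ₜ
      (LinearMap.proj j : (Fin n → R) →ₗ[R] R).comp (Gr.toSubmodule B).subtype := rfl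
  rw [boxEval, this]
  simp

/-- The section of `Q ⊠ U^∨` given by a matrix. -/
def boxSec (a m b n : ℕ) : Matrix (Fin m) (Fin n) ℂ →ₗ[ℂ] (QBoxUDual a m b n).sections where
  toFun P := ∑ i, ∑ j, P i j • boxBasic a b i j
  map_add' P P' := by simp [add_smul, Finset.sum_add_distrib]
  map_smul' c P := by simp [mul_smul, Finset.smul_sum]

theorem boxEval_sec (P : Matrix (Fin m) (Fin n) ℂ) (A : (Gr a m).obj R) (B : (Gr b n).obj R)
    (q hq v hv) : boxEval (boxSec a m b n P) A B q hq v hv = q ⬝ᵥ act R P v := by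
  have : boxSec a m b n P = ∑ i, ∑ j, P i j • boxBasic a b i j := rfl
  simp only [this, boxEval_sum, boxEval_smul, boxEval_basic, dotProduct, act_apply, Finset.mul_sum]
  refine Finset.sum_congr rfl fun i _ => Finset.sum_congr rfl fun j _ => by ring

/-- The quotient by `L` is projective, so linear forms separate its elements, and these forms are
dot products with vectors annihilating `L`. -/
theorem mem_of_forall_annihilates {R : Type} [CommRing R] {L : Submodule R (Fin n → R)}
    [Module.Projective R ((Fin n → R) ⧸ L)] {v : Fin n → R}
    (h : ∀ q, Annihilates q L → q ⬝ᵥ v = 0) : v ∈ L := by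
  rw [← Submodule.Quotient.mk_eq_zero, ← Module.forall_dual_apply_eq_zero_iff R]
  intro l
  obtain ⟨q, hq, rfl⟩ := dual_quot_eq_annForm l
  exact h q hq

/-- By the separation property, `q · P v = 0` for all `q ∈ A^⊥` means `P v ∈ A`. All the geometry
below rests on this description. -/
theorem mem_zeroLocus_boxSec {P : Matrix (Fin m) (Fin n) ℂ} {A : (Gr a m).obj R}
    {B : (Gr b n).obj R} :
    ((A, B) : (prod (Gr a m) (Gr b n)).obj R) ∈ (VectorBundle.zeroLocus (boxSec a m b n P)).obj R ↔
      ∀ v ∈ Gr.toSubmodule B, act R P v ∈ Gr.toSubmodule A := by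
  simp only [mem_zeroLocus_box, boxEval_sec]
  constructor
  · exact fun h v hv => mem_of_forall_annihilates fun q hq => h q hq v hv
  · exact fun h q hq v hv => hq _ (h v hv)

/-! #### Sections on flag manifolds -/

/-- The smaller subspace of a flag. -/
def Fl.pt₁ (x : (Fl b c n).obj R) : (Gr b n).obj R := x.1.1

/-- The larger subspace of a flag. -/
def Fl.pt₂ (x : (Fl b c n).obj R) : (Gr c n).obj R := x.1.2

theorem Fl.le (x : (Fl b c n).obj R) :
    Gr.toSubmodule (Fl.pt₁ x) ≤ Gr.toSubmodule (Fl.pt₂ x) := x.2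

/-- The flag given by two subspaces. -/
def Fl.mk (B : (Gr b n).obj R) (C : (Gr c n).obj R)
    (h : Gr.toSubmodule B ≤ Gr.toSubmodule C) : (Fl b c n).obj R := ⟨(B, C), h⟩

theorem Fl.pt₂_map (f : R ⟶ S) (x : (Fl b c n).obj R) :
    Fl.pt₂ ((Fl b c n).map f x) = (Gr c n).map f (Fl.pt₂ x) := rfl

/-- The value of a section of `Q₂^{⊕ r}` on the flag manifold. -/
def flVal (t : ((Fl.Q₂ b c n).power r).sections) (x : (Fl b c n).obj R) (i : Fin r) :
    (Fin n → R) ⧸ Gr.toSubmodule (Fl.pt₂ x) :=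
  (show Fin r → (Fin n → R) ⧸ Gr.toSubmodule (Fl.pt₂ x) from t.1 R x) i

/-- The value of a section of `Q₂^{⊕ r}` paired with `q ∈ C^⊥`. -/
def flEval (t : ((Fl.Q₂ b c n).power r).sections) (x : (Fl b c n).obj R) (i : Fin r)
    (q : Fin n → R) (hq : Annihilates q (Gr.toSubmodule (Fl.pt₂ x))) : R :=
  annForm _ q hq (flVal t x i)

theorem flVal_eq_zero {t : ((Fl.Q₂ b c n).power r).sections} {x : (Fl b c n).obj R} {i : Fin r}
    (h : ∀ q hq, flEval t x i q hq = 0) : flVal t x i = 0 := by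
  rw [← Module.forall_dual_apply_eq_zero_iff R]
  intro l
  obtain ⟨q, hq, rfl⟩ := dual_quot_eq_annForm l
  exact h q hq

theorem mem_zeroLocus_fl {t : ((Fl.Q₂ b c n).power r).sections} {x : (Fl b c n).obj R} :
    x ∈ (VectorBundle.zeroLocus t).obj R ↔ ∀ i q hq, flEval t x i q hq = 0 := by
  constructor
  · intro h i q hq
    have : flVal t x i = 0 := congrFun (show t.1 R x = 0 from h) i
    rw [flEval, this, map_zero]
  · exact fun h => funext fun i => flVal_eq_zero (h i)

theorem flVal_map (t : ((Fl.Q₂ b c n).power r).sections) (f : R ⟶ S) (x : (Fl b c n).obj R)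
    (i : Fin r) : flVal t ((Fl b c n).map f x) i =
      quotSemi (vmap n f) (Gr.toSubmodule (Fl.pt₂ x))
        (Gr.toSubmodule (Fl.pt₂ ((Fl b c n).map f x))) rfl (flVal t x i) :=
  (congrFun (t.2 f (x := x) rfl) i).symm

theorem Annihilates.mapFl (f : R ⟶ S) {x : (Fl b c n).obj R} {q : Fin n → R}
    (hq : Annihilates q (Gr.toSubmodule (Fl.pt₂ x))) :
    Annihilates (vmap n f q) (Gr.toSubmodule (Fl.pt₂ ((Fl b c n).map f x))) :=
  hq.map f

theorem flEval_map (t : ((Fl.Q₂ b c n).power r).sections) (f : R ⟶ S) (x : (Fl b c n).obj R)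
    (i : Fin r) (q : Fin n → R) (hq : Annihilates q (Gr.toSubmodule (Fl.pt₂ x))) :
    flEval t ((Fl b c n).map f x) i (vmap n f q) (hq.mapFl f) = f.hom (flEval t x i q hq) := by
  refine (congrArg (annForm _ (vmap n f q) (hq.map f)) (flVal_map t f x i)).trans ?_
  rw [flEval]
  obtain ⟨w, hw⟩ := Submodule.mkQ_surjective _ (flVal t x i)
  rw [← hw]
  exact vmap_dotProduct f q w

theorem flEval_add (s t : ((Fl.Q₂ b c n).power r).sections) (x : (Fl b c n).obj R) (i q hq) :
    flEval (s + t) x i q hq = flEval s x i q hq + flEval t x i q hq :=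
  map_add (annForm _ q hq) (flVal s x i) (flVal t x i)

theorem fl_ext {s t : ((Fl.Q₂ b c n).power r).sections}
    (h : ∀ (R : CommAlgCat.{0} ℂ) (x : (Fl b c n).obj R) i q hq,
      flEval s x i q hq = flEval t x i q hq) : s = t := by
  rw [← sub_eq_zero]
  ext R x
  refine funext fun i => flVal_eq_zero (t := s - t) (x := x) (i := i) fun q hq => ?_
  have h1 := flEval_add (s - t) t x i q hq
  rw [sub_add_cancel, h] at h1
  simpa using h1

/-- The base change of a complex vector. -/
def cvec (R : CommAlgCat.{0} ℂ) (v : Fin n → ℂ) : Fin n → R := fun i => algebraMap ℂ R (v i)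

theorem vmap_cvec (f : R ⟶ S) (v : Fin n → ℂ) : vmap n f (cvec R v) = cvec S v :=
  funext fun i => f.hom.commutes (v i)

theorem act_cvec (P : Matrix (Fin m) (Fin n) ℂ) (v : Fin n → ℂ) :
    act R P (cvec R v) = cvec R (P.mulVec v) := by
  ext i
  simp [act_apply, cvec, Matrix.mulVec, dotProduct]

/-- The section of `Q₂^{⊕ r}` given by the columns of a matrix. -/
def flSec (b c n r : ℕ) : Matrix (Fin n) (Fin r) ℂ →ₗ[ℂ] ((Fl.Q₂ b c n).power r).sections where
  toFun P :=
    { val := fun R x => (show Fin r → (Fin n → R) ⧸ Gr.toSubmodule (Fl.pt₂ x) from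
        fun i => Submodule.Quotient.mk (cvec R (P.col i)))
      property := by
        intro R S f x y h
        subst h
        exact funext fun i => congrArg (Submodule.mkQ _) (vmap_cvec f (P.col i)) }
  map_add' P P' := by
    ext R x
    refine funext fun i => congrArg (Submodule.mkQ (Gr.toSubmodule (Fl.pt₂ x)))
      (a₂ := cvec R (P.col i) + cvec R (P'.col i)) (funext fun j => ?_)
    simp [cvec, Matrix.col]
  map_smul' z P := by
    ext R x
    refine funext fun i => congrArg (Submodule.mkQ (Gr.toSubmodule (Fl.pt₂ x)))
      (a₂ := algebraMap ℂ R z • cvec R (P.col i)) (funext fun j => ?_)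
    simp [cvec, Matrix.col]

theorem flEval_sec (P : Matrix (Fin n) (Fin r) ℂ) (x : (Fl b c n).obj R) (i q hq) :
    flEval (flSec b c n r P) x i q hq = q ⬝ᵥ cvec R (P.col i) := rfl

/-- The section is the class of the columns modulo the larger subspace `C`, so it vanishes when `C`
contains them. -/
theorem mem_zeroLocus_flSec {P : Matrix (Fin n) (Fin r) ℂ} {x : (Fl b c n).obj R} :
    x ∈ (VectorBundle.zeroLocus (flSec b c n r P)).obj R ↔
      ∀ i, cvec R (P.col i) ∈ Gr.toSubmodule (Fl.pt₂ x) := by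
  simp only [mem_zeroLocus_fl, flEval_sec]
  refine forall_congr' fun i => ⟨fun h => mem_of_forall_annihilates h, fun h q hq => hq _ h⟩

end Evaluation

/-! ### Families of linear forms on the subspaces of a vector space -/

section Pencils

open Polynomial Module

variable {F V : Type} [Field F] [AddCommGroup V] [Module F V]

/-- A function on the projective line that is regular in both charts is constant. With `N = deg q`,
clearing denominators gives `X^N p = reflect N q`, of degree at most `N`, so `p` has degree 0. -/
theorem eval_eq_of_eval_inv [Infinite F] {p q : F[X]}
    (h : ∀ t ≠ 0, p.eval t = q.eval t⁻¹) (t : F) : p.eval t = q.eval 0 := by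
  let N := q.natDegree
  have key : X ^ N * p = reflect N q := by
    refine eq_of_infinite_eval_eq _ _ (Set.Infinite.mono (s := {0}ᶜ) (fun t ht => ?_)
      (Set.finite_singleton 0).infinite_compl)
    have ht : t ≠ 0 := ht
    have : Invertible t⁻¹ := invertibleOfNonzero (inv_ne_zero ht)
    have e := eval₂_reflect_mul_pow (RingHom.id F) t⁻¹ N q le_rfl
    simp only [invOf_eq_inv, inv_inv, eval₂_id] at e
    simp only [Set.mem_ofPred_eq, eval_mul, eval_pow, eval_X, h t ht, ← e]
    rw [mul_comm, mul_assoc, ← mul_pow, inv_mul_cancel₀ ht, one_pow, mul_one]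
  have hd : p.natDegree = 0 := by
    by_cases hp : p = 0
    · simp [hp]
    have h1 : (X ^ N * p).natDegree = N + p.natDegree := by
      rw [natDegree_mul (pow_ne_zero _ X_ne_zero) hp, natDegree_X_pow]
    have h2 : (reflect N q).natDegree ≤ max N q.natDegree := natDegree_reflect_le
    rw [← key, h1, max_self] at h2
    omega
  obtain ⟨c, rfl⟩ : ∃ c, p = C c := ⟨_, eq_C_of_natDegree_eq_zero hd⟩
  have hq : q = C c := by
    refine eq_of_infinite_eval_eq _ _ (Set.Infinite.mono (s := {0}ᶜ) (fun t ht => ?_)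
      (Set.finite_singleton 0).infinite_compl)
    have ht : t ≠ 0 := ht
    have := h t⁻¹ (inv_ne_zero ht)
    rw [inv_inv] at this
    simp [← this]
  simp [hq]

/-- The same for sections of `O(1)`, which are affine in the coordinate. Subtracting `q(0) X` from
`p` and dividing the nonconstant part of `q` by `X` reduces to the untwisted case. -/
theorem eval_eq_of_eval_inv_mul [Infinite F] {p q : F[X]}
    (h : ∀ t ≠ 0, p.eval t = t * q.eval t⁻¹) (t : F) :
    p.eval t = p.eval 0 + t * q.eval 0 := by
  have key : ∀ t, (p - C (q.eval 0) * X).eval t = (q.divX).eval 0 := by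
    refine eval_eq_of_eval_inv fun t ht => ?_
    have e : q.eval t⁻¹ = q.divX.eval t⁻¹ * t⁻¹ + q.eval 0 := by
      conv_lhs => rw [← q.divX_mul_X_add]
      simp [coeff_zero_eq_eval_zero]
    simp only [eval_sub, eval_mul, eval_C, eval_X, h t ht, e]
    field_simp
    ring
  have h1 := key t
  have h2 := key 0
  simp only [eval_sub, eval_mul, eval_C, eval_X, mul_zero, sub_zero] at h1 h2
  rw [← h2] at h1
  linear_combination h1

theorem exists_between_finrank [FiniteDimensional F V] {W D : Submodule F V} (hWD : W ≤ D) {b : ℕ}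
    (hb : finrank F W ≤ b) (hb' : b ≤ finrank F D) : ∃ B, W ≤ B ∧ B ≤ D ∧ finrank F B = b := by
  induction b, hb using Nat.le_induction with
  | base => exact ⟨W, le_rfl, hWD, rfl⟩
  | succ b hb ih =>
    obtain ⟨B, h1, h2, h3⟩ := ih (by omega)
    have hlt : B < D := lt_of_le_of_ne h2 (by rintro rfl; omega)
    obtain ⟨x, hx, hx'⟩ := SetLike.exists_of_lt hlt
    refine ⟨B ⊔ F ∙ x, h1.trans le_sup_left, sup_le h2 (by simpa using hx), ?_⟩
    have h4 : finrank F ((B ⊔ F ∙ x : Submodule F V)) ≤ finrank F B + finrank F (F ∙ x) :=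
      Submodule.finrank_add_le_finrank_add_finrank _ _
    have h5 : finrank F (F ∙ x) ≤ 1 := finrank_span_le_card {x} |>.trans (by simp)
    have h6 : B < B ⊔ F ∙ x := lt_of_le_of_ne le_sup_left fun e =>
      hx' (e.symm ▸ Submodule.mem_sup_right (Submodule.mem_span_singleton_self x) :)
    have := Submodule.finrank_lt_finrank_of_lt h6
    omega

/-- `x` and `y` are linearly independent modulo `D`. -/
def IndepMod (D : Submodule F V) (x y : V) : Prop :=
  ∀ α β : F, α • x + β • y ∈ D → α = 0 ∧ β = 0

theorem IndepMod.symm {D : Submodule F V} {x y : V} (h : IndepMod D x y) : IndepMod D y x :=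
  fun α β hαβ => (h β α (by rwa [add_comm])).symm

/-- The member of a pencil of subspaces with parameter `t`. -/
def pencil (D : Submodule F V) (x y : V) (t : F) : Submodule F V := D ⊔ F ∙ (x + t • y)

/-- The change of coordinate on the projective line of subspaces between `D` and `D + ⟨x, y⟩`.
Exchanging `x` and `y` makes the member at infinity the member with parameter 0. -/
theorem pencil_inv (D : Submodule F V) (x y : V) {t : F} (ht : t ≠ 0) :
    pencil D y x t⁻¹ = pencil D x y t := by
  have : F ∙ (y + t⁻¹ • x) = F ∙ (x + t • y) := by
    have e : x + t • y = t • (y + t⁻¹ • x) := by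
      rw [smul_add, smul_smul, mul_inv_cancel₀ ht, one_smul, add_comm]
    rw [e, Submodule.span_singleton_smul_eq (IsUnit.mk0 t ht)]
  rw [pencil, pencil, this]

theorem IndepMod.finrank_pencil [FiniteDimensional F V] {D : Submodule F V} {x y : V}
    (h : IndepMod D x y) (t : F) : finrank F (pencil D x y t) = finrank F D + 1 := by
  have hx : x + t • y ∉ D := fun hx => by
    have := (h 1 t (by rwa [one_smul])).1
    exact one_ne_zero this
  have h0 : x + t • y ≠ 0 := fun e => hx (by rw [e]; exact D.zero_mem)
  have h1 := Submodule.finrank_sup_add_finrank_inf_eq D (F ∙ (x + t • y))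
  have h2 : D ⊓ F ∙ (x + t • y) = ⊥ := by
    rw [← disjoint_iff]
    exact (Submodule.disjoint_span_singleton' h0).2 hx
  rw [h2, finrank_bot, finrank_span_singleton h0] at h1
  exact h1

theorem mem_pencil (D : Submodule F V) (x y : V) (t : F) : x + t • y ∈ pencil D x y t :=
  Submodule.mem_sup_right (Submodule.mem_span_singleton_self _)

theorem le_pencil (D : Submodule F V) (x y : V) (t : F) : D ≤ pencil D x y t := le_sup_left

/-- A function on the `b`-dimensional subspaces between `D₀` and `D₁` which is polynomial on
pencils is constant. -/
theorem eq_of_polynomial_on_pencils [Infinite F] [FiniteDimensional F V] (b : ℕ)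
    (D₀ D₁ : Submodule F V) (g : Submodule F V → F)
    (hg : ∀ D x y, D₀ ≤ D → D ≤ D₁ → x ∈ D₁ → y ∈ D₁ → finrank F D + 1 = b → IndepMod D x y →
      ∃ p : F[X], ∀ t, p.eval t = g (pencil D x y t)) {B B' : Submodule F V}
    (hB : finrank F B = b) (hB' : finrank F B' = b) (h₀ : D₀ ≤ B) (h₀' : D₀ ≤ B') (h₁ : B ≤ D₁)
    (h₁' : B' ≤ D₁) : g B = g B' := by
  -- Induction on a bound for the codimension of `B ⊓ B'` in `B`; `B'` stays fixed while `B` moves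
  -- towards it.
  obtain ⟨k, hk⟩ : ∃ k, b ≤ finrank F (B ⊓ B' : Submodule F V) + k := ⟨b, by omega⟩
  induction k generalizing B with
  | zero =>
    have e1 : B ⊓ B' = B := Submodule.eq_of_le_of_finrank_le inf_le_left (by omega)
    have e2 : B ⊓ B' = B' := Submodule.eq_of_le_of_finrank_le inf_le_right (by omega)
    rw [← e1, e2]
  | succ k ih =>
    by_cases hBB : B ≤ B'
    · rw [Submodule.eq_of_le_of_finrank_eq hBB (hB.trans hB'.symm)]
    have hBB' : ¬ B' ≤ B := fun h =>
      hBB (Submodule.eq_of_le_of_finrank_eq h (hB'.trans hB.symm)).ge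
    obtain ⟨x, hx, hx'⟩ := SetLike.not_le_iff_exists.1 hBB
    obtain ⟨y, hy, hy'⟩ := SetLike.not_le_iff_exists.1 hBB'
    -- The kernel of `f` cuts out a hyperplane `D` of `B` containing `B ⊓ B'` but not `x`. The
    -- pencil of `D`, `x`, `y` joins `B`, at parameter 0, to `D + ⟨y⟩` at infinity, and the latter
    -- meets `B'` in a strictly larger subspace because it contains `y`.
    obtain ⟨f, hfx, hf⟩ := Submodule.exists_le_ker_of_notMem (p := B ⊓ B') (v := x)
      fun h => hx' h.2
    let D := B ⊓ LinearMap.ker f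
    have hind : IndepMod D x y := fun α β h => by
      have hβ : β = 0 := by
        by_contra hβ
        refine hy' ?_
        have h1 : β • y ∈ B := by
          have := B.sub_mem h.1 (B.smul_mem α hx)
          rwa [add_sub_cancel_left] at this
        exact (B.smul_mem_iff hβ).1 h1
      subst hβ
      have h2 : f (α • x + (0 : F) • y) = 0 := h.2
      simp only [zero_smul, add_zero, map_smul, smul_eq_mul] at h2
      exact ⟨(mul_eq_zero.1 h2).resolve_right hfx, rfl⟩
    have hDB : pencil D x y 0 = B := by
      rw [pencil, zero_smul, add_zero]
      refine le_antisymm (sup_le inf_le_left (by simpa using hx)) fun v hv => ?_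
      rw [Submodule.mem_sup]
      refine ⟨v - (f v / f x) • x, ⟨B.sub_mem hv (B.smul_mem _ hx), ?_⟩, (f v / f x) • x,
        Submodule.smul_mem _ _ (Submodule.mem_span_singleton_self x), by simp⟩
      simp [hfx]
    have hD : finrank F D + 1 = b := by rw [← hind.finrank_pencil 0, hDB, hB]
    have hD0 : D₀ ≤ D := le_inf h₀ ((le_inf h₀ h₀').trans hf)
    have hD1 : D ≤ D₁ := inf_le_left.trans h₁
    obtain ⟨p, hp⟩ := hg D x y hD0 hD1 (h₁ hx) (h₁' hy) hD hind
    obtain ⟨q, hq⟩ := hg D y x hD0 hD1 (h₁' hy) (h₁ hx) hD hind.symm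
    have e := eval_eq_of_eval_inv (p := p) (q := q)
      (fun t ht => by rw [hp, hq, pencil_inv _ _ _ ht]) 0
    rw [hp, hq, hDB] at e
    rw [e]
    have hy2 : y ∈ pencil D y x 0 := by simpa using mem_pencil D y x 0
    refine ih (by rw [hind.symm.finrank_pencil, hD]) (hD0.trans (le_pencil ..)) ?_ ?_
    · rw [pencil, zero_smul, add_zero]
      exact sup_le hD1 (by simpa using h₁' hy)
    · have hlt : B ⊓ B' < pencil D y x 0 ⊓ B' := by
        refine lt_of_le_of_ne (le_inf ((le_inf inf_le_left hf).trans (le_pencil ..)) inf_le_right) ?_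
        intro e
        have : y ∈ B ⊓ B' := e ▸ ⟨hy2, hy⟩
        exact hy' this.1
      have := Submodule.finrank_lt_finrank_of_lt hlt
      omega

theorem finrank_span_singleton_le (v : V) : finrank F (F ∙ v) ≤ 1 :=
  (finrank_span_le_card {v}).trans (by simp)

/-- A family of linear forms on the `b`-dimensional subspaces which is polynomial on pencils comes
from a linear form. -/
theorem exists_form_of_polynomial_on_pencils [Infinite F] [FiniteDimensional F V] (b : ℕ)
    (h : Submodule F V → V → F)
    (hadd : ∀ B : Submodule F V, finrank F B = b → ∀ v ∈ B, ∀ w ∈ B, h B (v + w) = h B v + h B w)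
    (hsmul : ∀ B : Submodule F V, finrank F B = b → ∀ v ∈ B, ∀ c : F, h B (c • v) = c * h B v)
    (hpoly : ∀ (D : Submodule F V) x y, finrank F D + 1 = b → IndepMod D x y → ∀ w ∈ D, ∀ c : F,
      ∃ p : F[X], ∀ t, p.eval t = h (pencil D x y t) (w + c • (x + t • y))) :
    ∃ Φ : Dual F V, ∀ B : Submodule F V, finrank F B = b → ∀ v ∈ B, h B v = Φ v := by
  by_cases hbV : finrank F V < b
  · exact ⟨0, fun B hB => by have := B.finrank_le; omega⟩
  by_cases hb0 : b = 0
  · refine ⟨0, fun B hB v hv => ?_⟩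
    rw [hb0, Submodule.finrank_eq_zero] at hB
    subst hB
    rw [Submodule.mem_bot] at hv
    subst hv
    simpa using hsmul ⊥ (by simp [hb0]) 0 (zero_mem _) 0
  -- Independence of `B`: the lower bound `F ∙ v` keeps `v` in all the subspaces considered, and
  -- `hpoly` is used with `w = v` and `c = 0`.
  have hconst : ∀ (v : V) {B B' : Submodule F V}, finrank F B = b → finrank F B' = b → v ∈ B → v ∈ B' →
      h B v = h B' v := fun v B B' hB hB' hv hv' =>
    eq_of_polynomial_on_pencils b (F ∙ v) ⊤ (fun B => h B v)
      (fun D x y hD _ _ _ hDb hind => by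
        simpa using hpoly D x y hDb hind v (by simpa using hD) 0)
      hB hB' (by simpa using hv) (by simpa using hv') le_top le_top
  have hex : ∀ v : V, ∃ B : Submodule F V, v ∈ B ∧ finrank F B = b := fun v => by
    obtain ⟨B, h1, -, h2⟩ := exists_between_finrank (W := F ∙ v) (D := ⊤) le_top (b := b)
      ((finrank_span_singleton_le v).trans (by omega)) (by rw [finrank_top]; omega)
    exact ⟨B, by simpa using h1, h2⟩
  choose β hβ hβ' using hex
  have hH : ∀ B : Submodule F V, finrank F B = b → ∀ v ∈ B, h B v = h (β v) v := fun B hB v hv =>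
    hconst v hB (hβ' v) hv (hβ v)
  have hHadd : ∀ v w, h (β (v + w)) (v + w) = h (β v) v + h (β w) w := fun v w => by
    by_cases h2 : finrank F (Submodule.span F {v, w}) ≤ b
    · obtain ⟨B, h1, -, h2⟩ := exists_between_finrank (W := Submodule.span F {v, w}) (D := ⊤) le_top
        h2 (by rw [finrank_top]; omega)
      have hv : v ∈ B := h1 (Submodule.subset_span (by simp))
      have hw : w ∈ B := h1 (Submodule.subset_span (by simp))
      rw [← hH B h2 v hv, ← hH B h2 w hw, ← hH B h2 _ (B.add_mem hv hw), hadd B h2 v hv w hw]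
    -- Two vectors fail to lie in a common `B` only when the subspaces `B` are lines. Then the
    -- values on `v + t w` and on `w + t v` are the two charts of a section of `O(1)`; it is affine
    -- in `t`, and `t = 1` gives additivity.
    · have hb1 : b = 1 := by
        have : finrank F (Submodule.span F {v, w}) ≤ 2 := by
          classical
          exact (finrank_span_le_card {v, w}).trans (by simpa using Finset.card_le_two)
        omega
      have hind : IndepMod ⊥ v w := fun α β' e => by
        rw [Submodule.mem_bot] at e
        by_contra hne
        refine h2 (le_trans ?_ hb1.ge)
        rw [not_and_or] at hne
        rcases hne with hα | hβ
        · have : v ∈ F ∙ w := Submodule.mem_span_singleton.2 ⟨-(α⁻¹ * β'), by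
            rw [← smul_right_injective V hα |>.eq_iff]
            simp only [smul_smul]
            rw [eq_neg_of_add_eq_zero_left e, ← neg_smul]
            congr 1
            field_simp⟩
          rw [Submodule.span_insert_eq_span this]
          exact finrank_span_singleton_le w
        · have : w ∈ F ∙ v := Submodule.mem_span_singleton.2 ⟨-(β'⁻¹ * α), by
            rw [← smul_right_injective V hβ |>.eq_iff]
            simp only [smul_smul]
            rw [eq_neg_of_add_eq_zero_right e, ← neg_smul]
            congr 1
            field_simp⟩
          rw [Set.pair_comm, Submodule.span_insert_eq_span this]
          exact finrank_span_singleton_le v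
      have hD : finrank F (⊥ : Submodule F V) + 1 = b := by simp [hb1]
      obtain ⟨p, hp⟩ := hpoly ⊥ v w hD hind 0 (zero_mem _) 1
      obtain ⟨q, hq⟩ := hpoly ⊥ w v hD hind.symm 0 (zero_mem _) 1
      simp only [zero_add, one_smul] at hp hq
      have hp' : ∀ t, p.eval t = h (β (v + t • w)) (v + t • w) := fun t => by
        rw [hp, hH _ (by rw [hind.finrank_pencil, hD]) _ (mem_pencil _ _ _ _)]
      have hq' : ∀ t, q.eval t = h (β (w + t • v)) (w + t • v) := fun t => by
        rw [hq, hH _ (by rw [hind.symm.finrank_pencil, hD]) _ (mem_pencil _ _ _ _)]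
      have e := eval_eq_of_eval_inv_mul (p := p) (q := q) (fun t ht => by
        rw [hp, hq, pencil_inv _ _ _ ht, ← hsmul]
        · congr 1
          rw [smul_add, smul_smul, mul_inv_cancel₀ ht, one_smul, add_comm]
        · rw [hind.finrank_pencil, hD]
        · rw [← pencil_inv _ _ _ ht]; exact mem_pencil _ _ _ _) 1
      simpa [hp', hq'] using e
  refine ⟨⟨⟨fun v => h (β v) v, hHadd⟩, fun c v => ?_⟩, hH⟩
  simp only [RingHom.id_apply, smul_eq_mul]
  rw [← hH _ (hβ' v) _ ((β v).smul_mem c (hβ v)), hsmul _ (hβ' v) _ (hβ v)]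

/-- Rank-nullity for the map to the plane given by the two forms. In codimension 2 surjectivity
provides vectors dual to `l` and `l'`. -/
theorem finrank_ker_inf_ker [FiniteDimensional F V] (l l' : Dual F V) :
    finrank F V ≤ finrank F (LinearMap.ker l ⊓ LinearMap.ker l' : Submodule F V) + 2 ∧
    (finrank F V = finrank F (LinearMap.ker l ⊓ LinearMap.ker l' : Submodule F V) + 2 →
      Function.Surjective (l.prod l')) := by
  have h := LinearMap.finrank_range_add_finrank_ker (l.prod l')
  rw [LinearMap.ker_prod] at h
  have h2 := (LinearMap.range (l.prod l')).finrank_le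
  have h3 : finrank F (F × F) = 2 := by simp
  refine ⟨by omega, fun e => ?_⟩
  rw [← LinearMap.range_eq_top]
  exact Submodule.eq_top_of_finrank_eq (by omega)

/-- A family of linear forms on the annihilators of the `a`-dimensional subspaces which is
polynomial on pencils comes from a vector. -/
theorem exists_vector_of_polynomial_on_pencils [Infinite F] [FiniteDimensional F V] (a : ℕ)
    (h : Submodule F V → Dual F V → F)
    (hadd : ∀ A : Submodule F V, finrank F A = a → ∀ l l', A ≤ LinearMap.ker l → A ≤ LinearMap.ker l' →
      h A (l + l') = h A l + h A l')
    (hsmul : ∀ A : Submodule F V, finrank F A = a → ∀ l, A ≤ LinearMap.ker l → ∀ c : F, h A (c • l) = c * h A l)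
    (hpoly : ∀ (D : Submodule F V) x y, finrank F D + 1 = a → IndepMod D x y → ∀ l l' : Dual F V,
      D ≤ LinearMap.ker l → D ≤ LinearMap.ker l' → l x = 0 → l y + l' x = 0 → l' y = 0 →
      ∃ p : F[X], ∀ t, p.eval t = h (pencil D x y t) (l + t • l')) :
    ∃ v : V, ∀ A : Submodule F V, finrank F A = a → ∀ l, A ≤ LinearMap.ker l → h A l = l v := by
  by_cases haV : finrank F V ≤ a
  · refine ⟨0, fun A hA l hl => ?_⟩
    have : A = ⊤ := Submodule.eq_top_of_finrank_eq (le_antisymm A.finrank_le (by omega))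
    subst this
    obtain rfl : l = 0 := by
      rw [← LinearMap.ker_eq_top]
      exact top_le_iff.1 hl
    simpa using hsmul ⊤ hA 0 (by simp) 0
  have hconst : ∀ (l : Dual F V) {A A' : Submodule F V}, finrank F A = a → finrank F A' = a →
      A ≤ LinearMap.ker l → A' ≤ LinearMap.ker l → h A l = h A' l := fun l A A' hA hA' hl hl' =>
    eq_of_polynomial_on_pencils a ⊥ (LinearMap.ker l) (fun B => h B l)
      (fun D x y _ hD hx hy hDb hind => by
        simpa using hpoly D x y hDb hind l 0 hD (by simp) hx (by simpa using hy) rfl)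
      hA hA' bot_le bot_le hl hl'
  have hex : ∀ l : Dual F V, ∃ A : Submodule F V, A ≤ LinearMap.ker l ∧ finrank F A = a :=
    fun l => by
    have h1 := LinearMap.finrank_range_add_finrank_ker l
    have h2 := (LinearMap.range l).finrank_le
    rw [finrank_self] at h2
    obtain ⟨A, -, h3, h4⟩ := exists_between_finrank (W := ⊥) (D := LinearMap.ker l) bot_le (b := a)
      (by simp) (by omega)
    exact ⟨A, h3, h4⟩
  choose α hα hα' using hex
  have hH : ∀ A : Submodule F V, finrank F A = a → ∀ l, A ≤ LinearMap.ker l → h A l = h (α l) l := fun A hA l hl =>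
    hconst l hA (hα' l) hl (hα l)
  have hHsmul : ∀ (c : F) l, h (α (c • l)) (c • l) = c * h (α l) l := fun c l => by
    rw [← hH _ (hα' l) (c • l) fun v hv => by simp [show l v = 0 from hα l hv],
      hsmul _ (hα' l) _ (hα l)]
  have hHadd : ∀ l l', h (α (l + l')) (l + l') = h (α l) l + h (α l') l' := fun l l' => by
    obtain ⟨hK, hsurj⟩ := finrank_ker_inf_ker l l'
    set K := LinearMap.ker l ⊓ LinearMap.ker l' with hKdef
    by_cases h2 : a ≤ finrank F K
    · obtain ⟨A, -, h3, h4⟩ := exists_between_finrank (W := ⊥) (D := K) bot_le (b := a)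
        (by simp) (by omega)
      have hl := h3.trans inf_le_left
      have hl' := h3.trans inf_le_right
      rw [← hH A h4 l hl, ← hH A h4 l' hl', ← hH A h4 _ fun v hv => by
        simp [show l v = 0 from hl hv, show l' v = 0 from hl' hv], hadd A h4 l l' hl hl']
    -- No common `A` exists, so `a = dim V - 1` and `l`, `l'` are independent. With `x`, `y` dual to
    -- them, the hyperplanes containing `K` form a pencil.
    · have hs := hsurj (by omega)
      obtain ⟨x, hx⟩ := hs (1, 0)
      obtain ⟨y, hy⟩ := hs (0, 1)
      obtain ⟨hx1, hx2⟩ := Prod.mk_inj.1 hx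
      obtain ⟨hy1, hy2⟩ := Prod.mk_inj.1 hy
      have hind : IndepMod K x y := fun s t e => by
        have e1 : l (s • x + t • y) = 0 := e.1
        have e2 : l' (s • x + t • y) = 0 := e.2
        simp only [map_add, map_smul, smul_eq_mul] at e1 e2
        change l x = 1 at hx1
        change l' x = 0 at hx2
        change l y = 0 at hy1
        change l' y = 1 at hy2
        simp only [hx1, hx2, hy1, hy2] at e1 e2
        constructor
        · linear_combination e1
        · linear_combination e2
      change l x = 1 at hx1
      change l' x = 0 at hx2
      change l y = 0 at hy1
      change l' y = 1 at hy2
      have hKl : K ≤ LinearMap.ker (-l) := fun v hv => by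
        have : l v = 0 := hv.1
        simp [this]
      have hD : finrank F K + 1 = a := by omega
      -- The form `l' - t l` kills `x + t y` for every `t`, so it annihilates the whole pencil. It
      -- takes the value `l + l'` at `t = -1`, which is where the affine function `p` is finally
      -- evaluated.
      obtain ⟨p, hp⟩ := hpoly K x y hD hind l' (-l) inf_le_right hKl hx2
        (by simp [hx1, hy2]) (by simp [hy1])
      obtain ⟨q, hq⟩ := hpoly K y x hD hind.symm (-l) l' hKl inf_le_right (by simp [hy1])
        (by simp [hx1, hy2]) hx2
      have hker : ∀ t, pencil K x y t ≤ LinearMap.ker (l' + t • -l) := fun t => by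
        refine sup_le (fun v hv => ?_) ?_
        · simp [show l v = 0 from hv.1, show l' v = 0 from hv.2]
        · simp [hx1, hx2, hy1, hy2]
      have hker' : ∀ t, pencil K y x t ≤ LinearMap.ker (-l + t • l') := fun t => by
        refine sup_le (fun v hv => ?_) ?_
        · simp [show l v = 0 from hv.1, show l' v = 0 from hv.2]
        · simp [hx1, hx2, hy1, hy2]
      have hp' : ∀ t, p.eval t = h (α (l' + t • -l)) (l' + t • -l) := fun t => by
        rw [hp, hH _ (by rw [hind.finrank_pencil, hD]) _ (hker t)]
      have hq' : ∀ t, q.eval t = h (α (-l + t • l')) (-l + t • l') := fun t => by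
        rw [hq, hH _ (by rw [hind.symm.finrank_pencil, hD]) _ (hker' t)]
      have e := eval_eq_of_eval_inv_mul (p := p) (q := q) (fun t ht => by
        rw [hp', hq', ← hHsmul]
        have : t • (-l + t⁻¹ • l') = l' + t • -l := by
          rw [smul_add, smul_smul, mul_inv_cancel₀ ht, one_smul, add_comm]
        rw [this]) (-1)
      have hneg := hHsmul (-1) l
      rw [show (-1 : F) • l = -l from LinearMap.ext fun v => by simp] at hneg
      have h3 : l' + (-1 : F) • -l = l + l' := LinearMap.ext fun v => by simp [add_comm]
      simp only [hp', hq', zero_smul, add_zero, hneg, h3] at e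
      rw [e]
      ring
  let H : Dual F (Dual F V) :=
    { toFun := fun l => h (α l) l, map_add' := hHadd, map_smul' := hHsmul }
  refine ⟨(evalEquiv F V).symm H, fun A hA l hl => ?_⟩
  rw [hH A hA l hl, apply_evalEquiv_symm_apply]
  rfl

end Pencils

/-! ### Points given by frames -/

section Frames

variable {R S : CommAlgCat.{0} ℂ} {k n : ℕ}

theorem isSummand_top {R : Type} [CommRing R] {k : ℕ} :
    IsSummand k (⊤ : Submodule R (Fin k → R)) := by
  have : Subsingleton ((Fin k → R) ⧸ (⊤ : Submodule R (Fin k → R))) :=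
    Submodule.Quotient.subsingleton_iff.2 rfl
  refine ⟨inferInstance, fun p => ?_⟩
  rw [Module.rankAtStalk_eq_of_equiv (Submodule.topEquiv), rank_fun]

theorem isSummand_range {R : Type} [CommRing R] {k n : ℕ} (M : Matrix (Fin n) (Fin k) R)
    (L : Matrix (Fin k) (Fin n) R) (h : L * M = 1) : IsSummand k (LinearMap.range M.mulVecLin) := by
  rw [LinearMap.range_eq_map]
  refine isSummand_top.map _ L.mulVecLin fun v => ?_
  simp [Matrix.mulVec_mulVec, h]

/-- The column space of a matrix with a left inverse. -/
def framePt (M : Matrix (Fin n) (Fin k) R) (L : Matrix (Fin k) (Fin n) R) (h : L * M = 1) :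
    (Gr k n).obj R :=
  Gr.mk (LinearMap.range M.mulVecLin) (isSummand_range M L h)

theorem mem_framePt {M : Matrix (Fin n) (Fin k) R} {L : Matrix (Fin k) (Fin n) R} {h : L * M = 1}
    {v : Fin n → R} : v ∈ Gr.toSubmodule (framePt M L h) ↔ ∃ u, M.mulVec u = v := Iff.rfl

theorem map_mul_eq_one (f : R ⟶ S) {M : Matrix (Fin n) (Fin k) R} {L : Matrix (Fin k) (Fin n) R}
    (h : L * M = 1) : L.map f.hom * M.map f.hom = 1 := by
  have := congrArg (fun N => N.map f.hom) h
  simpa [Matrix.map_mul] using this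

theorem vmap_mulVec (f : R ⟶ S) (M : Matrix (Fin n) (Fin k) R) (u : Fin k → R) :
    vmap n f (M.mulVec u) = (M.map f.hom).mulVec (vmap k f u) := by
  ext i
  simp only [vmap_apply, Matrix.mulVec, dotProduct, map_sum, map_mul, Matrix.map_apply]

theorem framePt_map (f : R ⟶ S) (M : Matrix (Fin n) (Fin k) R) (L : Matrix (Fin k) (Fin n) R)
    (h : L * M = 1) : (Gr k n).map f (framePt M L h) =
      framePt (M.map f.hom) (L.map f.hom) (map_mul_eq_one f h) := by
  refine Gr.map_eq_of_forall_mem f _ _ ?_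
  rintro _ ⟨u, rfl⟩
  exact ⟨vmap k f u, (vmap_mulVec f M u).symm⟩

/-- A basis gives the columns, and a projection onto the summand followed by the coordinates gives
the left inverse. -/
theorem exists_framePt [Nontrivial R] (A : (Gr k n).obj R)
    [Module.Free R (Gr.toSubmodule A)] :
    ∃ M L h, A = framePt M L h := by
  have hr : Module.finrank R (Gr.toSubmodule A) = k := by
    obtain ⟨p⟩ : Nonempty (PrimeSpectrum R) := inferInstance
    have := (Gr.isSummand A).2 p
    rwa [Module.rankAtStalk_eq_finrank_of_free] at this
  let e : (Fin k → R) ≃ₗ[R] Gr.toSubmodule A :=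
    LinearEquiv.ofFinrankEq _ _ (by rw [hr]; simp)
  obtain ⟨π, hπ⟩ := exists_projection (Gr.toSubmodule A)
  let μ : (Fin k → R) →ₗ[R] (Fin n → R) := (Gr.toSubmodule A).subtype ∘ₗ e.toLinearMap
  let l : (Fin n → R) →ₗ[R] (Fin k → R) := e.symm.toLinearMap ∘ₗ π
  have hl : l ∘ₗ μ = LinearMap.id := by
    refine LinearMap.ext fun v => ?_
    simp [l, μ, hπ]
  refine ⟨LinearMap.toMatrix' μ, LinearMap.toMatrix' l, ?_, Gr.ext ?_⟩
  · rw [← LinearMap.toMatrix'_comp, hl, LinearMap.toMatrix'_id]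
  · ext v
    rw [mem_framePt]
    constructor
    · intro hv
      exact ⟨e.symm ⟨v, hv⟩, by rw [LinearMap.toMatrix'_mulVec]; simp [μ]⟩
    · rintro ⟨u, rfl⟩
      rw [LinearMap.toMatrix'_mulVec]
      exact (e u).2

end Frames

/-! ### Points over fields and over polynomial rings -/

section FieldPoints

open Polynomial

variable {F : Type} [Field F] {k n : ℕ}

theorem isSummand_of_finrank {L : Submodule F (Fin n → F)} (h : Module.finrank F L = k) :
    IsSummand k L :=
  ⟨inferInstance, fun p => by rw [Module.rankAtStalk_eq_finrank_of_free, ← h]; rfl⟩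

variable [Algebra ℂ F]

/-- The point of the Grassmannian over a field given by a subspace. -/
def Gr.ofFinrank (L : Submodule F (Fin n → F)) (h : Module.finrank F L = k) :
    (Gr k n).obj (CommAlgCat.of ℂ F) :=
  Gr.mk (R := CommAlgCat.of ℂ F) L (isSummand_of_finrank h)

theorem Gr.finrank_eq (A : (Gr k n).obj (CommAlgCat.of ℂ F)) :
    Module.finrank F (Gr.toSubmodule A : Submodule F (Fin n → F)) = k := by
  obtain ⟨p⟩ : Nonempty (PrimeSpectrum F) := inferInstance
  have := (Gr.isSummand A).2 p
  rw [Module.rankAtStalk_eq_finrank_of_free] at this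
  exact this

variable (F) in
/-- The inclusion of the constants in the polynomial ring. -/
def constX : CommAlgCat.of ℂ F ⟶ CommAlgCat.of ℂ F[X] :=
  CommAlgCat.ofHom (IsScalarTower.toAlgHom ℂ F F[X])

/-- The evaluation of polynomials at `t`. -/
def evalX (t : F) : CommAlgCat.of ℂ F[X] ⟶ CommAlgCat.of ℂ F :=
  CommAlgCat.ofHom ((Polynomial.aeval t).restrictScalars ℂ)

theorem evalX_apply (t : F) (p : F[X]) : (evalX t).hom p = p.eval t := by
  simp only [evalX, CommAlgCat.hom_ofHom, AlgHom.restrictScalars_apply]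
  exact Polynomial.coe_aeval_eq_eval t ▸ rfl

theorem constX_evalX (t : F) : constX F ≫ evalX t = 𝟙 _ := by
  ext c
  have : (evalX t).hom (C c) = c := by rw [evalX_apply, eval_C]
  exact this

theorem map_constX_evalX {X : Space} (t : F) (x : X.obj (CommAlgCat.of ℂ F)) :
    X.map (evalX t) (X.map (constX F) x) = x := by
  rw [← Functor.map_comp_apply, constX_evalX, X.map_id]
  rfl

instance : Infinite F := Infinite.of_injective (algebraMap ℂ F) (algebraMap ℂ F).injective

/-- Membership is the vanishing of the polynomials `q · v` for `q` annihilating `B`, and a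
polynomial over an infinite field vanishes if all its values do. -/
theorem mem_of_forall_evalX (B : (Gr k n).obj (CommAlgCat.of ℂ F[X])) {v : Fin n → F[X]}
    (h : ∀ t, vmap n (evalX t) v ∈ Gr.toSubmodule ((Gr k n).map (evalX t) B)) :
    v ∈ Gr.toSubmodule B := by
  have := Gr.projective_quot B
  refine mem_of_forall_annihilates (R := CommAlgCat.of ℂ F[X]) fun q hq => Polynomial.funext fun t => ?_
  rw [eval_zero, ← evalX_apply, ← vmap_dotProduct]
  exact hq.map (evalX t) _ (h t)

theorem annihilates_of_forall_evalX (B : (Gr k n).obj (CommAlgCat.of ℂ F[X])) {q : Fin n → F[X]}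
    (h : ∀ t, Annihilates (vmap n (evalX t) q) (Gr.toSubmodule ((Gr k n).map (evalX t) B))) :
    Annihilates q (Gr.toSubmodule B) := by
  refine fun v hv => Polynomial.funext fun t => ?_
  rw [eval_zero, ← evalX_apply, ← vmap_dotProduct]
  exact h t _ (Gr.map_mem _ _ hv)

/-- Take the frame `M₀ + X M₁`, whose columns span `D` together with `x + X y`. Since `D`, `x`, `y`
are independent, a constant matrix `L` satisfies `L M₀ = 1` and `L M₁ = 0`, so it is a left inverse
for all parameters at once. -/
theorem exists_pencil_family {D : Submodule F (Fin n → F)} {x y : Fin n → F}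
    (hind : IndepMod D x y) (hD : Module.finrank F D + 1 = k) :
    ∃ B : (Gr k n).obj (CommAlgCat.of ℂ F[X]),
      ∀ t, Gr.toSubmodule ((Gr k n).map (evalX t) B) = pencil D x y t := by
  let j : (D × F) × F →ₗ[F] (Fin n → F) :=
    (D.subtype.coprod (LinearMap.toSpanSingleton F _ x)).coprod (LinearMap.toSpanSingleton F _ y)
  have hj : LinearMap.ker j = ⊥ := by
    rw [LinearMap.ker_eq_bot']
    rintro ⟨⟨d, α⟩, β⟩ h
    simp only [j, LinearMap.coprod_apply, LinearMap.toSpanSingleton_apply,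
      Submodule.subtype_apply] at h
    have h1 : α • x + β • y ∈ D := by
      rw [add_assoc] at h
      rw [eq_neg_of_add_eq_zero_right h]
      exact D.neg_mem d.2
    obtain ⟨rfl, rfl⟩ := hind _ _ h1
    simpa using h
  obtain ⟨l, hl⟩ := LinearMap.exists_leftInverse_of_injective j hj
  let e : (Fin k → F) ≃ₗ[F] D × F := LinearEquiv.ofFinrankEq _ _ (by simp [hD])
  let M₀ := LinearMap.toMatrix' (j ∘ₗ LinearMap.inl F (D × F) F ∘ₗ e.toLinearMap)
  let M₁ := LinearMap.toMatrix'
    (j ∘ₗ LinearMap.inr F (D × F) F ∘ₗ LinearMap.snd F D F ∘ₗ e.toLinearMap)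
  let L := LinearMap.toMatrix' (e.symm.toLinearMap ∘ₗ LinearMap.fst F (D × F) F ∘ₗ l)
  have hl' : ∀ z, l (j z) = z := fun z => LinearMap.congr_fun hl z
  have h0 : L * M₀ = 1 := by
    rw [← LinearMap.toMatrix'_comp, ← LinearMap.toMatrix'_id]
    congr 1
    refine LinearMap.ext fun v => ?_
    simp [hl']
  have h1 : L * M₁ = 0 := by
    rw [← LinearMap.toMatrix'_comp, ← map_zero LinearMap.toMatrix']
    congr 1
    refine LinearMap.ext fun v => ?_
    simp [hl']
  have hLX : (L.map C) * (M₀.map C + (X : F[X]) • M₁.map C) = 1 := by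
    rw [Matrix.mul_add, Matrix.mul_smul, ← Matrix.map_mul, ← Matrix.map_mul, h0, h1]
    simp
  refine ⟨framePt (R := CommAlgCat.of ℂ F[X]) _ _ hLX, fun t => ?_⟩
  rw [framePt_map]
  have hM : ∀ u, ((M₀.map C + (X : F[X]) • M₁.map C).map (evalX t).hom).mulVec u =
      ((e u).1 : Fin n → F) + (e u).2 • (x + t • y) := fun u => by
    have : (M₀.map C + (X : F[X]) • M₁.map C).map (evalX t).hom = M₀ + t • M₁ := by
      ext i j
      rw [Matrix.map_apply, evalX_apply]
      simp only [Matrix.add_apply, Matrix.smul_apply, Matrix.map_apply, smul_eq_mul, eval_add,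
        eval_mul, eval_C, eval_X]
    rw [this]
    refine (Matrix.add_mulVec _ _ _).trans ?_
    rw [Matrix.smul_mulVec, LinearMap.toMatrix'_mulVec, LinearMap.toMatrix'_mulVec]
    simp only [j, LinearMap.comp_apply, LinearMap.coprod_apply, LinearMap.inl_apply,
      LinearMap.inr_apply, LinearMap.toSpanSingleton_apply, Submodule.subtype_apply,
      LinearEquiv.coe_coe, LinearMap.snd_apply, map_zero, zero_add, add_zero, smul_add]
    rw [smul_comm t, add_assoc]
  ext v
  rw [mem_framePt, pencil, Submodule.mem_sup]
  simp only [Submodule.mem_span_singleton, hM]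
  constructor
  · rintro ⟨u, rfl⟩
    exact ⟨_, (e u).1.2, _, ⟨_, rfl⟩, rfl⟩
  · rintro ⟨d, hd, _, ⟨c, rfl⟩, rfl⟩
    exact ⟨e.symm (⟨d, hd⟩, c), by simp⟩

end FieldPoints

/-! ### Sections at points over fields -/

section BoxField

variable {R : CommAlgCat.{0} ℂ} {m n a b : ℕ}

theorem Annihilates.add {R : Type} [CommRing R] {q q' : Fin m → R}
    {A : Submodule R (Fin m → R)} (h : Annihilates q A) (h' : Annihilates q' A) :
    Annihilates (q + q') A := fun w hw => by rw [add_dotProduct, h w hw, h' w hw, add_zero]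

theorem Annihilates.smul {R : Type} [CommRing R] {q : Fin m → R}
    {A : Submodule R (Fin m → R)} (h : Annihilates q A) (c : R) :
    Annihilates (c • q) A := fun w hw => by rw [smul_dotProduct, h w hw, smul_zero]

theorem annForm_add {R : Type} [CommRing R] {q q' : Fin m → R}
    {A : Submodule R (Fin m → R)} (h : Annihilates q A) (h' : Annihilates q' A) :
    annForm A (q + q') (h.add h') = annForm A q h + annForm A q' h' := by
  ext w
  simp

theorem annForm_smul {R : Type} [CommRing R] {q : Fin m → R}
    {A : Submodule R (Fin m → R)} (h : Annihilates q A) (c : R) :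
    annForm A (c • q) (h.smul c) = c • annForm A q h := by
  ext w
  simp

variable (s : (QBoxUDual a m b n).sections)

theorem boxEval_congr {A A' : (Gr a m).obj R} {B B' : (Gr b n).obj R} {q q' : Fin m → R}
    {v v' : Fin n → R} (hA : A = A') (hB : B = B') (hq : q = q') (hv : v = v') (h₁ h₂ h₁' h₂') :
    boxEval s A B q h₁ v h₂ = boxEval s A' B' q' h₁' v' h₂' := by
  subst hA hB hq hv
  rfl

theorem boxEval_add_right {A : (Gr a m).obj R} {B : (Gr b n).obj R} {q : Fin m → R} (hq)
    {v w : Fin n → R} (hv hw) (h) :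
    boxEval s A B q hq (v + w) h = boxEval s A B q hq v hv + boxEval s A B q hq w hw := by
  have : (⟨v + w, h⟩ : Gr.toSubmodule B) = ⟨v, hv⟩ + ⟨w, hw⟩ := rfl
  simp only [boxEval, this, map_add, TensorProduct.tmul_add, LinearMap.add_apply]

theorem boxEval_smul_right {A : (Gr a m).obj R} {B : (Gr b n).obj R} {q : Fin m → R} (hq)
    {v : Fin n → R} (hv) (c : R) (h) :
    boxEval s A B q hq (c • v) h = c * boxEval s A B q hq v hv := by
  have : (⟨c • v, h⟩ : Gr.toSubmodule B) = c • ⟨v, hv⟩ := rfl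
  simp only [boxEval, this, map_smul, TensorProduct.tmul_smul, LinearMap.smul_apply, smul_eq_mul]

theorem boxEval_add_left {A : (Gr a m).obj R} {B : (Gr b n).obj R} {q q' : Fin m → R} (hq hq')
    {v : Fin n → R} (hv) (h) :
    boxEval s A B (q + q') h v hv = boxEval s A B q hq v hv + boxEval s A B q' hq' v hv := by
  simp only [boxEval, annForm_add hq hq', map_add, TensorProduct.add_tmul, LinearMap.add_apply]

theorem boxEval_smul_left {A : (Gr a m).obj R} {B : (Gr b n).obj R} {q : Fin m → R} (hq)
    {v : Fin n → R} (hv) (c : R) (h) :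
    boxEval s A B (c • q) h v hv = c * boxEval s A B q hq v hv := by
  rw [boxEval, annForm_smul hq, ← TensorProduct.smul_tmul', map_smul]
  rfl

open Polynomial

variable {F : Type} [Field F]

/-- The vector representing a linear form. -/
def dualVec (l : Module.Dual F (Fin m → F)) : Fin m → F := fun i => l (Pi.single i 1)

theorem dualVec_dotProduct (l : Module.Dual F (Fin m → F)) (w : Fin m → F) :
    dualVec l ⬝ᵥ w = l w := by
  conv_rhs => rw [pi_eq_sum_univ' w, map_sum]
  refine Finset.sum_congr rfl fun i _ => ?_
  rw [map_smul, smul_eq_mul, mul_comm]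
  rfl

theorem annihilates_dualVec {l : Module.Dual F (Fin m → F)} {A : Submodule F (Fin m → F)}
    (h : A ≤ LinearMap.ker l) : Annihilates (dualVec l) A := fun w hw => by
  rw [dualVec_dotProduct]; exact h hw

variable [Algebra ℂ F]

/-- The polynomial family of vectors `v + X w`. -/
def lineX (v w : Fin n → F) : Fin n → CommAlgCat.of ℂ F[X] := fun i => (C (v i) + X * C (w i) : F[X])

theorem vmap_evalX_lineX (v w : Fin n → F) (t : F) :
    vmap n (evalX t) (lineX v w) = v + t • w := by
  ext i
  rw [vmap_apply]
  refine (evalX_apply t (C (v i) + X * C (w i))).trans ?_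
  simp only [eval_add, eval_mul, eval_C, eval_X]
  rfl

theorem vmap_evalX_constX (v : Fin n → F) (t : F) :
    vmap n (evalX t) (vmap n (constX F) v) = v := by
  ext i
  exact (evalX_apply t (C (v i))).trans eval_C

/-- With `A` and `q` fixed, the section is a family of linear forms on the subspaces `B`. Its value
at the `F[X]`-point given by a pencil is a polynomial interpolating the family, so
`exists_form_of_polynomial_on_pencils` applies. -/
theorem box_form_of_field (A : (Gr a m).obj (CommAlgCat.of ℂ F)) (q : Fin m → F)
    (hq : Annihilates q (Gr.toSubmodule A)) :
    ∃ Φ : Module.Dual F (Fin n → F), ∀ (B : (Gr b n).obj (CommAlgCat.of ℂ F)) v hv,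
      boxEval s A B q hq v hv = Φ v := by
  classical
  let h : Submodule F (Fin n → F) → (Fin n → F) → F := fun B v =>
    if h : Module.finrank F B = b ∧ v ∈ B then boxEval s A (Gr.ofFinrank B h.1) q hq v h.2 else 0
  have hh : ∀ (B : Submodule F (Fin n → F)) (hB : Module.finrank F B = b) v (hv : v ∈ B),
      h B v = boxEval s A (Gr.ofFinrank B hB) q hq v hv := fun B hB v hv => dif_pos ⟨hB, hv⟩
  obtain ⟨Φ, hΦ⟩ := exists_form_of_polynomial_on_pencils b h
    (fun B hB v hv w hw => by
      rw [hh B hB v hv, hh B hB w hw, hh B hB _ (B.add_mem hv hw)]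
      exact boxEval_add_right s hq hv hw _)
    (fun B hB v hv c => by
      rw [hh B hB v hv, hh B hB _ (B.smul_mem c hv)]
      exact boxEval_smul_right (R := CommAlgCat.of ℂ F) s (B := Gr.ofFinrank B hB) hq hv c
        (B.smul_mem c hv))
    (fun D x y hD hind w hw c => by
      obtain ⟨B, hB⟩ := exists_pencil_family hind hD
      have hmem : ∀ t, w + c • (x + t • y) ∈ pencil D x y t := fun t =>
        Submodule.add_mem _ (le_pencil _ _ _ _ hw) (Submodule.smul_mem _ _ (mem_pencil _ _ _ _))
      have hX : ∀ t, vmap n (evalX t) (lineX (w + c • x) (c • y)) = w + c • (x + t • y) :=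
        fun t => by
          rw [vmap_evalX_lineX, smul_add, smul_comm c t, add_assoc]
      have hv : lineX (w + c • x) (c • y) ∈ Gr.toSubmodule B :=
        mem_of_forall_evalX B fun t => by rw [hB, hX]; exact hmem t
      refine ⟨boxEval s ((Gr a m).map (constX F) A) B (vmap m (constX F) q) (hq.map _) _ hv,
        fun t => ?_⟩
      rw [hh _ (by rw [hind.finrank_pencil, hD]) _ (hmem t), ← evalX_apply, ← boxEval_map]
      exact boxEval_congr s (map_constX_evalX t A) (Gr.ext (hB t)) (vmap_evalX_constX q t) (hX t)
        _ _ _ _)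
  refine ⟨Φ, fun B v hv => ?_⟩
  rw [← hΦ _ (Gr.finrank_eq B) v hv, hh _ (Gr.finrank_eq B) v hv]
  rfl

/-- The dual argument: `B` and `v` are fixed, and both `A` and the annihilating form move along a
pencil. -/
theorem box_vector_of_field (B : (Gr b n).obj (CommAlgCat.of ℂ F)) (v : Fin n → F)
    (hv : v ∈ Gr.toSubmodule B) :
    ∃ w : Fin m → F, ∀ (A : (Gr a m).obj (CommAlgCat.of ℂ F)) (q : Fin m → F) hq,
      boxEval s A B q hq v hv = q ⬝ᵥ w := by
  classical
  let h : Submodule F (Fin m → F) → Module.Dual F (Fin m → F) → F := fun A l =>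
    if h : Module.finrank F A = a ∧ A ≤ LinearMap.ker l then
      boxEval s (Gr.ofFinrank A h.1) B (dualVec l) (annihilates_dualVec h.2) v hv else 0
  have hh : ∀ (A : Submodule F (Fin m → F)) (hA : Module.finrank F A = a) l (hl : A ≤ LinearMap.ker l),
      h A l = boxEval s (Gr.ofFinrank A hA) B (dualVec l) (annihilates_dualVec hl) v hv :=
    fun A hA l hl => dif_pos ⟨hA, hl⟩
  obtain ⟨w, hw⟩ := exists_vector_of_polynomial_on_pencils a h
    (fun A hA l l' hl hl' => by
      have hll : A ≤ LinearMap.ker (l + l') := fun v hv => by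
        simp [show l v = 0 from hl hv, show l' v = 0 from hl' hv]
      rw [hh A hA l hl, hh A hA l' hl', hh A hA _ hll]
      exact boxEval_add_left s (annihilates_dualVec hl) (annihilates_dualVec hl') hv _)
    (fun A hA l hl c => by
      have hcl : A ≤ LinearMap.ker (c • l) := fun v hv => by
        simp [show l v = 0 from hl hv]
      rw [hh A hA l hl, hh A hA _ hcl]
      exact boxEval_smul_left (R := CommAlgCat.of ℂ F) s (A := Gr.ofFinrank A hA)
        (annihilates_dualVec hl) hv c (annihilates_dualVec hcl))
    (fun D x y hD hind l l' hDl hDl' h1 h2 h3 => by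
      obtain ⟨A, hA⟩ := exists_pencil_family hind hD
      have hker : ∀ t, pencil D x y t ≤ LinearMap.ker (l + t • l') := fun t => by
        refine sup_le (fun v hv => ?_) ?_
        · simp [show l v = 0 from hDl hv, show l' v = 0 from hDl' hv]
        · simp only [Submodule.span_singleton_le_iff_mem, LinearMap.mem_ker, LinearMap.add_apply,
            LinearMap.smul_apply, map_add, map_smul, smul_eq_mul, h1, h3]
          linear_combination t * h2
      have hX : ∀ t, vmap m (evalX t) (lineX (dualVec l) (dualVec l')) = dualVec (l + t • l') :=
        fun t => by
          rw [vmap_evalX_lineX]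
          rfl
      have hq : Annihilates (lineX (dualVec l) (dualVec l')) (Gr.toSubmodule A) :=
        annihilates_of_forall_evalX A fun t => by
          rw [hA, hX]; exact annihilates_dualVec (hker t)
      refine ⟨boxEval s A ((Gr b n).map (constX F) B) _ hq (vmap n (constX F) v)
        (Gr.map_mem _ _ hv), fun t => ?_⟩
      rw [hh _ (by rw [hind.finrank_pencil, hD]) _ (hker t), ← evalX_apply, ← boxEval_map]
      exact boxEval_congr s (Gr.ext (hA t)) (map_constX_evalX t B) (hX t) (vmap_evalX_constX v t)
        _ _ _ _)
  refine ⟨w, fun A q hq => ?_⟩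
  let l : Module.Dual F (Fin m → F) := dotProductBilin F F q
  have hl : (Gr.toSubmodule A : Submodule F (Fin m → F)) ≤ LinearMap.ker l := hq
  have hlq : dualVec l = q := by
    ext i
    simp [dualVec, l]
  have := hw _ (Gr.finrank_eq A) l hl
  rw [hh _ (Gr.finrank_eq A) l hl] at this
  rw [show q ⬝ᵥ w = l w from rfl, ← this]
  exact boxEval_congr s (Gr.ext rfl) rfl hlq.symm rfl _ _ _ _

end BoxField

/-! ### Frames over domains -/

section UniversalFrames

open MvPolynomial

/-- Matrices with left inverses are specialisations of matrices with left inverses over a domain. -/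
theorem exists_universal_frames {R : CommAlgCat.{0} ℂ} [Nontrivial R] {k₁ n₁ k₂ n₂ : ℕ}
    (M : Matrix (Fin n₁) (Fin k₁) R) (L : Matrix (Fin k₁) (Fin n₁) R) (h : L * M = 1)
    (N : Matrix (Fin n₂) (Fin k₂) R) (L' : Matrix (Fin k₂) (Fin n₂) R) (h' : L' * N = 1) :
    ∃ (D : CommAlgCat.{0} ℂ) (_ : IsDomain D) (f : D ⟶ R) (M₀ : Matrix (Fin n₁) (Fin k₁) D)
      (L₀ : Matrix (Fin k₁) (Fin n₁) D) (_ : L₀ * M₀ = 1) (N₀ : Matrix (Fin n₂) (Fin k₂) D)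
      (L₀' : Matrix (Fin k₂) (Fin n₂) D) (_ : L₀' * N₀ = 1),
      M₀.map f.hom = M ∧ N₀.map f.hom = N := by
  let σ := ((Fin n₁ × Fin k₁) ⊕ (Fin k₁ × Fin n₁)) ⊕ ((Fin n₂ × Fin k₂) ⊕ (Fin k₂ × Fin n₂))
  let A := MvPolynomial σ ℂ
  let ev : A →ₐ[ℂ] R := aeval (Sum.elim (Sum.elim (fun x => M x.1 x.2) (fun x => L x.1 x.2))
    (Sum.elim (fun x => N x.1 x.2) (fun x => L' x.1 x.2)))
  let Mg : Matrix (Fin n₁) (Fin k₁) A := fun i j => X (Sum.inl (Sum.inl (i, j)))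
  let Lg : Matrix (Fin k₁) (Fin n₁) A := fun i j => X (Sum.inl (Sum.inr (i, j)))
  let Ng : Matrix (Fin n₂) (Fin k₂) A := fun i j => X (Sum.inr (Sum.inl (i, j)))
  let Lg' : Matrix (Fin k₂) (Fin n₂) A := fun i j => X (Sum.inr (Sum.inr (i, j)))
  have hM : Mg.map ev = M := by ext i j; exact aeval_X _ _
  have hL : Lg.map ev = L := by ext i j; exact aeval_X _ _
  have hN : Ng.map ev = N := by ext i j; exact aeval_X _ _
  have hL' : Lg'.map ev = L' := by ext i j; exact aeval_X _ _
  -- Inverting this determinant makes the generic matrices left invertible. It maps to 1 in `R`, so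
  -- it is nonzero and evaluation extends to the localisation. The new left inverses are corrected
  -- by the inverses of the products, and only `M` and `N` need to be recovered.
  let d : A := (Lg * Mg).det * (Lg' * Ng).det
  have hd : ev d = 1 := by
    simp only [d, map_mul, AlgHom.map_det, AlgHom.mapMatrix_apply, Matrix.map_mul, hM, hL, hN, hL',
      h, h', Matrix.det_one, mul_one]
  have hd0 : d ≠ 0 := by
    rintro e
    rw [e, map_zero] at hd
    exact zero_ne_one hd
  let D := Localization.Away d
  have hdom : IsDomain D := IsLocalization.isDomain_localization
    (powers_le_nonZeroDivisors_of_noZeroDivisors hd0)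
  let g : A →ₐ[ℂ] D := IsScalarTower.toAlgHom ℂ A D
  have hu : IsUnit (g d) := IsLocalization.Away.algebraMap_isUnit d
  let f : D →ₐ[ℂ] R := IsLocalization.liftAlgHom (M := Submonoid.powers d) (f := ev) (by
    rintro ⟨_, i, rfl⟩
    simp [hd])
  have hf : ∀ x, f (g x) = ev x := fun x => IsLocalization.lift_eq _ x
  have hdet : g d = (Lg.map g * Mg.map g).det * (Lg'.map g * Ng.map g).det := by
    simp only [d, map_mul, AlgHom.map_det, AlgHom.mapMatrix_apply, Matrix.map_mul]
  rw [hdet] at hu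
  refine ⟨CommAlgCat.of ℂ D, hdom, CommAlgCat.ofHom f, Mg.map g,
    (Lg.map g * Mg.map g)⁻¹ * Lg.map g, ?_, Ng.map g, (Lg'.map g * Ng.map g)⁻¹ * Lg'.map g,
    ?_, ?_, ?_⟩
  · exact (Matrix.mul_assoc _ _ _).trans (Matrix.nonsing_inv_mul _ (isUnit_of_mul_isUnit_left hu))
  · exact (Matrix.mul_assoc _ _ _).trans (Matrix.nonsing_inv_mul _ (isUnit_of_mul_isUnit_right hu))
  · rw [← hM]
    ext i j
    exact hf _
  · rw [← hN]
    ext i j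
    exact hf _

/-- The localisation at a prime ideal. -/
def localizationAt (R : CommAlgCat.{0} ℂ) (p : Ideal R) [p.IsPrime] :
    R ⟶ CommAlgCat.of ℂ (Localization.AtPrime p) :=
  CommAlgCat.ofHom (IsScalarTower.toAlgHom ℂ R (Localization.AtPrime p))

theorem eq_zero_of_localizationAt {R : CommAlgCat.{0} ℂ} {x : R}
    (h : ∀ (p : Ideal R) [p.IsMaximal], (localizationAt R p).hom x = 0) : x = 0 :=
  eq_zero_of_localization x fun p _ => h p

/-- The inclusion of a domain in its field of fractions. -/
def toFrac (R : CommAlgCat.{0} ℂ) [IsDomain R] : R ⟶ CommAlgCat.of ℂ (FractionRing R) :=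
  CommAlgCat.ofHom (IsScalarTower.toAlgHom ℂ R (FractionRing R))

theorem toFrac_injective (R : CommAlgCat.{0} ℂ) [IsDomain R] :
    Function.Injective (toFrac R).hom :=
  IsFractionRing.injective R (FractionRing R)

theorem free_of_isLocalRing {R : CommAlgCat.{0} ℂ} [IsLocalRing R] {k n : ℕ} (A : (Gr k n).obj R) :
    Module.Free R (Gr.toSubmodule A) :=
  Module.free_of_flat_of_isLocalRing

theorem framePt_map_eq {R S : CommAlgCat.{0} ℂ} {k n : ℕ} (f : R ⟶ S)
    {M : Matrix (Fin n) (Fin k) R} {L : Matrix (Fin k) (Fin n) R} (h : L * M = 1)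
    {M' : Matrix (Fin n) (Fin k) S} {L' : Matrix (Fin k) (Fin n) S} (h' : L' * M' = 1)
    (hM : M.map f.hom = M') : (Gr k n).map f (framePt M L h) = framePt M' L' h' := by
  rw [framePt_map]
  subst hM
  exact Gr.ext rfl

end UniversalFrames

/-! ### Global sections of `Q ⊠ U^∨` -/

section BoxSections

variable {m n a b : ℕ} (s : (QBoxUDual a m b n).sections)

theorem boxEval_zero_left {R : CommAlgCat.{0} ℂ} {A : (Gr a m).obj R} {B : (Gr b n).obj R}
    {v : Fin n → R} (hv) (h) : boxEval s A B 0 h v hv = 0 := by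
  have := boxEval_smul_left s h hv 0 (by simpa using h)
  simpa using this

theorem boxEval_zero_right {R : CommAlgCat.{0} ℂ} {A : (Gr a m).obj R} {B : (Gr b n).obj R}
    {q : Fin m → R} (hq) (h) : boxEval s A B q hq 0 h = 0 := by
  have := boxEval_smul_right s hq h 0 (by simp)
  simpa using this

/-- The entry `P i j` is read off at complex points `A i` annihilated by `e_i` and `B j` containing
`e_j`. These exist when `a < m` and `1 ≤ b ≤ n`; otherwise `q = 0`, or `v = 0`, or there is no `B`.
Over `F`, the value does not depend on the chosen subspaces and is bilinear, so it is determined by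
the base changes of these points. -/
theorem exists_matrix_of_fields : ∃ P : Matrix (Fin m) (Fin n) ℂ,
    ∀ (F : Type) [Field F] [Algebra ℂ F] (A : (Gr a m).obj (CommAlgCat.of ℂ F))
      (B : (Gr b n).obj (CommAlgCat.of ℂ F)) q hq v hv,
      boxEval s A B q hq v hv = q ⬝ᵥ act (CommAlgCat.of ℂ F) P v := by
  by_cases ham : m ≤ a
  · refine ⟨0, fun F _ _ A B q hq v hv => ?_⟩
    have h1 : (Gr.toSubmodule A : Submodule F (Fin m → F)) = ⊤ := by
      have h2 := Gr.finrank_eq A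
      have h3 := Gr.le_of_nontrivial A
      exact Submodule.eq_top_of_finrank_eq (by rw [h2]; simp; omega)
    have h2 : q = 0 := by
      ext i
      have := hq (Pi.single i 1) (h1 ▸ Submodule.mem_top)
      simpa using this
    subst h2
    rw [boxEval_zero_left, zero_dotProduct]
  by_cases hb0 : b = 0
  · subst hb0
    refine ⟨0, fun F _ _ A B q hq v hv => ?_⟩
    have h1 := Submodule.finrank_eq_zero.1 (Gr.finrank_eq B)
    have h2 : v = 0 := by
      rw [h1] at hv
      exact hv
    subst h2
    rw [boxEval_zero_right, map_zero, dotProduct_zero]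
  by_cases hbn : n < b
  · refine ⟨0, fun F _ _ A B => ?_⟩
    have := Gr.le_of_nontrivial B
    omega
  have hA : ∀ i : Fin m, ∃ A : (Gr a m).obj (CommAlgCat.of ℂ ℂ),
      Annihilates (Pi.single i 1) (Gr.toSubmodule A) := fun i => by
    let l : Module.Dual ℂ (Fin m → ℂ) := LinearMap.proj i
    have h1 := LinearMap.finrank_range_add_finrank_ker l
    have h2 := (LinearMap.range l).finrank_le
    rw [Module.finrank_self, Module.finrank_fin_fun] at *
    obtain ⟨A, -, h3, h4⟩ := exists_between_finrank (W := ⊥) (D := LinearMap.ker l) bot_le (b := a)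
      (by simp) (by omega)
    refine ⟨Gr.ofFinrank A h4, fun w hw => ?_⟩
    have : l w = 0 := h3 hw
    simpa [l] using this
  have hB : ∀ j : Fin n, ∃ B : (Gr b n).obj (CommAlgCat.of ℂ ℂ),
      Pi.single j 1 ∈ Gr.toSubmodule B := fun j => by
    obtain ⟨B, h3, -, h4⟩ := exists_between_finrank (F := ℂ) (W := ℂ ∙ (Pi.single j 1 : Fin n → ℂ))
      (D := ⊤) le_top (b := b) ((finrank_span_singleton_le _).trans (by omega))
      (by rw [finrank_top, Module.finrank_fin_fun]; omega)
    exact ⟨Gr.ofFinrank B h4, h3 (Submodule.mem_span_singleton_self _)⟩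
  choose A₀ hA₀ using hA
  choose B₀ hB₀ using hB
  refine ⟨fun i j => boxEval s (A₀ i) (B₀ j) (Pi.single i 1) (hA₀ i) (Pi.single j 1) (hB₀ j),
    fun F _ _ A B q hq v hv => ?_⟩
  let f : CommAlgCat.of ℂ ℂ ⟶ CommAlgCat.of ℂ F := CommAlgCat.ofHom (Algebra.ofId ℂ F)
  obtain ⟨w, hw⟩ := box_vector_of_field (a := a) s B v hv
  rw [hw]
  have hqA : ∀ i, Annihilates (Pi.single i 1) (Gr.toSubmodule ((Gr a m).map f (A₀ i))) := fun i => by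
    have := (hA₀ i).map f
    rwa [vmap_single] at this
  have hvB : ∀ j, Pi.single j 1 ∈ Gr.toSubmodule ((Gr b n).map f (B₀ j)) := fun j => by
    have := Gr.map_mem f _ (hB₀ j)
    rwa [vmap_single] at this
  refine congrArg (q ⬝ᵥ ·) (funext fun i => ?_)
  have h1 := hw ((Gr a m).map f (A₀ i)) (Pi.single i 1) (hqA i)
  rw [single_dotProduct, one_mul] at h1
  obtain ⟨Φ, hΦ⟩ := box_form_of_field (b := b) s ((Gr a m).map f (A₀ i)) (Pi.single i 1) (hqA i)
  rw [← h1, hΦ]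
  refine Eq.trans ?_ (act_apply (CommAlgCat.of ℂ F) _ v i).symm
  conv_lhs => rw [pi_eq_sum_univ' v, map_sum]
  refine Finset.sum_congr rfl fun j _ => ?_
  rw [map_smul, smul_eq_mul, mul_comm]
  refine congrArg (· * v j) ?_
  have h2 := hΦ ((Gr b n).map f (B₀ j)) (Pi.single j 1) (hvB j)
  refine h2.symm.trans ?_
  rw [← boxEval_congr s rfl rfl (vmap_single f i) (vmap_single f j) ((hA₀ i).map f)
    (Gr.map_mem f _ (hB₀ j)), boxEval_map]
  rfl

/-- Test rings may be nonreduced, so fields do not suffice directly. Over a local ring the points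
have frames, which are specialisations of frames over a domain, and a domain embeds in its fraction
field. Localisation handles arbitrary rings. -/
theorem box_eq_zero_of_fields (h : ∀ (F : Type) [Field F] [Algebra ℂ F]
    (A : (Gr a m).obj (CommAlgCat.of ℂ F)) (B : (Gr b n).obj (CommAlgCat.of ℂ F)) q hq v hv,
    boxEval s A B q hq v hv = 0) : s = 0 := by
  have h1 : ∀ (R : CommAlgCat.{0} ℂ) [IsDomain R] (A : (Gr a m).obj R) (B : (Gr b n).obj R),
      boxVal s A B = 0 := fun R _ A B => boxVal_eq_zero fun q hq v hv => by
    apply toFrac_injective R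
    rw [← boxEval_map, h, map_zero]
  have h2 : ∀ (R : CommAlgCat.{0} ℂ) [IsLocalRing R] (A : (Gr a m).obj R) (B : (Gr b n).obj R),
      boxVal s A B = 0 := fun R _ A B => by
    have := free_of_isLocalRing A
    have := free_of_isLocalRing B
    obtain ⟨M, L, hL, rfl⟩ := exists_framePt A
    obtain ⟨N, L', hL', rfl⟩ := exists_framePt B
    obtain ⟨D, _, f, M₀, L₀, h₀, N₀, L₀', h₀', hM, hN⟩ := exists_universal_frames M L hL N L' hL'
    rw [← framePt_map_eq f h₀ hL hM, ← framePt_map_eq f h₀' hL' hN, boxVal_map, h1, map_zero]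
  refine box_ext fun R A B q hq v hv => ?_
  refine (eq_zero_of_localizationAt fun p _ => ?_).trans ?_
  · have := h2 (CommAlgCat.of ℂ (Localization.AtPrime p)) ((Gr a m).map (localizationAt R p) A)
      ((Gr b n).map (localizationAt R p) B)
    rw [← boxEval_map, boxEval, this, map_zero]
  · rw [boxEval, boxVal_zero, map_zero]

theorem boxSec_surjective : Function.Surjective (boxSec a m b n) := fun s => by
  obtain ⟨P, hP⟩ := exists_matrix_of_fields s
  refine ⟨P, ?_⟩
  rw [eq_comm, ← sub_eq_zero]
  refine box_eq_zero_of_fields _ fun F _ _ A B q hq v hv => ?_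
  have h1 := boxEval_add (s - boxSec a m b n P) (boxSec a m b n P) A B q hq v hv
  rw [sub_add_cancel, boxEval_sec, hP] at h1
  simpa using h1

end BoxSections

/-! ### Global sections on flag manifolds -/

section FlSections

open Polynomial

variable {n b c r : ℕ} (t : ((Fl.Q₂ b c n).power r).sections)

theorem Fl.ext {R : CommAlgCat.{0} ℂ} {x y : (Fl b c n).obj R} (h₁ : Fl.pt₁ x = Fl.pt₁ y)
    (h₂ : Fl.pt₂ x = Fl.pt₂ y) : x = y :=
  Subtype.ext (Prod.ext h₁ h₂)

theorem flEval_congr {R : CommAlgCat.{0} ℂ} {x y : (Fl b c n).obj R} {q q' : Fin n → R}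
    (h : x = y) (hq : q = q') (i) (h₁ h₁') : flEval t x i q h₁ = flEval t y i q' h₁' := by
  subst h hq
  rfl

theorem flEval_add_right {R : CommAlgCat.{0} ℂ} {x : (Fl b c n).obj R} (i) {q q' : Fin n → R}
    (hq hq') (h) : flEval t x i (q + q') h = flEval t x i q hq + flEval t x i q' hq' := by
  rw [flEval, annForm_add hq hq']
  rfl

theorem flEval_smul_right {R : CommAlgCat.{0} ℂ} {x : (Fl b c n).obj R} (i) {q : Fin n → R}
    (hq) (z : R) (h) : flEval t x i (z • q) h = z * flEval t x i q hq := by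
  rw [flEval, annForm_smul hq]
  rfl

theorem flEval_zero_right {R : CommAlgCat.{0} ℂ} {x : (Fl b c n).obj R} (i) (h) :
    flEval t x i 0 h = 0 := by
  have := flEval_smul_right t i h 0 (by simpa using h)
  simpa using this

variable {F : Type} [Field F] [Algebra ℂ F]

theorem le_of_forall_evalX {B : (Gr b n).obj (CommAlgCat.of ℂ F[X])}
    {C : (Gr c n).obj (CommAlgCat.of ℂ F[X])}
    (h : ∀ z, Gr.toSubmodule ((Gr b n).map (evalX z) B) ≤
      Gr.toSubmodule ((Gr c n).map (evalX z) C)) :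
    Gr.toSubmodule B ≤ Gr.toSubmodule C := fun _ hv =>
  mem_of_forall_evalX C fun z => h z (Gr.map_mem _ _ hv)

theorem exists_polynomial_flEval {D : Submodule F (Fin n → F)} {v w : Fin n → F}
    {C : (Gr c n).obj (CommAlgCat.of ℂ F)} (i : Fin r) {q : Fin n → F}
    (hq : Annihilates q (Gr.toSubmodule C)) (hind : IndepMod D v w)
    (hD : Module.finrank F D + 1 = b) (hle : ∀ z : F, pencil D v w z ≤ Gr.toSubmodule C) :
    ∃ p : F[X], ∀ (z : F) (hz : Module.finrank F (pencil D v w z) = b),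
      flEval t (Fl.mk (Gr.ofFinrank _ hz) C (hle z)) i q hq = p.eval z := by
  obtain ⟨B, hB⟩ := exists_pencil_family hind hD
  have hBC : Gr.toSubmodule B ≤ Gr.toSubmodule ((Gr c n).map (constX F) C) :=
    le_of_forall_evalX fun z => by rw [hB, map_constX_evalX]; exact hle z
  have hqX : Annihilates (vmap n (constX F) q) (Gr.toSubmodule (Fl.pt₂ (Fl.mk B _ hBC))) :=
    hq.map _
  refine ⟨flEval t (Fl.mk B _ hBC) i (vmap n (constX F) q) hqX, fun z hz => ?_⟩
  rw [← evalX_apply, ← flEval_map]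
  exact flEval_congr t (Fl.ext (x := Fl.mk (Gr.ofFinrank _ hz) C (hle z))
    (y := (Fl b c n).map (evalX z) (Fl.mk B _ hBC)) (Gr.ext (hB z).symm)
    (map_constX_evalX z C).symm) (vmap_evalX_constX q z).symm _ _ _

/-- The fibre of the flag manifold over `C` is a Grassmannian, and the bundle is constant along it.
Pencils inside `C` join any two choices of the small subspace, so the value of the section does not
change. -/
theorem flEval_mk_eq_mk {B B' : (Gr b n).obj (CommAlgCat.of ℂ F)}
    {C : (Gr c n).obj (CommAlgCat.of ℂ F)} (i : Fin r) {q : Fin n → F}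
    (hq : Annihilates q (Gr.toSubmodule C)) (hB : Gr.toSubmodule B ≤ Gr.toSubmodule C)
    (hB' : Gr.toSubmodule B' ≤ Gr.toSubmodule C) :
    flEval t (Fl.mk B C hB) i q hq = flEval t (Fl.mk B' C hB') i q hq := by
  classical
  obtain ⟨g, hg⟩ : ∃ g : Submodule F (Fin n → F) → F,
      ∀ (B : Submodule F (Fin n → F)) (hB : Module.finrank F B = b)
        (hBC : B ≤ Gr.toSubmodule C),
        g B = flEval t (Fl.mk (Gr.ofFinrank B hB) C hBC) i q hq :=
    ⟨fun B => if h : Module.finrank F B = b ∧ B ≤ Gr.toSubmodule C then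
      flEval t (Fl.mk (Gr.ofFinrank B h.1) C h.2) i q hq else 0,
      fun B hB hBC => dif_pos ⟨hB, hBC⟩⟩
  have h1 := hg _ (Gr.finrank_eq B) hB
  have h2 := hg _ (Gr.finrank_eq B') hB'
  refine h1.symm.trans (Eq.trans ?_ h2)
  refine eq_of_polynomial_on_pencils (F := F) b (⊥ : Submodule F (Fin n → F))
    (Gr.toSubmodule C) g (fun D v w _ hDC hv hw hD hind => ?_)
    (Gr.finrank_eq B) (Gr.finrank_eq B') bot_le bot_le hB hB'
  have hle : ∀ z : F, pencil D v w z ≤ Gr.toSubmodule C := fun z =>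
    sup_le hDC (by simpa using Submodule.add_mem _ hv (Submodule.smul_mem _ z hw))
  obtain ⟨p, hp⟩ := exists_polynomial_flEval t i hq hind hD hle
  refine ⟨p, fun z => ?_⟩
  have hz : Module.finrank F (pencil D v w z) = b := by rw [hind.finrank_pencil, hD]
  exact ((hg _ hz (hle z)).trans (hp z hz)).symm

theorem flEval_eq_of_pt₂_eq {x y : (Fl b c n).obj (CommAlgCat.of ℂ F)} (i : Fin r)
    {q : Fin n → F} (hq : Annihilates q (Gr.toSubmodule (Fl.pt₂ x)))
    (hq' : Annihilates q (Gr.toSubmodule (Fl.pt₂ y))) (h : Fl.pt₂ x = Fl.pt₂ y) :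
    flEval t x i q hq = flEval t y i q hq' := by
  have hy : Gr.toSubmodule (Fl.pt₁ y) ≤ Gr.toSubmodule (Fl.pt₂ x) := h ▸ Fl.le y
  refine (flEval_mk_eq_mk t i hq (Fl.le x) hy).trans ?_
  exact flEval_congr t (Fl.ext (x := Fl.mk (Fl.pt₁ y) (Fl.pt₂ x) hy) (y := y) rfl h) rfl i _ hq'

/-- A pencil of large subspaces lifts to flags: if `b = c` the small subspace is the large one, and
if `b < c` a constant one can be chosen inside `D`, which has dimension `c - 1`. -/
theorem exists_flag_over_pencil (hbc : b ≤ c) {D : Submodule F (Fin n → F)} {v w : Fin n → F}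
    (hind : IndepMod D v w) (hD : Module.finrank F D + 1 = c) :
    ∃ x : (Fl b c n).obj (CommAlgCat.of ℂ F[X]),
      ∀ z, Gr.toSubmodule ((Gr c n).map (evalX z) (Fl.pt₂ x)) = pencil D v w z := by
  obtain ⟨C, hC⟩ := exists_pencil_family hind hD
  rcases hbc.eq_or_lt with rfl | hlt
  · exact ⟨Fl.mk C C le_rfl, hC⟩
  · obtain ⟨B, -, hBD, hB⟩ := exists_between_finrank (W := ⊥) (D := D) bot_le (b := b)
      (by simp) (by omega)
    refine ⟨Fl.mk ((Gr b n).map (constX F) (Gr.ofFinrank B hB)) C (le_of_forall_evalX fun z => ?_),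
      hC⟩
    rw [map_constX_evalX, hC]
    exact hBD.trans (le_pencil _ _ _ _)

theorem Fl.le_of_field (x : (Fl b c n).obj (CommAlgCat.of ℂ F)) : b ≤ c := by
  have h := Submodule.finrank_mono (R := F) (Fl.le x)
  have h₁ := Gr.finrank_eq (Fl.pt₁ x)
  have h₂ := Gr.finrank_eq (Fl.pt₂ x)
  exact h₁.symm.trans_le (h.trans_eq h₂)

/-- The value depends only on the large subspace `C`, so an arbitrary flag is chosen over each `C`.
The result is a family of functions on annihilators, to which
`exists_vector_of_polynomial_on_pencils` applies. -/
theorem fl_vector_of_field (hbc : b ≤ c) (i : Fin r) :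
    ∃ w : Fin n → F, ∀ (x : (Fl b c n).obj (CommAlgCat.of ℂ F)) (q : Fin n → F) hq,
      flEval t x i q hq = q ⬝ᵥ w := by
  classical
  have hβ : ∀ (C : Submodule F (Fin n → F)) (_ : Module.finrank F C = c),
      ∃ B ≤ C, Module.finrank F B = b := fun C hC => by
    obtain ⟨B, -, hBC, hB⟩ := exists_between_finrank (W := ⊥) (D := C) bot_le (b := b)
      (by simp) (by omega)
    exact ⟨B, hBC, hB⟩
  choose β hβ hβ' using hβ
  let pt : ∀ (C : Submodule F (Fin n → F)) (_ : Module.finrank F C = c),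
      (Fl b c n).obj (CommAlgCat.of ℂ F) := fun C hC =>
    Fl.mk (Gr.ofFinrank (β C hC) (hβ' C hC)) (Gr.ofFinrank C hC) (hβ C hC)
  let h : Submodule F (Fin n → F) → Module.Dual F (Fin n → F) → F := fun C l =>
    if h : Module.finrank F C = c ∧ C ≤ LinearMap.ker l then
      flEval t (pt C h.1) i (dualVec l) (annihilates_dualVec h.2) else 0
  have hh : ∀ (C : Submodule F (Fin n → F)) (hC : Module.finrank F C = c) l
      (hl : C ≤ LinearMap.ker l),
      h C l = flEval t (pt C hC) i (dualVec l) (annihilates_dualVec hl) :=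
    fun C hC l hl => dif_pos ⟨hC, hl⟩
  obtain ⟨w, hw⟩ := exists_vector_of_polynomial_on_pencils c h
    (fun C hC l l' hl hl' => by
      have hll : C ≤ LinearMap.ker (l + l') := fun v hv => by
        simp [show l v = 0 from hl hv, show l' v = 0 from hl' hv]
      rw [hh C hC l hl, hh C hC l' hl', hh C hC _ hll]
      exact flEval_add_right t i (annihilates_dualVec hl) (annihilates_dualVec hl') _)
    (fun C hC l hl z => by
      have hcl : C ≤ LinearMap.ker (z • l) := fun v hv => by
        simp [show l v = 0 from hl hv]
      rw [hh C hC l hl, hh C hC _ hcl]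
      exact flEval_smul_right (R := CommAlgCat.of ℂ F) t (x := pt C hC) i
        (annihilates_dualVec hl) z (annihilates_dualVec hcl))
    (fun D v w hD hind l l' hDl hDl' h1 h2 h3 => by
      obtain ⟨x, hx⟩ := exists_flag_over_pencil hbc hind hD
      have hker : ∀ z, pencil D v w z ≤ LinearMap.ker (l + z • l') := fun z => by
        refine sup_le (fun v hv => ?_) ?_
        · simp [show l v = 0 from hDl hv, show l' v = 0 from hDl' hv]
        · simp only [Submodule.span_singleton_le_iff_mem, LinearMap.mem_ker, LinearMap.add_apply,
            LinearMap.smul_apply, map_add, map_smul, smul_eq_mul, h1, h3]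
          linear_combination z * h2
      have hX : ∀ z, vmap n (evalX z) (lineX (dualVec l) (dualVec l')) = dualVec (l + z • l') :=
        fun z => by
          rw [vmap_evalX_lineX]
          rfl
      have hq : Annihilates (lineX (dualVec l) (dualVec l')) (Gr.toSubmodule (Fl.pt₂ x)) :=
        annihilates_of_forall_evalX (Fl.pt₂ x) fun z => by
          rw [hx, hX]; exact annihilates_dualVec (hker z)
      refine ⟨flEval t x i _ hq, fun z => ?_⟩
      have hd := hind.finrank_pencil z
      rw [hD] at hd
      rw [hh _ hd _ (hker z), ← evalX_apply, ← flEval_map]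
      have h4 : Annihilates (dualVec (l + z • l'))
          (Gr.toSubmodule (Fl.pt₂ ((Fl b c n).map (evalX z) x))) := by
        rw [Fl.pt₂_map, hx]
        exact annihilates_dualVec (hker z)
      exact (flEval_congr t rfl (hX z) i _ h4).trans
        (flEval_eq_of_pt₂_eq t i _ _ (Gr.ext (hx z))))
  refine ⟨w, fun x q hq => ?_⟩
  let l : Module.Dual F (Fin n → F) := dotProductBilin F F q
  have hl : (Gr.toSubmodule (Fl.pt₂ x) : Submodule F (Fin n → F)) ≤ LinearMap.ker l := hq
  have hlq : dualVec l = q := by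
    ext i
    simp [dualVec, l]
  have := hw _ (Gr.finrank_eq (Fl.pt₂ x)) l hl
  rw [hh _ (Gr.finrank_eq (Fl.pt₂ x)) l hl] at this
  rw [show q ⬝ᵥ w = l w from rfl, ← this]
  have hq' : Annihilates (dualVec l) (Gr.toSubmodule (Fl.pt₂ x)) := by rwa [hlq]
  exact (flEval_congr t rfl hlq.symm i _ hq').trans (flEval_eq_of_pt₂_eq t i _ _ (Gr.ext rfl))

theorem exists_flMatrix_of_fields : ∃ P : Matrix (Fin n) (Fin r) ℂ,
    ∀ (F : Type) [Field F] [Algebra ℂ F] (x : (Fl b c n).obj (CommAlgCat.of ℂ F)) i q hq,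
      flEval t x i q hq = q ⬝ᵥ cvec (CommAlgCat.of ℂ F) (P.col i) := by
  by_cases hbc : c < b
  · refine ⟨0, fun F _ _ x => ?_⟩
    have := Fl.le_of_field x
    omega
  by_cases hcn : n ≤ c
  · refine ⟨0, fun F _ _ x i q hq => ?_⟩
    have h1 : (Gr.toSubmodule (Fl.pt₂ x) : Submodule F (Fin n → F)) = ⊤ := by
      have h2 := Gr.finrank_eq (Fl.pt₂ x)
      have h3 := Gr.le_of_nontrivial (Fl.pt₂ x)
      exact Submodule.eq_top_of_finrank_eq (by rw [h2]; simp; omega)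
    have h2 : q = 0 := by
      ext i
      have := hq (Pi.single i 1) (h1 ▸ Submodule.mem_top)
      simpa using this
    subst h2
    rw [flEval_zero_right, zero_dotProduct]
  have hx : ∀ j : Fin n, ∃ x : (Fl b c n).obj (CommAlgCat.of ℂ ℂ),
      Annihilates (Pi.single j 1) (Gr.toSubmodule (Fl.pt₂ x)) := fun j => by
    let l : Module.Dual ℂ (Fin n → ℂ) := LinearMap.proj j
    have h1 := LinearMap.finrank_range_add_finrank_ker l
    have h2 := (LinearMap.range l).finrank_le
    rw [Module.finrank_self, Module.finrank_fin_fun] at *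
    obtain ⟨C, -, h3, h4⟩ := exists_between_finrank (W := ⊥) (D := LinearMap.ker l) bot_le (b := c)
      (by simp) (by omega)
    obtain ⟨B, -, h5, h6⟩ := exists_between_finrank (W := ⊥) (D := C) bot_le (b := b)
      (by simp) (by omega)
    refine ⟨Fl.mk (Gr.ofFinrank B h6) (Gr.ofFinrank C h4) h5, fun w hw => ?_⟩
    have : l w = 0 := h3 hw
    simpa [l] using this
  choose x₀ hx₀ using hx
  refine ⟨fun j i => flEval t (x₀ j) i (Pi.single j 1) (hx₀ j), fun F _ _ x i q hq => ?_⟩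
  let f : CommAlgCat.of ℂ ℂ ⟶ CommAlgCat.of ℂ F := CommAlgCat.ofHom (Algebra.ofId ℂ F)
  obtain ⟨w, hw⟩ := fl_vector_of_field (F := F) t (by omega) i
  rw [hw]
  refine congrArg (q ⬝ᵥ ·) (funext fun j => ?_)
  have hqA : Annihilates (Pi.single j 1) (Gr.toSubmodule (Fl.pt₂ ((Fl b c n).map f (x₀ j)))) := by
    have := (hx₀ j).mapFl f
    rwa [vmap_single] at this
  have h1 := hw ((Fl b c n).map f (x₀ j)) (Pi.single j 1) hqA
  rw [single_dotProduct, one_mul] at h1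
  rw [← h1, ← flEval_congr t rfl (vmap_single f j) i ((hx₀ j).mapFl f) hqA,
    flEval_map t f (x₀ j) i _ (hx₀ j)]
  rfl

/-- The reduction is that of `box_eq_zero_of_fields`, but the lift to a domain must preserve the
inclusion of the two subspaces. -/
theorem fl_eq_zero_of_fields (h : ∀ (F : Type) [Field F] [Algebra ℂ F]
    (x : (Fl b c n).obj (CommAlgCat.of ℂ F)) i q hq, flEval t x i q hq = 0) : t = 0 := by
  have h1 : ∀ (R : CommAlgCat.{0} ℂ) [IsDomain R] (x : (Fl b c n).obj R) i,
      flVal t x i = 0 := fun R _ x i => flVal_eq_zero fun q hq => by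
    apply toFrac_injective R
    rw [← flEval_map, h, map_zero]
  have h2 : ∀ (R : CommAlgCat.{0} ℂ) [IsLocalRing R] (x : (Fl b c n).obj R) i,
      flVal t x i = 0 := fun R _ x i => by
    have := free_of_isLocalRing (Fl.pt₁ x)
    have := free_of_isLocalRing (Fl.pt₂ x)
    obtain ⟨N, L', hL', hN⟩ := exists_framePt (Fl.pt₁ x)
    obtain ⟨M, L, hL, hM⟩ := exists_framePt (Fl.pt₂ x)
    have hle := Fl.le x
    -- The columns of `N` lie in the column space of `M`, on which `M L` is the identity. Thus `N =
    -- M K` with `K = L N`, which has left inverse `L' M`. Lifting `M` and `K` instead of `M` and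
    -- `N` keeps the lifted pair a flag.
    have hMLN : M * (L * N) = N := by
      refine Matrix.ext_of_mulVec_single fun j => ?_
      obtain ⟨u, hu⟩ : N.mulVec (Pi.single j 1) ∈ Gr.toSubmodule (framePt M L hL) := by
        rw [← hM]
        refine hle ?_
        rw [hN]
        exact ⟨_, rfl⟩
      have hu : M.mulVec u = N.mulVec (Pi.single j 1) := hu
      rw [← Matrix.mulVec_mulVec, ← Matrix.mulVec_mulVec, ← hu, Matrix.mulVec_mulVec u L, hL,
        Matrix.one_mulVec]
    have hK : (L' * M) * (L * N) = 1 := by rw [Matrix.mul_assoc, hMLN, hL']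
    obtain ⟨D, _, f, M₀, L₀, h₀, K₀, L₀', h₀', hM₀, hK₀⟩ :=
      exists_universal_frames M L hL (L * N) (L' * M) hK
    have h3 : (L₀' * L₀) * (M₀ * K₀) = 1 := by
      rw [Matrix.mul_assoc, ← Matrix.mul_assoc L₀, h₀, Matrix.one_mul, h₀']
    let y : (Fl b c n).obj D := Fl.mk (framePt (M₀ * K₀) _ h3) (framePt M₀ L₀ h₀) (by
      rintro _ ⟨u, rfl⟩
      exact ⟨K₀.mulVec u, by simp [Matrix.mulVec_mulVec]⟩)
    have hy : (Fl b c n).map f y = x := by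
      refine Fl.ext ?_ ?_
      · rw [hN]
        refine framePt_map_eq f h3 hL' ?_
        have : (M₀ * K₀).map f.hom = M₀.map f.hom * K₀.map f.hom := Matrix.map_mul
        rw [this, hM₀, hK₀, hMLN]
      · rw [hM]
        exact framePt_map_eq f h₀ hL hM₀
    rw [← hy]
    refine (flVal_map t f y i).trans ?_
    rw [h1, map_zero]
  refine fl_ext fun R x i q hq => ?_
  refine (eq_zero_of_localizationAt fun p _ => ?_).trans ?_
  · have := h2 (CommAlgCat.of ℂ (Localization.AtPrime p)) ((Fl b c n).map (localizationAt R p) x) i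
    rw [← flEval_map, flEval, this, map_zero]
  · exact (map_zero (annForm _ q hq)).symm

theorem flSec_surjective : Function.Surjective (flSec b c n r) := fun t => by
  obtain ⟨P, hP⟩ := exists_flMatrix_of_fields t
  refine ⟨P, ?_⟩
  rw [eq_comm, ← sub_eq_zero]
  refine fl_eq_zero_of_fields _ fun F _ _ x i q hq => ?_
  have h1 := flEval_add (t - flSec b c n r P) (flSec b c n r P) x i q hq
  rw [sub_add_cancel, flEval_sec, hP] at h1
  simpa using h1

end FlSections

/-! ### General matrices -/

section General

theorem ForGeneral.mono {H : Type*} [AddCommGroup H] [Module ℂ H] {P P' : H → Prop}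
    (h : ForGeneral P) (h' : ∀ s, P s → P' s) : ForGeneral P' := by
  obtain ⟨r, l, p, h₁, h₂⟩ := h
  exact ⟨r, l, p, h₁, fun s hs => h' s (h₂ s hs)⟩

/-- A linear section `σ` of `T` carries polynomials on `W` to polynomials on `H`, but the given one
might vanish on `σ(H)`. Translating by `w₀ - σ (T w₀)`, an element of the kernel of `T`, gives an
affine section through a point `w₀` where it does not vanish. -/
theorem ForGeneral.of_surjective {W H : Type*} [AddCommGroup W] [Module ℂ W] [AddCommGroup H]
    [Module ℂ H] {P : H → Prop} (T : W →ₗ[ℂ] H) (hT : Function.Surjective T)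
    (h : ForGeneral fun w => P (T w)) : ForGeneral P := by
  obtain ⟨r, l, p, ⟨w₀, h₁⟩, h₂⟩ := h
  obtain ⟨σ, hσ⟩ := T.exists_rightInverse_of_surjective (LinearMap.range_eq_top.2 hT)
  have hTσ : ∀ s, T (σ s) = s := LinearMap.congr_fun hσ
  let p' : MvPolynomial (Fin r) ℂ :=
    MvPolynomial.bind₁ (fun i => MvPolynomial.X i + MvPolynomial.C (l i (w₀ - σ (T w₀)))) p
  have key : ∀ s, MvPolynomial.eval (fun i => (l i).comp σ s) p' =
      MvPolynomial.eval (fun i => l i (σ s + (w₀ - σ (T w₀)))) p := fun s => by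
    rw [MvPolynomial.eval, MvPolynomial.eval₂Hom_bind₁]
    refine congrArg (fun g => MvPolynomial.eval₂Hom (RingHom.id ℂ) g p) (funext fun i => ?_)
    simp
  refine ⟨r, fun i => (l i).comp σ, p', ⟨T w₀, ?_⟩, fun s hs => ?_⟩
  · rw [key]
    simpa using h₁
  · rw [key] at hs
    have : P (T _) := h₂ _ hs
    rwa [map_add, map_sub, hTσ, hTσ, sub_self, add_zero] at this

/-- The minor is a polynomial in the entries, and it equals 1 at the matrix with ones at the
positions `(u i, v i)` and zeros elsewhere. -/
theorem forGeneral_det_submatrix {k m n : ℕ} {u : Fin k → Fin m} {v : Fin k → Fin n}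
    (hu : Function.Injective u) (hv : Function.Injective v) :
    ForGeneral fun P : Matrix (Fin m) (Fin n) ℂ => (P.submatrix u v).det ≠ 0 := by
  classical
  let p : MvPolynomial (Fin (m * n)) ℂ :=
    Matrix.det (Matrix.of fun i j : Fin k => MvPolynomial.X (finProdFinEquiv (u i, v j)))
  let l : Fin (m * n) → Module.Dual ℂ (Matrix (Fin m) (Fin n) ℂ) := fun x =>
    Matrix.entryLinearMap ℂ ℂ (finProdFinEquiv.symm x).1 (finProdFinEquiv.symm x).2
  have key : ∀ P, MvPolynomial.eval (fun i => l i P) p = (P.submatrix u v).det := fun P => by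
    rw [RingHom.map_det]
    refine congrArg Matrix.det (Matrix.ext fun i j => ?_)
    have h : l (finProdFinEquiv (u i, v j)) P = P (u i) (v j) := by
      simp only [l, Equiv.symm_apply_apply]
      rfl
    simpa using h
  refine ⟨m * n, l, p, ⟨Matrix.of fun x y => if ∃ i, u i = x ∧ v i = y then 1 else 0, ?_⟩,
    fun P hP => by rwa [key] at hP⟩
  rw [key]
  have : (Matrix.of fun x y => if ∃ i, u i = x ∧ v i = y then (1 : ℂ) else 0).submatrix u v =
      1 := by
    ext i j
    rw [Matrix.submatrix_apply, Matrix.of_apply, Matrix.one_apply]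
    refine if_congr ⟨?_, ?_⟩ rfl rfl
    · rintro ⟨x, h₁, h₂⟩
      rw [← hu h₁, ← hv h₂]
    · rintro rfl
      exact ⟨i, rfl, rfl⟩
  rw [this, Matrix.det_one]
  exact one_ne_zero

/-- Matrices exhibiting `ℂⁿ` as the direct sum of `ℂᵐ` and `ℂᵏ`. -/
structure Splitting (m k n : ℕ) where
  P : Matrix (Fin m) (Fin n) ℂ
  σ : Matrix (Fin n) (Fin m) ℂ
  τ : Matrix (Fin n) (Fin k) ℂ
  ρ : Matrix (Fin k) (Fin n) ℂ
  P_mul_σ : P * σ = 1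
  P_mul_τ : P * τ = 0
  ρ_mul_σ : ρ * σ = 0
  ρ_mul_τ : ρ * τ = 1
  add_eq_one : σ * P + τ * ρ = 1

/-- Exchanging the two direct summands. -/
def Splitting.swap {m k n : ℕ} (s : Splitting m k n) : Splitting k m n where
  P := s.ρ
  σ := s.τ
  τ := s.σ
  ρ := s.P
  P_mul_σ := s.ρ_mul_τ
  P_mul_τ := s.ρ_mul_σ
  ρ_mul_σ := s.P_mul_τ
  ρ_mul_τ := s.P_mul_σ
  add_eq_one := by rw [add_comm, s.add_eq_one]

/-- `τ` is a basis of the kernel of `P`, and `ρ` gives the coordinates of `v - σ P v`, which lies in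
that kernel. -/
theorem exists_splitting {m k n : ℕ} (hk : m + k = n) {P : Matrix (Fin m) (Fin n) ℂ}
    {σ : Matrix (Fin n) (Fin m) ℂ} (h : P * σ = 1) :
    ∃ s : Splitting m k n, s.P = P ∧ s.σ = σ := by
  let p := P.toLin'
  let t := σ.toLin'
  have hpt : ∀ v, p (t v) = v := fun v => by
    have : (P * σ).mulVec v = v := by rw [h, Matrix.one_mulVec]
    simpa [p, t, ← Matrix.mulVec_mulVec] using this
  have hp : Function.Surjective p := fun v => ⟨t v, hpt v⟩
  have hker : Module.finrank ℂ (LinearMap.ker p) = k := by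
    have := LinearMap.finrank_range_add_finrank_ker p
    rw [LinearMap.range_eq_top.2 hp, finrank_top, Module.finrank_fin_fun,
      Module.finrank_fin_fun] at this
    omega
  let e : LinearMap.ker p ≃ₗ[ℂ] (Fin k → ℂ) := (Module.finBasisOfFinrankEq ℂ _ hker).equivFun
  let i : (Fin k → ℂ) →ₗ[ℂ] (Fin n → ℂ) := (LinearMap.ker p).subtype.comp e.symm.toLinearMap
  let c : (Fin n → ℂ) →ₗ[ℂ] LinearMap.ker p :=
    (LinearMap.id - t.comp p).codRestrict _ fun v => by simp [hpt]
  let r : (Fin n → ℂ) →ₗ[ℂ] (Fin k → ℂ) := e.toLinearMap.comp c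
  have hpi : ∀ v, p (i v) = 0 := fun v => (e.symm v).2
  have hc : ∀ v, (c v : Fin n → ℂ) = v - t (p v) := fun v => rfl
  have hir : ∀ v, i (r v) = v - t (p v) := fun v => by simp [i, r, hc]
  have hi : Function.Injective i := Subtype.val_injective.comp e.symm.injective
  have hP : P = LinearMap.toMatrix' p := (LinearMap.toMatrix'_toLin' P).symm
  have hσ : σ = LinearMap.toMatrix' t := (LinearMap.toMatrix'_toLin' σ).symm
  refine ⟨⟨P, σ, LinearMap.toMatrix' i, LinearMap.toMatrix' r, h, ?_, ?_, ?_, ?_⟩, rfl, rfl⟩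
  · rw [hP, ← LinearMap.toMatrix'_comp, show p.comp i = 0 from LinearMap.ext hpi, map_zero]
  · rw [hσ, ← LinearMap.toMatrix'_comp, show r.comp t = 0 from LinearMap.ext fun v => hi ?_,
      map_zero]
    simp [hir, hpt]
  · rw [← LinearMap.toMatrix'_comp, show r.comp i = LinearMap.id from
      LinearMap.ext fun v => hi ?_, LinearMap.toMatrix'_id]
    simp [hir, hpi]
  · rw [hP, hσ, ← LinearMap.toMatrix'_comp, ← LinearMap.toMatrix'_comp, ← map_add,
      show t.comp p + i.comp r = LinearMap.id from LinearMap.ext fun v => ?_,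
      LinearMap.toMatrix'_id]
    simp [hir]

/-- Where the leading maximal minor is invertible, `P` has a right inverse supported on the first
`m` coordinates. -/
theorem forGeneral_splitting_P {m k n : ℕ} (hk : m + k = n) :
    ForGeneral fun P : Matrix (Fin m) (Fin n) ℂ => ∃ s : Splitting m k n, s.P = P := by
  have hmn : m ≤ n := by omega
  refine (forGeneral_det_submatrix (u := id) (v := Fin.castLE hmn) Function.injective_id
    (Fin.castLE_injective hmn)).mono fun P hP => ?_
  have h : P * ((1 : Matrix (Fin n) (Fin n) ℂ).submatrix id (Fin.castLE hmn) *
      (P.submatrix id (Fin.castLE hmn))⁻¹) = 1 := by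
    rw [← Matrix.mul_assoc, show P * (1 : Matrix (Fin n) (Fin n) ℂ).submatrix id (Fin.castLE hmn) =
      P.submatrix id (Fin.castLE hmn) from ?_, Matrix.mul_nonsing_inv _ (Ne.isUnit hP)]
    ext i j
    simp [Matrix.mul_apply, Matrix.one_apply]
  obtain ⟨s, hs, -⟩ := exists_splitting hk h
  exact ⟨s, hs⟩

theorem forGeneral_splitting_τ {m k n : ℕ} (hk : m + k = n) :
    ForGeneral fun τ : Matrix (Fin n) (Fin k) ℂ => ∃ s : Splitting m k n, s.τ = τ := by
  have hkn : k ≤ n := by omega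
  refine (forGeneral_det_submatrix (u := Fin.castLE hkn) (v := id)
    (Fin.castLE_injective hkn) Function.injective_id).mono fun τ hτ => ?_
  have h : ((τ.submatrix (Fin.castLE hkn) id)⁻¹ *
      (1 : Matrix (Fin n) (Fin n) ℂ).submatrix (Fin.castLE hkn) id) * τ = 1 := by
    rw [Matrix.mul_assoc, show (1 : Matrix (Fin n) (Fin n) ℂ).submatrix (Fin.castLE hkn) id * τ =
      τ.submatrix (Fin.castLE hkn) id from ?_, Matrix.nonsing_inv_mul _ (Ne.isUnit hτ)]
    ext i j
    simp [Matrix.mul_apply, Matrix.one_apply]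
  obtain ⟨s, -, hs⟩ := exists_splitting (k := m) (by omega) h
  exact ⟨s.swap, hs⟩

namespace Splitting

variable {m k n : ℕ} (s : Splitting m k n) (R : CommAlgCat.{0} ℂ)

theorem act_P_σ (v) : act R s.P (act R s.σ v) = v := act_of_mul_eq_one s.P_mul_σ v

theorem act_ρ_τ (v) : act R s.ρ (act R s.τ v) = v := act_of_mul_eq_one s.ρ_mul_τ v

theorem act_P_τ (v) : act R s.P (act R s.τ v) = 0 := by
  rw [← act_mul, s.P_mul_τ, act_zero]

theorem act_ρ_σ (v) : act R s.ρ (act R s.σ v) = 0 := by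
  rw [← act_mul, s.ρ_mul_σ, act_zero]

theorem act_add_eq (v) : act R s.σ (act R s.P v) + act R s.τ (act R s.ρ v) = v := by
  rw [← act_mul, ← act_mul, ← act_add, s.add_eq_one, act_one]

theorem act_P_surjective : Function.Surjective (act R s.P) := act_surjective s.P_mul_σ

theorem act_P_eq_zero {v} (h : act R s.P v = 0) : act R s.τ (act R s.ρ v) = v := by
  have := s.act_add_eq R v
  rwa [h, map_zero, zero_add] at this

end Splitting

end General

/-! ### Morphisms of spaces -/

/-- The morphism of spaces given by a natural family of maps. -/
def Space.homMk {X Y : Space} (φ : ∀ R, X.obj R → Y.obj R)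
    (h : ∀ {R S : CommAlgCat.{0} ℂ} (f : R ⟶ S) (x : X.obj R),
      φ S (X.map f x) = Y.map f (φ R x)) : X ⟶ Y where
  app R := ↾(φ R)
  naturality R S f := by
    ext x
    exact h f x

theorem Space.isIso_of_bijective {X Y : Space} (η : X ⟶ Y)
    (h : ∀ R, Function.Bijective (η.app R)) : IsIso η := by
  have : ∀ R, IsIso (η.app R) := fun R => (isIso_iff_bijective _).2 (h R)
  exact NatIso.isIso_of_isIso_app η

/-! ### The zero locus as a Grassmann bundle -/

section Bundle

theorem IsSummand.rank_le {R M : Type} [CommRing R] [AddCommGroup M] [Module R M] [Nontrivial R]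
    [Module.Finite R M] [Module.Projective R M] {k k' : ℕ} {L L' : Submodule R M}
    (h : IsSummand k L) (h' : IsSummand k' L') (hl : L ≤ L') : k ≤ k' := by
  have := h.1
  have := h'.1
  have := finite_sub L'
  have := projective_sub L'
  have := projective_sub_quot hl
  obtain ⟨p⟩ : Nonempty (PrimeSpectrum R) := inferInstance
  have h1 := rank_add_rank_quot (L.comap L'.subtype) p
  rw [Module.rankAtStalk_eq_of_equiv (Submodule.comapSubtypeEquivOfLe hl), h.2, h'.2] at h1
  omega

theorem IsSummand.comap {R M N : Type} [CommRing R] [AddCommGroup M] [Module R M]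
    [AddCommGroup N] [Module R N] [Module.Projective R M] {k : ℕ} {L : Submodule R N}
    (hL : IsSummand k L) (i : M →ₗ[R] N) (r : N →ₗ[R] M) (h : ∀ v, r (i v) = v)
    (hi : L ≤ LinearMap.range i) : IsSummand k (L.comap i) := by
  have := hL.1
  obtain ⟨π, hπ⟩ := exists_projection L
  have hir : ∀ w ∈ L, i (r w) = w := fun w hw => by
    obtain ⟨v, rfl⟩ := hi hw
    rw [h]
  refine ⟨projective_quot_of_retraction _ (r ∘ₗ L.subtype ∘ₗ π ∘ₗ i) (fun v => ?_) fun v hv => ?_,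
    rank_eq_of_injective i (Function.LeftInverse.injective h) (Submodule.map_comap_eq_of_le hi) hL.2⟩
  · simp [hir _ (π (i v)).2]
  · have := hπ ⟨i v, hv⟩
    simp only [LinearMap.comp_apply] at this ⊢
    rw [this]
    exact h v

variable {a b m n k : ℕ} (s : Splitting m k n) {R S : CommAlgCat.{0} ℂ}

/-- The embedding of `A ⊕ Rᵏ` in `Rⁿ`. -/
def Splitting.emb (A : (Gr a m).obj R) : (Gr.toSubmodule A × (Fin k → R)) →ₗ[R] (Fin n → R) :=
  ((act R s.σ).comp (Gr.toSubmodule A).subtype).coprod (act R s.τ)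

theorem Splitting.emb_apply (A : (Gr a m).obj R) (v) :
    s.emb A v = act R s.σ v.1 + act R s.τ v.2 := rfl

theorem Splitting.act_P_emb (A : (Gr a m).obj R) (v) : act R s.P (s.emb A v) = v.1 := by
  rw [emb_apply, map_add, act_P_σ, act_P_τ, add_zero]

theorem Splitting.act_ρ_emb (A : (Gr a m).obj R) (v) : act R s.ρ (s.emb A v) = v.2 := by
  rw [emb_apply, map_add, act_ρ_σ, act_ρ_τ, zero_add]

theorem Splitting.exists_retraction (A : (Gr a m).obj R) :
    ∃ r : (Fin n → R) →ₗ[R] (Gr.toSubmodule A × (Fin k → R)), ∀ v, r (s.emb A v) = v := by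
  obtain ⟨π, hπ⟩ := exists_projection (Gr.toSubmodule A)
  refine ⟨(π.comp (act R s.P)).prod (act R s.ρ), fun v => Prod.ext ?_ (s.act_ρ_emb A v)⟩
  exact (congrArg π (s.act_P_emb A v)).trans (hπ v.1)

theorem Splitting.emb_injective (A : (Gr a m).obj R) : Function.Injective (s.emb A) := by
  obtain ⟨r, hr⟩ := s.exists_retraction A
  exact Function.LeftInverse.injective hr

/-- Since `v = σ P v + τ ρ v`, a vector with `P v ∈ A` comes from the pair `(P v, ρ v)`. The zero
locus condition thus becomes `B ⊆ A ⊕ R^k`. -/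
theorem Splitting.range_emb (A : (Gr a m).obj R) :
    LinearMap.range (s.emb A) = (Gr.toSubmodule A).comap (act R s.P) := by
  refine le_antisymm ?_ fun v hv => ⟨(⟨act R s.P v, hv⟩, act R s.ρ v), s.act_add_eq R v⟩
  rintro _ ⟨v, rfl⟩
  rw [Submodule.mem_comap, act_P_emb]
  exact v.1.2

/-- The bundle `U ⊕ Oᵏ`. -/
abbrev sumBundle (a m k : ℕ) : VectorBundle (Gr a m) :=
  (U a m).directSum (VectorBundle.trivial (Gr a m) k)

/-- The submodule underlying a point of the Grassmann bundle of `U ⊕ Oᵏ`. -/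
def bundleSub (p : (GrassBundle b (sumBundle a m k)).obj R) :
    Submodule R (Gr.toSubmodule (GrassPoint.base p) × (Fin k → R)) :=
  GrassPoint.sub p

theorem bundleSub_isSummand (p : (GrassBundle b (sumBundle a m k)).obj R) :
    IsSummand b (bundleSub p) := ⟨GrassPoint.projective_quot p, GrassPoint.rank_eq p⟩

/-- The point of the Grassmannian given by a point of the Grassmann bundle. -/
def Splitting.bundlePt (p : (GrassBundle b (sumBundle a m k)).obj R) : (Gr b n).obj R :=
  Gr.mk ((bundleSub p).map (s.emb (GrassPoint.base p))) (by
    obtain ⟨r, hr⟩ := s.exists_retraction (GrassPoint.base p)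
    exact (bundleSub_isSummand p).map _ r hr)

theorem Splitting.bundlePt_mem (p : (GrassBundle b (sumBundle a m k)).obj R) :
    ((GrassPoint.base p, s.bundlePt p) : (prod (Gr a m) (Gr b n)).obj R) ∈
      (VectorBundle.zeroLocus (boxSec a m b n s.P)).obj R := by
  rw [mem_zeroLocus_boxSec]
  rintro _ ⟨v, -, rfl⟩
  rw [act_P_emb]
  exact v.1.2

/-- The morphism from the Grassmann bundle to the zero locus. -/
def Splitting.bundleHom (b : ℕ) :
    GrassBundle b (sumBundle a m k) ⟶ (VectorBundle.zeroLocus (boxSec a m b n s.P)).toFunctor :=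
  Space.homMk (fun R p => ⟨(GrassPoint.base p, s.bundlePt p), s.bundlePt_mem p⟩) (by
    intro R S f p
    refine Subtype.ext (Prod.ext rfl ?_)
    refine (Gr.map_eq_of_forall_mem f (s.bundlePt p) _ ?_).symm
    rintro _ ⟨v, hv, rfl⟩
    refine ⟨_, mem_pushSub _ hv, ?_⟩
    rw [emb_apply, emb_apply, map_add, vmap_act, vmap_act]
    rfl)

/-- Over a fixed `A`, image and preimage under the split injection `emb` match the summands of `A ⊕
R^k` with the summands `B` contained in its range. -/
theorem Splitting.bundleHom_bijective (b : ℕ) (R : CommAlgCat.{0} ℂ) :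
    Function.Bijective ((s.bundleHom (a := a) b).app R) := by
  constructor
  · rintro ⟨A, L, _, _⟩ ⟨A', L', _, _⟩ h
    have h := congrArg Subtype.val h
    obtain rfl : A = A' := congrArg Prod.fst h
    have h2 := congrArg Gr.toSubmodule (congrArg Prod.snd h)
    obtain rfl : L = L' := Submodule.map_injective_of_injective (s.emb_injective A) h2
    rfl
  · rintro ⟨⟨A, B⟩, h⟩
    have h := mem_zeroLocus_boxSec.1 h
    obtain ⟨r, hr⟩ := s.exists_retraction A
    have hle : Gr.toSubmodule B ≤ LinearMap.range (s.emb A) := by rwa [range_emb]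
    have hL := (Gr.isSummand B).comap _ r hr hle
    refine ⟨(⟨A, (Gr.toSubmodule B).comap (s.emb A), hL.1, hL.2⟩ : GrassPoint b _ R), ?_⟩
    exact Subtype.ext (Prod.ext rfl (Gr.ext (Submodule.map_comap_eq_of_le hle)))

instance (b : ℕ) : IsIso (s.bundleHom (a := a) b) :=
  Space.isIso_of_bijective _ (s.bundleHom_bijective b)

/-- The zero locus is a Grassmann bundle. -/
def Splitting.bundleIso (b : ℕ) : (VectorBundle.zeroLocus (boxSec a m b n s.P)).toFunctor ≅
    GrassBundle b (sumBundle a m k) :=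
  (asIso (s.bundleHom b)).symm

theorem Splitting.bundleIso_hom_proj (b : ℕ) :
    (s.bundleIso b).hom ≫ GrassBundle.proj b (sumBundle a m k) = fstOn _ := by
  refine (IsIso.inv_comp_eq (s.bundleHom (a := a) b)).2 ?_
  rfl

/-! ### The zero locus on the flag manifold -/

/-- Over any algebra the columns of `τ` span the kernel of `P`, because `v = τ ρ v` there. -/
theorem Splitting.ker_act_P_le {L : Submodule R (Fin n → R)}
    (h : ∀ i, cvec R (s.τ.col i) ∈ L) : LinearMap.ker (act R s.P) ≤ L := fun v hv => by
  rw [← s.act_P_eq_zero R hv]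
  have : act R s.τ (act R s.ρ v) = ∑ i, act R s.ρ v i • cvec R (s.τ.col i) := by
    ext j
    simp [act_apply R s.τ, cvec, Finset.sum_apply, mul_comm]
  rw [this]
  exact sum_mem fun i _ => Submodule.smul_mem _ _ (h i)

theorem Splitting.cvec_mem_ker (i) : cvec R (s.τ.col i) ∈ LinearMap.ker (act R s.P) := by
  rw [LinearMap.mem_ker, act_cvec]
  have : s.P.mulVec (s.τ.col i) = 0 := by
    have := congrArg (fun M => M.col i) s.P_mul_τ
    ext j
    exact congrFun this j
  rw [this]
  ext
  simp [cvec]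

/-- The preimage in `Rⁿ` of a point of `Gr(a, m)`. -/
def Splitting.comapPt {c : ℕ} (hc : c + m = a + n) (A : (Gr a m).obj R) : (Gr c n).obj R :=
  Gr.mk ((Gr.toSubmodule A).comap (act R s.P))
    ((isSummand_comap _ (s.act_P_surjective R) hc).2 (Gr.isSummand A))

theorem Splitting.mem_comapPt {c : ℕ} (hc : c + m = a + n) (A : (Gr a m).obj R) {v} :
    v ∈ Gr.toSubmodule (s.comapPt hc A) ↔ act R s.P v ∈ Gr.toSubmodule A := Iff.rfl

theorem Splitting.comapPt_map {c : ℕ} (hc : c + m = a + n) (f : R ⟶ S) (A : (Gr a m).obj R) :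
    (Gr c n).map f (s.comapPt hc A) = s.comapPt hc ((Gr a m).map f A) :=
  Gr.map_eq_of_forall_mem _ _ _ fun v hv => by
    rw [mem_comapPt, ← vmap_act]
    exact Gr.map_mem f A hv

theorem Splitting.comapPt_injective {c : ℕ} (hc : c + m = a + n) :
    Function.Injective (s.comapPt (R := R) hc) := fun _ _ h =>
  Gr.ext (Submodule.comap_injective_of_surjective (s.act_P_surjective R)
    (congrArg Gr.toSubmodule h))

theorem Splitting.exists_comapPt_eq {c : ℕ} (hc : c + m = a + n) (C : (Gr c n).obj R)
    (h : LinearMap.ker (act R s.P) ≤ Gr.toSubmodule C) : ∃ A, s.comapPt hc A = C :=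
  ⟨Gr.mk _ ((Gr.isSummand C).map_of_ker_le _ (s.act_P_surjective R) hc h), Gr.ext (by
    show ((Gr.toSubmodule C).map _).comap _ = _
    rw [Submodule.comap_map_eq, sup_eq_left.2 h])⟩

/-- The morphism from the zero locus on the product to the zero locus on the flag manifold. -/
def Splitting.flagHom (b : ℕ) {c : ℕ} (hc : c + m = a + n) :
    (VectorBundle.zeroLocus (boxSec a m b n s.P)).toFunctor ⟶
      (VectorBundle.zeroLocus (flSec b c n k s.τ)).toFunctor :=
  Space.homMk (fun R x => ⟨Fl.mk x.1.2 (s.comapPt hc x.1.1) (mem_zeroLocus_boxSec.1 x.2),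
      mem_zeroLocus_flSec.2 fun i => by
        show act R s.P (cvec R (s.τ.col i)) ∈ Gr.toSubmodule x.1.1
        rw [s.cvec_mem_ker i]
        exact zero_mem _⟩)
    fun f x => Subtype.ext (Fl.ext rfl (s.comapPt_map hc f x.1.1).symm)

/-- Vanishing of the section given by `τ` says that the large subspace contains `ker P`, and such
subspaces are the preimages of unique points `A`. The inclusion in the flag is then the zero locus
condition. -/
theorem Splitting.flagHom_bijective (b : ℕ) {c : ℕ} (hc : c + m = a + n) (R : CommAlgCat.{0} ℂ) :
    Function.Bijective ((s.flagHom b hc).app R) := by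
  constructor
  · rintro ⟨⟨A, B⟩, h⟩ ⟨⟨A', B'⟩, h'⟩ e
    have e := congrArg Subtype.val e
    obtain rfl : B = B' := congrArg Fl.pt₁ e
    obtain rfl : A = A' := s.comapPt_injective hc (congrArg Fl.pt₂ e)
    rfl
  · rintro ⟨x, hx⟩
    have hx' := s.ker_act_P_le (mem_zeroLocus_flSec.1 hx)
    obtain ⟨A, hA⟩ := s.exists_comapPt_eq hc (Fl.pt₂ x) hx'
    have hle := Fl.le x
    rw [← hA] at hle
    exact ⟨⟨(A, Fl.pt₁ x), mem_zeroLocus_boxSec.2 hle⟩, Subtype.ext (Fl.ext rfl hA)⟩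

/-- The zero locus is isomorphic to a zero locus on a flag manifold. -/
theorem Splitting.nonempty_flagIso (s' : Splitting m k n) (b : ℕ) {c : ℕ} (hc : c + m = a + n) :
    Nonempty ((VectorBundle.zeroLocus (boxSec a m b n s.P)).toFunctor ≅
      (VectorBundle.zeroLocus (flSec b c n k s'.τ)).toFunctor) := by
  have := Space.isIso_of_bijective _ (s'.flagHom_bijective b hc)
  -- `P` and `τ` come from unrelated splittings `s` and `s'`. The Grassmann bundle depends on
  -- neither, so it links the zero loci of the two.
  exact ⟨s.bundleIso b ≪≫ (s'.bundleIso b).symm ≪≫ asIso (s'.flagHom b hc)⟩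

/-- `B` would be a summand of rank `b` inside `P⁻¹(A)`, which has the smaller rank `a + k`. -/
theorem Splitting.isEmpty_zeroLocus {b : ℕ} (h : a + n < b + m) (hk : m + k = n) :
    IsEmptySpace (VectorBundle.zeroLocus (boxSec a m b n s.P)).toFunctor := fun R _ => ⟨fun x => by
  have hc : (a + k) + m = a + n := by omega
  have h1 : Gr.toSubmodule x.1.2 ≤ Gr.toSubmodule (s.comapPt hc x.1.1) :=
    mem_zeroLocus_boxSec.1 x.2
  have := (Gr.isSummand x.1.2).rank_le (Gr.isSummand (s.comapPt hc x.1.1)) h1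
  omega⟩

end Bundle

/-! ### Subspaces containing a fixed subspace, and fibres -/

section Containing

/-- A basis of `K` is an injection with a left inverse. A splitting that has it as `σ` turns, after
exchanging the summands, into one that has it as `τ`. -/
theorem exists_splitting_ker {m k n : ℕ} (hk : m + k = n) {K : Submodule ℂ (Fin n → ℂ)}
    (hK : Module.finrank ℂ K = k) : ∃ s : Splitting m k n, LinearMap.ker s.P.mulVecLin = K := by
  let e : K ≃ₗ[ℂ] (Fin k → ℂ) := (Module.finBasisOfFinrankEq ℂ _ hK).equivFun
  let i : (Fin k → ℂ) →ₗ[ℂ] (Fin n → ℂ) := K.subtype.comp e.symm.toLinearMap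
  have hi : LinearMap.ker i = ⊥ :=
    LinearMap.ker_eq_bot.2 (Subtype.val_injective.comp e.symm.injective)
  obtain ⟨r, hr⟩ := i.exists_leftInverse_of_injective hi
  obtain ⟨s, -, hs⟩ := exists_splitting (P := LinearMap.toMatrix' r)
    (σ := LinearMap.toMatrix' i) (k := m) (n := n) (by omega)
    (by rw [← LinearMap.toMatrix'_comp, hr, LinearMap.toMatrix'_id])
  have hτ : ∀ v, s.swap.τ.mulVec v = i v := fun v => by
    rw [show s.swap.τ = LinearMap.toMatrix' i from hs, LinearMap.toMatrix'_mulVec]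
  refine ⟨s.swap, le_antisymm (fun v hv => ?_) fun v hv => ?_⟩
  · have h := s.swap.act_P_eq_zero (CommAlgCat.of ℂ ℂ) (v := v) hv
    have h' : s.swap.τ.mulVec (s.swap.ρ.mulVec v) = v := h
    rw [← h', hτ]
    exact (e.symm _).2
  · have : v = s.swap.τ.mulVec (e ⟨v, hv⟩) := by
      rw [hτ]
      simp [i]
    rw [this, LinearMap.mem_ker, Matrix.mulVecLin_apply, Matrix.mulVec_mulVec, s.swap.P_mul_τ,
      Matrix.zero_mulVec]

variable {a b c m n k : ℕ} (s : Splitting m k n) {R S : CommAlgCat.{0} ℂ}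

/-- The kernel of the projection. -/
abbrev Splitting.ker : Submodule ℂ (Fin n → ℂ) := LinearMap.ker s.P.mulVecLin

theorem Splitting.finrank_ker (hk : m + k = n) : Module.finrank ℂ s.ker = k := by
  have h : Function.Surjective s.P.mulVecLin := fun v =>
    ⟨s.σ.mulVec v, by simp [Matrix.mulVec_mulVec, s.P_mul_σ]⟩
  have := LinearMap.finrank_range_add_finrank_ker s.P.mulVecLin
  rw [LinearMap.range_eq_top.2 h, finrank_top, Module.finrank_fin_fun,
    Module.finrank_fin_fun] at this
  rw [Splitting.ker]
  omega

theorem Splitting.forall_cvec_mem {L : Submodule R (Fin n → R)} :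
    (∀ v ∈ s.ker, cvec R v ∈ L) ↔ LinearMap.ker (act R s.P) ≤ L := by
  constructor
  · intro h
    refine s.ker_act_P_le fun i => h _ ?_
    have := congrArg (fun M => M.col i) s.P_mul_τ
    rw [LinearMap.mem_ker]
    ext j
    exact congrFun this j
  · intro h v hv
    refine h ?_
    rw [LinearMap.mem_ker, act_cvec, show s.P.mulVec v = 0 from hv]
    ext
    simp [cvec]

theorem Splitting.mem_containing {C : (Gr c n).obj R} :
    C ∈ (Gr.containing c n s.ker).obj R ↔ LinearMap.ker (act R s.P) ≤ Gr.toSubmodule C :=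
  s.forall_cvec_mem

theorem Splitting.ker_le_comapPt (hc : c + m = a + n) (A : (Gr a m).obj R) :
    LinearMap.ker (act R s.P) ≤ Gr.toSubmodule (s.comapPt hc A) := fun v hv => by
  rw [mem_comapPt, show act R s.P v = 0 from hv]
  exact zero_mem _

/-- Subspaces of the quotient are subspaces containing the kernel. -/
def Splitting.containingHom (hc : c + m = a + n) :
    Gr a m ⟶ (Gr.containing c n s.ker).toFunctor :=
  Space.homMk (fun _ A => ⟨s.comapPt hc A, s.mem_containing.2 (s.ker_le_comapPt hc A)⟩)
    fun f A => Subtype.ext (s.comapPt_map hc f A).symm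

theorem Splitting.nonempty_containingIso (hc : c + m = a + n) :
    Nonempty ((Gr.containing c n s.ker).toFunctor ≅ Gr a m) := by
  have : IsIso (s.containingHom hc) := Space.isIso_of_bijective _ fun R => by
    constructor
    · exact fun A A' h => s.comapPt_injective hc (congrArg Subtype.val h)
    · rintro ⟨C, hC⟩
      obtain ⟨A, hA⟩ := s.exists_comapPt_eq hc C (s.mem_containing.1 hC)
      exact ⟨A, Subtype.ext hA⟩
  exact ⟨(asIso (s.containingHom hc)).symm⟩

/-- The base change of a complex point. -/
def Gr.ofComplex (R : CommAlgCat.{0} ℂ) (B : (Gr b n).obj (CommAlgCat.of ℂ ℂ)) : (Gr b n).obj R :=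
  (Gr b n).map (CommAlgCat.ofHom (Algebra.ofId ℂ R)) B

theorem Gr.map_ofComplex (f : R ⟶ S) (B : (Gr b n).obj (CommAlgCat.of ℂ ℂ)) :
    (Gr b n).map f (Gr.ofComplex R B) = Gr.ofComplex S B := by
  have e : CommAlgCat.ofHom (Algebra.ofId ℂ R) ≫ f = CommAlgCat.ofHom (Algebra.ofId ℂ S) :=
    CommAlgCat.hom_ext (AlgHom.ext fun c => f.hom.commutes c)
  rw [Gr.ofComplex, Gr.ofComplex, ← e, Functor.map_comp_apply]

/-- The base change of `B` is spanned by complex vectors, so the condition is that `A` contains the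
fixed complex subspace `P(B)`. -/
theorem mem_zeroLocus_ofComplex {P : Matrix (Fin m) (Fin n) ℂ} {A : (Gr a m).obj R}
    {B : (Gr b n).obj (CommAlgCat.of ℂ ℂ)} :
    ((A, Gr.ofComplex R B) : (prod (Gr a m) (Gr b n)).obj R) ∈
        (VectorBundle.zeroLocus (boxSec a m b n P)).obj R ↔
      ∀ w ∈ (Gr.toSubmodule B : Submodule ℂ (Fin n → ℂ)).map P.mulVecLin,
        cvec R w ∈ Gr.toSubmodule A := by
  rw [mem_zeroLocus_boxSec]
  constructor
  · rintro h _ ⟨v, hv, rfl⟩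
    have := h _ (Gr.map_mem (CommAlgCat.ofHom (Algebra.ofId ℂ R)) B hv)
    rw [show vmap n (CommAlgCat.ofHom (Algebra.ofId ℂ R)) v = cvec R v from rfl, act_cvec] at this
    exact this
  · intro h
    refine (pushSub_le (L' := (Gr.toSubmodule A).comap (act R P))
      (ψ := vmap n (CommAlgCat.ofHom (Algebra.ofId ℂ R)))).2 fun v hv => ?_
    rw [Submodule.mem_comap,
      show vmap n (CommAlgCat.ofHom (Algebra.ofId ℂ R)) v = cvec R v from rfl, act_cvec]
    exact h _ ⟨v, hv, rfl⟩

/-- Writing `P(B)` as the kernel of a complex projection `ℂ^m → ℂ^m'`, the subspaces `A` containing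
it are the preimages of points of `Gr d m'`; `hc` equates codimensions. -/
theorem nonempty_fiberIso (P : Matrix (Fin m) (Fin n) ℂ) (B : (Gr b n).obj (CommAlgCat.of ℂ ℂ))
    {d m' e : ℕ} (hc : a + m' = d + m) (t : Splitting m' e m)
    (ht : t.ker = (Gr.toSubmodule B : Submodule ℂ (Fin n → ℂ)).map P.mulVecLin) :
    Nonempty ((fiber (sndOn (VectorBundle.zeroLocus (boxSec a m b n P))) B).toFunctor ≅
      Gr d m') := by
  have key : ∀ (R : CommAlgCat.{0} ℂ) (A : (Gr a m).obj R),
      ((A, Gr.ofComplex R B) : (prod (Gr a m) (Gr b n)).obj R) ∈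
        (VectorBundle.zeroLocus (boxSec a m b n P)).obj R ↔
      LinearMap.ker (act R t.P) ≤ Gr.toSubmodule A := fun R A => by
    rw [mem_zeroLocus_ofComplex, ← ht, t.forall_cvec_mem]
  let η : Gr d m' ⟶ (fiber (sndOn (VectorBundle.zeroLocus (boxSec a m b n P))) B).toFunctor :=
    Space.homMk (fun R A' => ⟨⟨(t.comapPt hc A', Gr.ofComplex R B),
        (key R _).2 (t.ker_le_comapPt hc A')⟩, rfl⟩)
      fun f A' => Subtype.ext (Subtype.ext (Prod.ext (t.comapPt_map hc f A').symm
        (Gr.map_ofComplex f B).symm))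
  have : IsIso η := Space.isIso_of_bijective _ fun R => by
    constructor
    · exact fun A A' h => t.comapPt_injective hc
        (congrArg Prod.fst (congrArg Subtype.val (congrArg Subtype.val h)))
    · rintro ⟨⟨⟨A, B'⟩, hA⟩, hB⟩
      obtain rfl : B' = Gr.ofComplex R B := hB
      obtain ⟨A', rfl⟩ := t.exists_comapPt_eq hc A ((key R A).1 hA)
      exact ⟨A', rfl⟩
  exact ⟨(asIso η).symm⟩

/-- Rank-nullity for `P` on `B` gives `dim P(B) = a - d`, hence a quotient of dimension `m - a + d`.
-/
theorem Splitting.nonempty_fiberIso (ham : a ≤ m) (B : (Gr a n).obj (CommAlgCat.of ℂ ℂ)) {d : ℕ}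
    (hd : Module.finrank ℂ ((Gr.toSubmodule B : Submodule ℂ (Fin n → ℂ)) ⊓ s.ker :
      Submodule ℂ _) = d) :
    Nonempty ((fiber (sndOn (VectorBundle.zeroLocus (boxSec a m a n s.P))) B).toFunctor ≅
      Gr d (m - a + d)) := by
  let B₀ : Submodule ℂ (Fin n → ℂ) := Gr.toSubmodule B
  have hB : Module.finrank ℂ B₀ = a := Gr.finrank_eq B
  have h1 := LinearMap.finrank_range_add_finrank_ker (s.P.mulVecLin.domRestrict B₀)
  have h2 : Module.finrank ℂ (LinearMap.ker (s.P.mulVecLin.domRestrict B₀)) = d := by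
    have h3 : LinearMap.ker (s.P.mulVecLin.domRestrict B₀) = (B₀ ⊓ s.ker).comap B₀.subtype := by
      ext v
      simp
    rw [h3, (Submodule.comapSubtypeEquivOfLe inf_le_left).finrank_eq]
    exact hd
  rw [LinearMap.range_domRestrict, h2, hB] at h1
  obtain ⟨t, ht⟩ := exists_splitting_ker (m := m - a + d) (k := a - d) (n := m)
    (K := B₀.map s.P.mulVecLin) (by omega) (by omega)
  exact FunctorOfPoints.nonempty_fiberIso s.P B (by omega) t ht

end Containing

/-! ### Open subspaces of Grassmannians -/

section Open

/-- Expand one argument at a time: the auxiliary statement lets the arguments indexed by `s` lie in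
the span and keeps the others in `X`. -/
theorem MultilinearMap.map_mem_of_forall_mem_span {R M : Type} [CommRing R] [AddCommGroup M]
    [Module R M] {ι : Type} [Finite ι] (f : MultilinearMap R (fun _ : ι => M) R) {X : Set M}
    {I : Ideal R} (h : ∀ v, (∀ j, v j ∈ X) → f v ∈ I) {w : ι → M}
    (hw : ∀ j, w j ∈ Submodule.span R X) : f w ∈ I := by
  classical
  cases nonempty_fintype ι
  suffices H : ∀ (s : Finset ι) (w : ι → M), (∀ j ∈ s, w j ∈ Submodule.span R X) →
      (∀ j ∉ s, w j ∈ X) → f w ∈ I from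
    H Finset.univ w (fun j _ => hw j) fun j hj => absurd (Finset.mem_univ j) hj
  intro s
  induction s using Finset.induction_on with
  | empty => exact fun w _ h' => h w fun j => h' j (Finset.notMem_empty j)
  | insert i s hi ih =>
    intro w h₁ h₂
    have key : ∀ x ∈ Submodule.span R X, f (Function.update w i x) ∈ I := fun x hx => by
      induction hx using Submodule.span_induction with
      | mem x hx =>
        refine ih _ (fun j hj => ?_) fun j hj => ?_
        · rw [Function.update_of_ne (by rintro rfl; exact hi hj)]
          exact h₁ j (Finset.mem_insert_of_mem hj)
        · by_cases hji : j = i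
          · subst hji
            rwa [Function.update_self]
          · rw [Function.update_of_ne hji]
            exact h₂ j fun h => (Finset.mem_insert.1 h).elim hji hj
      | zero => rw [f.map_update_zero]; exact zero_mem _
      | add x y _ _ hx hy => rw [f.map_update_add]; exact add_mem hx hy
      | smul c x _ hx => rw [f.map_update_smul]; exact I.mul_mem_left _ hx
    have := key (w i) (h₁ i (Finset.mem_insert_self _ _))
    rwa [Function.update_eq_self] at this

/-- The map `r` need only invert `i` on `L`, as happens for a projection restricted to a transversal
subspace. -/
theorem IsSummand.map_of_leftInverse {R M N : Type} [CommRing R] [AddCommGroup M] [Module R M]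
    [AddCommGroup N] [Module R N] [Module.Projective R N] {k : ℕ}
    {L : Submodule R M} (hL : IsSummand k L) (i : M →ₗ[R] N) (r : N →ₗ[R] M)
    (h : ∀ v ∈ L, r (i v) = v) : IsSummand k (L.map i) := by
  have := hL.1
  obtain ⟨π, hπ⟩ := exists_projection L
  have hi : Function.Injective (i.domRestrict L) := fun v w hvw => by
    have hvw : i v = i w := hvw
    exact Subtype.ext (by rw [← h v v.2, hvw, h w w.2])
  refine ⟨projective_quot_of_retraction _ (i ∘ₗ L.subtype ∘ₗ π ∘ₗ r) (fun v => ?_) fun v hv => ?_,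
    fun p => ?_⟩
  · exact ⟨_, (π (r v)).2, rfl⟩
  · obtain ⟨w, hw, rfl⟩ := hv
    have h1 : π (r (i w)) = ⟨w, hw⟩ := by rw [h w hw]; exact hπ ⟨w, hw⟩
    simp [h1]
  · rw [← hL.2 p, ← LinearMap.range_domRestrict]
    exact (Module.rankAtStalk_eq_of_equiv (LinearEquiv.ofInjective _ hi)).symm ▸ rfl

/-! ### Maximal minors and the locus of split injectivity -/

variable {a m n : ℕ} {R S : CommAlgCat.{0} ℂ}

/-- The subspace of `Gr(a, n)` of those subspaces on which a matrix is a split injection. -/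
def Gr.injOn (a : ℕ) (Q : Matrix (Fin m) (Fin n) ℂ) : Subfunctor (Gr a n) where
  obj R := {B | ∃ G : Matrix (Fin n) (Fin m) R, ∀ v ∈ Gr.toSubmodule B, G.mulVec (act R Q v) = v}
  map {R S} f B := by
    rintro ⟨G, hG⟩
    refine ⟨G.map f.hom, fun v hv => ?_⟩
    rw [Gr.toSubmodule_map', pushSub] at hv
    induction hv using Submodule.span_induction with
    | mem v hv =>
      obtain ⟨v, hv, rfl⟩ := hv
      rw [← vmap_act, ← vmap_mulVec, hG v hv]
    | zero => simp
    | add x y _ _ hx hy => rw [map_add, Matrix.mulVec_add, hx, hy]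
    | smul c x _ hx => rw [map_smul, Matrix.mulVec_smul, hx]

/-- The minor of a matrix on a tuple of vectors, as a multilinear map. -/
def minor (R : CommAlgCat.{0} ℂ) (Q : Matrix (Fin m) (Fin n) ℂ) (r : Fin a → Fin m) :
    MultilinearMap R (fun _ : Fin a => Fin n → R) R :=
  (Matrix.detRowAlternating (n := Fin a) (R := R)).toMultilinearMap.compLinearMap
    fun _ => (LinearMap.funLeft R R r).comp (act R Q)

theorem minor_apply (Q : Matrix (Fin m) (Fin n) ℂ) (r : Fin a → Fin m) (v : Fin a → Fin n → R) :
    minor R Q r v = (Matrix.of fun j i => act R Q (v j) (r i)).det := rfl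

theorem minor_map (f : R ⟶ S) (Q : Matrix (Fin m) (Fin n) ℂ) (r : Fin a → Fin m)
    (v : Fin a → Fin n → R) : minor S Q r (fun j => vmap n f (v j)) = f.hom (minor R Q r v) := by
  rw [minor_apply, minor_apply, AlgHom.map_det]
  congr 1
  ext i j
  simp only [Matrix.of_apply, ← vmap_act, vmap_apply, AlgHom.mapMatrix_apply, Matrix.map_apply]

/-- The ideal generated by the maximal minors of the restriction of a matrix to a subspace. -/
def minorIdeal (Q : Matrix (Fin m) (Fin n) ℂ) (B : (Gr a n).obj R) : Ideal R :=
  Ideal.span {d | ∃ (r : Fin a → Fin m) (v : Fin a → Fin n → R),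
    (∀ j, v j ∈ Gr.toSubmodule B) ∧ minor R Q r v = d}

theorem minor_mem {Q : Matrix (Fin m) (Fin n) ℂ} {B : (Gr a n).obj R} (r : Fin a → Fin m)
    {v : Fin a → Fin n → R} (h : ∀ j, v j ∈ Gr.toSubmodule B) : minor R Q r v ∈ minorIdeal Q B :=
  Ideal.subset_span ⟨r, v, h, rfl⟩

/-- Vectors of the base change are combinations of images of vectors of `B`, so by multilinearity
their minors lie in the extended ideal. Using all tuples in `B` avoids choosing a basis, which need
not exist. -/
theorem minorIdeal_map (f : R ⟶ S) (Q : Matrix (Fin m) (Fin n) ℂ) (B : (Gr a n).obj R) :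
    minorIdeal Q ((Gr a n).map f B) = (minorIdeal Q B).map f.hom := by
  apply le_antisymm
  · refine Ideal.span_le.2 ?_
    rintro _ ⟨r, w, hw, rfl⟩
    refine MultilinearMap.map_mem_of_forall_mem_span (minor S Q r)
      (X := vmap n f '' (Gr.toSubmodule B)) (fun v hv => ?_) hw
    choose u hu hu' using hv
    obtain rfl : (fun j => vmap n f (u j)) = v := funext hu'
    rw [minor_map]
    exact Ideal.mem_map_of_mem _ (minor_mem r hu)
  · rw [minorIdeal, Ideal.map_span]
    refine Ideal.span_le.2 ?_
    rintro _ ⟨_, ⟨r, v, hv, rfl⟩, rfl⟩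
    rw [← minor_map f]
    exact minor_mem r fun j => Gr.map_mem f B (hv j)

/-- The matrix of the values of the rows of a matrix on a tuple of vectors. -/
def minorMatrix (R : CommAlgCat.{0} ℂ) (Q : Matrix (Fin m) (Fin n) ℂ) (r : Fin a → Fin m)
    (v : Fin a → Fin n → R) : Matrix (Fin a) (Fin a) R :=
  Matrix.of fun i j => act R Q (v j) (r i)

theorem det_minorMatrix (Q : Matrix (Fin m) (Fin n) ℂ) (r : Fin a → Fin m)
    (v : Fin a → Fin n → R) : (minorMatrix R Q r v).det = minor R Q r v := by
  rw [minor_apply, ← Matrix.det_transpose]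
  rfl

theorem minorMatrix_map (f : R ⟶ S) (Q : Matrix (Fin m) (Fin n) ℂ) (r : Fin a → Fin m)
    (v : Fin a → Fin n → R) :
    minorMatrix S Q r (fun j => vmap n f (v j)) = (minorMatrix R Q r v).map f.hom := by
  ext i j
  rw [minorMatrix, Matrix.of_apply, ← vmap_act]
  rfl

/-- Cramer's rule. In frame coordinates the minor matrix factors as `N V'`, and `V' adj(N V') N = V'
adj(V') adj(N) N = det(N V')`, so no invertibility is needed. -/
theorem minor_smul_of_frame {M : Matrix (Fin n) (Fin a) R} (Q : Matrix (Fin m) (Fin n) ℂ)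
    (r : Fin a → Fin m)
    {v : Fin a → Fin n → R} (hv : ∀ j, ∃ w, M.mulVec w = v j) {u : Fin n → R}
    (hu : ∃ w, M.mulVec w = u) :
    minor R Q r v • u =
      ∑ j, ((minorMatrix R Q r v).adjugate.mulVec fun i => act R Q u (r i)) j • v j := by
  choose V hV using hv
  obtain ⟨U, rfl⟩ := hu
  let V' : Matrix (Fin a) (Fin a) R := Matrix.of fun i j => V j i
  let N : Matrix (Fin a) (Fin a) R :=
    LinearMap.toMatrix' ((LinearMap.funLeft R R r) ∘ₗ (act R Q) ∘ₗ M.mulVecLin)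
  have hN : ∀ w, (fun i => act R Q (M.mulVec w) (r i)) = N.mulVec w := fun w => by
    rw [LinearMap.toMatrix'_mulVec]; rfl
  have hD : minorMatrix R Q r v = N * V' := by
    ext i j
    rw [minorMatrix, Matrix.of_apply, ← hV]
    exact congrFun (hN (V j)) i
  have hsum : ∀ w : Fin a → R, ∑ j, w j • v j = M.mulVec (V'.mulVec w) := fun w => by
    have : V'.mulVec w = ∑ j, w j • V j := by
      ext i
      simp [V', Matrix.mulVec, dotProduct, Finset.sum_apply, mul_comm]
    rw [this, Matrix.mulVec_sum]
    exact Finset.sum_congr rfl fun j _ => by rw [Matrix.mulVec_smul, hV]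
  have hmat : V' * ((N * V').adjugate * N) = (N * V').det • 1 := by
    rw [Matrix.adjugate_mul_distrib, Matrix.mul_assoc, Matrix.adjugate_mul, Matrix.mul_smul,
      Matrix.mul_one, Matrix.mul_smul, Matrix.mul_adjugate, smul_smul, Matrix.det_mul]
  have hvec : V'.mulVec ((N * V').adjugate.mulVec (N.mulVec U)) = (N * V').det • U := by
    rw [Matrix.mulVec_mulVec U, Matrix.mulVec_mulVec U, hmat, Matrix.smul_mulVec, Matrix.one_mulVec]
  rw [hsum, hN, ← det_minorMatrix, hD, hvec, Matrix.mulVec_smul]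

theorem eq_of_localizationAt {u v : Fin n → R}
    (h : ∀ (p : Ideal R) [p.IsMaximal],
      vmap n (localizationAt R p) u = vmap n (localizationAt R p) v) : u = v := by
  ext i
  rw [← sub_eq_zero]
  refine eq_zero_of_localizationAt fun p _ => ?_
  rw [map_sub, sub_eq_zero]
  exact congrFun (h p) i

theorem exists_frame_localizationAt (B : (Gr a n).obj R) (p : Ideal R) [p.IsPrime] :
    ∃ M L h, (Gr a n).map (localizationAt R p) B = framePt M L h := by
  have := free_of_isLocalRing (R := CommAlgCat.of ℂ (Localization.AtPrime p))
    ((Gr a n).map (localizationAt R p) B)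
  exact exists_framePt (R := CommAlgCat.of ℂ (Localization.AtPrime p)) _

/-- Cramer's rule on a projective module of constant rank. -/
theorem minor_smul (Q : Matrix (Fin m) (Fin n) ℂ) (B : (Gr a n).obj R) (r : Fin a → Fin m)
    {v : Fin a → Fin n → R} (hv : ∀ j, v j ∈ Gr.toSubmodule B) {u : Fin n → R}
    (hu : u ∈ Gr.toSubmodule B) :
    minor R Q r v • u =
      ∑ j, ((minorMatrix R Q r v).adjugate.mulVec fun i => act R Q u (r i)) j • v j := by
  refine eq_of_localizationAt fun p _ => ?_
  obtain ⟨M, L, h, hM⟩ := exists_frame_localizationAt B p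
  have hf : ∀ w ∈ Gr.toSubmodule B, ∃ z, M.mulVec z = vmap n (localizationAt R p) w :=
    fun w hw => by
      rw [← mem_framePt (h := h), ← hM]
      exact Gr.map_mem _ B hw
  have key := minor_smul_of_frame (M := M) Q r (v := fun j => vmap n (localizationAt R p) (v j))
    (fun j => hf _ (hv j)) (hf u hu)
  rw [LinearMap.map_smulₛₗ, map_sum]
  simp only [LinearMap.map_smulₛₗ]
  rw [minor_map] at key
  refine key.trans (Finset.sum_congr rfl fun j _ => congrArg (· • _) ?_)
  have h1 : (fun i => act _ Q (vmap n (localizationAt R p) u) (r i)) =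
      vmap a (localizationAt R p) (fun i => act R Q u (r i)) := by
    ext i
    rw [← vmap_act]
    rfl
  have h2 : (minorMatrix _ Q r fun j => vmap n (localizationAt R p) (v j)).adjugate =
      (minorMatrix R Q r v).adjugate.map (localizationAt R p).hom := by
    rw [minorMatrix_map]
    exact ((localizationAt R p).hom.toRingHom.map_adjugate _).symm
  rw [h1, h2, ← vmap_mulVec]
  rfl

/-- `1 = det(W Q M)` is multilinear in the rows, and each row of `W Q M` is a combination of rows of
`Q M`. So 1 is a combination of minors. -/
theorem minorIdeal_framePt {M : Matrix (Fin n) (Fin a) R} {L : Matrix (Fin a) (Fin n) R}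
    (h : L * M = 1) {Q : Matrix (Fin m) (Fin n) ℂ} {W : Matrix (Fin a) (Fin m) R}
    (hW : W * (Q.map (algebraMap ℂ R) * M) = 1) : minorIdeal Q (framePt M L h) = ⊤ := by
  rw [Ideal.eq_top_iff_one, ← Matrix.det_one (n := Fin a), ← hW]
  refine MultilinearMap.map_mem_of_forall_mem_span
    (Matrix.detRowAlternating (n := Fin a) (R := R)).toMultilinearMap
    (X := Set.range (Q.map (algebraMap ℂ R) * M)) (fun v hv => ?_) fun i => ?_
  · choose r hr using hv
    have : (Matrix.detRowAlternating (n := Fin a) (R := R)).toMultilinearMap v =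
        minor R Q r fun j => M.col j := by
      rw [← det_minorMatrix]
      refine congrArg Matrix.det (Matrix.ext fun i j => ?_)
      rw [← hr]
      rfl
    rw [this]
    exact minor_mem r fun j => ⟨Pi.single j 1, by simp⟩
  · have : (W * (Q.map (algebraMap ℂ R) * M)) i =
        ∑ x, W i x • (Q.map (algebraMap ℂ R) * M) x := by
      ext j
      simp [Matrix.mul_apply, Finset.sum_apply]
    rw [this]
    exact sum_mem fun x _ => Submodule.smul_mem _ _ (Submodule.subset_span ⟨x, rfl⟩)

/-- The residue field at a maximal ideal. -/
def residue (R : CommAlgCat.{0} ℂ) (p : Ideal R) : R ⟶ CommAlgCat.of ℂ (R ⧸ p) :=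
  CommAlgCat.ofHom (Ideal.Quotient.mkₐ ℂ p)

theorem exists_frame_residue (B : (Gr a n).obj R) (p : Ideal R) [p.IsMaximal] :
    ∃ M L h, (Gr a n).map (residue R p) B = framePt M L h := by
  have : IsLocalRing (CommAlgCat.of ℂ (R ⧸ p)) := by
    let := Ideal.Quotient.field p
    exact inferInstanceAs (IsLocalRing (R ⧸ p))
  have := free_of_isLocalRing ((Gr a n).map (residue R p) B)
  exact exists_framePt _

theorem minorIdeal_framePt_of_mem {M : Matrix (Fin n) (Fin a) R} {L : Matrix (Fin a) (Fin n) R}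
    {h : L * M = 1} {Q : Matrix (Fin m) (Fin n) ℂ}
    (hB : framePt M L h ∈ (Gr.injOn a Q).obj R) : minorIdeal Q (framePt M L h) = ⊤ := by
  obtain ⟨G, hG⟩ := hB
  have hGM : G * (Q.map (algebraMap ℂ R) * M) = M := by
    refine Matrix.ext_of_mulVec_single fun j => ?_
    rw [← Matrix.mulVec_mulVec, ← Matrix.mulVec_mulVec]
    exact hG _ ⟨_, rfl⟩
  exact minorIdeal_framePt h (Q := Q) (W := L * G) (by rw [Matrix.mul_assoc, hGM, h])

/-- If the minors lie in a maximal ideal, then over its residue field all minors vanish, although a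
frame with a left inverse forces them to generate the unit ideal. Conversely, the scalars `d` for
which some `G` satisfies `G Q = d` on `B` form an ideal; Cramer's rule puts every minor in it, hence
also 1. -/
theorem Gr.mem_injOn_iff_minorIdeal {Q : Matrix (Fin m) (Fin n) ℂ} {B : (Gr a n).obj R} :
    B ∈ (Gr.injOn a Q).obj R ↔ minorIdeal Q B = ⊤ := by
  constructor
  · intro hB
    by_contra hI
    obtain ⟨p, hp, hle⟩ := Ideal.exists_le_maximal _ hI
    obtain ⟨M, L, h, hM⟩ := exists_frame_residue B p
    have h1 := (Gr.injOn a Q).map (residue R p) hB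
    rw [Set.mem_preimage, hM] at h1
    have h1 := minorIdeal_framePt_of_mem h1
    rw [← hM, minorIdeal_map] at h1
    have h2 : (minorIdeal Q B).map (residue R p).hom = ⊥ := Ideal.map_mk_eq_bot_of_le hle
    rw [h2] at h1
    have : Nontrivial (R ⧸ p) := Ideal.Quotient.nontrivial_iff.2 hp.ne_top
    exact bot_ne_top (α := Ideal (R ⧸ p)) h1
  · intro h
    let J : Ideal R :=
      { carrier := {d | ∃ G : Matrix (Fin n) (Fin m) R,
          ∀ v ∈ Gr.toSubmodule B, G.mulVec (act R Q v) = d • v}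
        add_mem' := by
          rintro d d' ⟨G, hG⟩ ⟨G', hG'⟩
          exact ⟨G + G', fun v hv => by rw [Matrix.add_mulVec, hG v hv, hG' v hv, add_smul]⟩
        zero_mem' := ⟨0, fun v _ => by simp⟩
        smul_mem' := by
          rintro c d ⟨G, hG⟩
          exact ⟨c • G, fun v hv => by rw [Matrix.smul_mulVec, hG v hv, smul_smul]; rfl⟩ }
    have hJ : minorIdeal Q B ≤ J := by
      refine Ideal.span_le.2 ?_
      rintro _ ⟨r, v, hv, rfl⟩
      let g : (Fin m → R) →ₗ[R] (Fin n → R) := (Fintype.linearCombination R v) ∘ₗ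
        (minorMatrix R Q r v).adjugate.mulVecLin ∘ₗ LinearMap.funLeft R R r
      refine ⟨LinearMap.toMatrix' g, fun u hu => ?_⟩
      rw [LinearMap.toMatrix'_mulVec, minor_smul Q B r hv hu]
      rfl
    rw [h] at hJ
    obtain ⟨G, hG⟩ := hJ (Submodule.mem_top (x := (1 : R)))
    exact ⟨G, fun v hv => by rw [hG v hv, one_smul]⟩

theorem Gr.isOpenSub_injOn (a : ℕ) (Q : Matrix (Fin m) (Fin n) ℂ) :
    IsOpenSub (Gr.injOn a Q) := fun R B => ⟨minorIdeal Q B, fun S f => by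
  rw [Gr.mem_injOn_iff_minorIdeal, minorIdeal_map]⟩

theorem Gr.mem_injOn_framePt {M : Matrix (Fin n) (Fin a) R} {L : Matrix (Fin a) (Fin n) R}
    {h : L * M = 1} {Q : Matrix (Fin m) (Fin n) ℂ} {W : Matrix (Fin a) (Fin m) R}
    (hW : W * (Q.map (algebraMap ℂ R) * M) = 1) :
    framePt M L h ∈ (Gr.injOn a Q).obj R :=
  Gr.mem_injOn_iff_minorIdeal.2 (minorIdeal_framePt h hW)

theorem IsOpenSub.preimage {X Y : Space} {V : Subfunctor X} (hV : IsOpenSub V) (p : Y ⟶ X) :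
    IsOpenSub (V.preimage p) := fun R y => by
  obtain ⟨I, hI⟩ := hV R (p.app R y)
  refine ⟨I, fun S f => ?_⟩
  rw [← hI S f, ← NatTrans.naturality_apply]
  rfl

theorem IsOpenSub.inf {X : Space} {V W : Subfunctor X} (hV : IsOpenSub V) (hW : IsOpenSub W) :
    IsOpenSub (V ⊓ W) := fun R x => by
  obtain ⟨I, hI⟩ := hV R x
  obtain ⟨J, hJ⟩ := hW R x
  refine ⟨I * J, fun S f => ?_⟩
  have h : (I * J).map f.hom = ⊤ ↔ I.map f.hom = ⊤ ∧ J.map f.hom = ⊤ := by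
    rw [Ideal.map_mul]
    refine ⟨fun h => ⟨top_le_iff.1 (h ▸ Ideal.mul_le_left), top_le_iff.1 (h ▸ Ideal.mul_le_right)⟩,
      fun h => by rw [h.1, h.2, Ideal.top_mul]⟩
  rw [h, ← hI S f, ← hJ S f]
  rfl

end Open

/-! ### Birationality -/

section Birational

variable {a m n k : ℕ} {R S : CommAlgCat.{0} ℂ}

/-- The image of a subspace on which a matrix is a split injection. -/
theorem isSummand_map_act {Q : Matrix (Fin m) (Fin n) ℂ} {B : (Gr a n).obj R}
    (hB : B ∈ (Gr.injOn a Q).obj R) : IsSummand a ((Gr.toSubmodule B).map (act R Q)) := by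
  obtain ⟨G, hG⟩ := hB
  exact (Gr.isSummand B).map_of_leftInverse _ G.mulVecLin hG

/-- Where `P` is split injective on `B`, the image `P(B)` is a summand of rank `a` contained in `A`,
so `A = P(B)`. -/
theorem isIso_fromPreimage (P : Matrix (Fin m) (Fin n) ℂ) :
    IsIso ((Gr.injOn a P).fromPreimage (sndOn (VectorBundle.zeroLocus (boxSec a m a n P)))) := by
  refine Space.isIso_of_bijective _ fun R => ?_
  have key : ∀ (A : (Gr a m).obj R) (B : (Gr a n).obj R) (hB : B ∈ (Gr.injOn a P).obj R),
      (∀ v ∈ Gr.toSubmodule B, act R P v ∈ Gr.toSubmodule A) → Gr.mk _ (isSummand_map_act hB) = A :=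
    fun A B hB h => Gr.ext_of_le (Submodule.map_le_iff_le_comap.2 h)
  constructor
  · rintro ⟨⟨⟨A, B⟩, h⟩, hB⟩ ⟨⟨⟨A', B'⟩, h'⟩, hB'⟩ e
    obtain rfl : B = B' := congrArg Subtype.val e
    obtain rfl : A = A' := (key A B hB (mem_zeroLocus_boxSec.1 h)).symm.trans
      (key A' B hB (mem_zeroLocus_boxSec.1 h'))
    rfl
  · rintro ⟨B, hB⟩
    exact ⟨⟨⟨(Gr.mk _ (isSummand_map_act hB), B), mem_zeroLocus_boxSec.2 fun v hv =>
      ⟨v, hv, rfl⟩⟩, hB⟩, rfl⟩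

/-! ### Deformations over the formal disc -/

section Deformation

variable {F : Type} [Field F] [Algebra ℂ F]

/-- The special point of the formal disc. -/
def specialPt (F : Type) [Field F] [Algebra ℂ F] :
    CommAlgCat.of ℂ (PowerSeries F) ⟶ CommAlgCat.of ℂ F :=
  CommAlgCat.ofHom
    { (PowerSeries.constantCoeff (R := F)) with
      commutes' := fun c => by simp [PowerSeries.algebraMap_apply] }

theorem specialPt_apply (x : PowerSeries F) :
    (specialPt F).hom x = PowerSeries.constantCoeff x := rfl

/-- Power series over a field form a local ring whose maximal ideal is the kernel of specialisation.
An open subspace containing the special point therefore contains the whole disc. -/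
theorem eq_top_of_map_specialPt {I : Ideal (PowerSeries F)}
    (h : I.map (specialPt F).hom = ⊤) : I = ⊤ := by
  by_contra hI
  have : I ≤ RingHom.ker (specialPt F).hom := fun x hx => by
    rw [RingHom.mem_ker, specialPt_apply]
    by_contra h0
    exact hI (Ideal.eq_top_of_isUnit_mem _ hx
      (PowerSeries.isUnit_iff_constantCoeff.2 (Ne.isUnit h0)))
  rw [(Ideal.map_eq_bot_iff_le_ker (f := (specialPt F).hom)).2 this] at h
  exact bot_ne_top (α := Ideal F) h

omit [Algebra ℂ F] in
-- This determinant is the characteristic polynomial of `-N`, which is monic.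
theorem det_add_X_smul_ne_zero (N : Matrix (Fin a) (Fin a) F) :
    (N.map PowerSeries.C + (PowerSeries.X : PowerSeries F) • 1).det ≠ 0 := by
  have h := (Matrix.charpoly_monic (-N)).ne_zero
  have e : (N.map PowerSeries.C + (PowerSeries.X : PowerSeries F) • 1) =
      (Polynomial.coeToPowerSeries.ringHom (R := F)).mapMatrix (Matrix.charmatrix (-N)) := by
    ext1 i j
    by_cases hij : i = j
    · subst hij
      simp [add_comm]
    · simp [hij]
  rw [e, ← RingHom.map_det]
  exact fun h0 => h (Polynomial.coe_injective F (by simpa [Matrix.charpoly] using h0))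

omit [Algebra ℂ F] in
open PowerSeries in
-- Take `M' = M + X σ α`. Then `P M' = P M + X α = α (β P M + X)`, so the image stays in the column
-- space of `α`, while `D = β P M + X` has nonzero determinant. A left inverse exists since `L M'`
-- has constant term 1.
theorem exists_matrix_deformation {P : Matrix (Fin m) (Fin n) F} {σ : Matrix (Fin n) (Fin m) F}
    (hσ : P * σ = 1) {α : Matrix (Fin m) (Fin a) F} {β : Matrix (Fin a) (Fin m) F}
    {M : Matrix (Fin n) (Fin a) F} {L : Matrix (Fin a) (Fin n) F} (hL : L * M = 1)
    (hα : α * (β * (P * M)) = P * M) :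
    ∃ (M' : Matrix (Fin n) (Fin a) F⟦X⟧) (L' : Matrix (Fin a) (Fin n) F⟦X⟧)
      (D : Matrix (Fin a) (Fin a) F⟦X⟧), L' * M' = 1 ∧ M'.map constantCoeff = M ∧
      P.map C * M' = α.map C * D ∧ D.det ≠ 0 := by
  let M' : Matrix (Fin n) (Fin a) F⟦X⟧ := M.map C + (X : F⟦X⟧) • (σ * α).map C
  have hM' : M'.map constantCoeff = M := by
    ext i j
    simp [M']
  have hdet : IsUnit (L.map C * M').det := by
    rw [isUnit_iff_constantCoeff, RingHom.map_det]
    have : (constantCoeff (R := F)).mapMatrix (L.map C * M') = 1 := by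
      rw [RingHom.mapMatrix_apply, Matrix.map_mul, hM', ← hL]
      congr 1
    rw [this, Matrix.det_one]
    exact isUnit_one
  refine ⟨M', (L.map C * M')⁻¹ * L.map C, (β * (P * M)).map C + (X : F⟦X⟧) • 1, ?_, hM', ?_,
    det_add_X_smul_ne_zero _⟩
  · rw [Matrix.mul_assoc, Matrix.nonsing_inv_mul _ hdet]
  · rw [Matrix.mul_add, Matrix.mul_add, Matrix.mul_smul, Matrix.mul_smul, Matrix.mul_one,
      ← Matrix.map_mul, ← Matrix.map_mul, ← Matrix.map_mul, hα, ← Matrix.mul_assoc, hσ,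
      Matrix.one_mul]

variable (s : Splitting m k n)

/-- Every point of the zero locus over a field is the specialisation of a point whose generic point
lies over the open subspace on which the projection is injective. -/
theorem Splitting.exists_deformation (A : (Gr a m).obj (CommAlgCat.of ℂ F))
    (B : (Gr a n).obj (CommAlgCat.of ℂ F))
    (h : ∀ v ∈ Gr.toSubmodule B, act (CommAlgCat.of ℂ F) s.P v ∈ Gr.toSubmodule A) :
    ∃ (A' : (Gr a m).obj (CommAlgCat.of ℂ (PowerSeries F)))
      (B' : (Gr a n).obj (CommAlgCat.of ℂ (PowerSeries F))),
      (∀ v ∈ Gr.toSubmodule B', act _ s.P v ∈ Gr.toSubmodule A') ∧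
      (Gr a m).map (specialPt F) A' = A ∧ (Gr a n).map (specialPt F) B' = B ∧
      (Gr a n).map (toFrac (CommAlgCat.of ℂ (PowerSeries F))) B' ∈
        (Gr.injOn a s.P).obj (CommAlgCat.of ℂ (FractionRing (PowerSeries F))) := by
  obtain ⟨α, β, hβ, rfl⟩ := exists_framePt A
  obtain ⟨M, L, hL, rfl⟩ := exists_framePt B
  have hσ : s.P.map (algebraMap ℂ F) * s.σ.map (algebraMap ℂ F) = 1 := by
    rw [← Matrix.map_mul, s.P_mul_σ]
    simp
  have hα : α * (β * (s.P.map (algebraMap ℂ F) * M)) = s.P.map (algebraMap ℂ F) * M := by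
    refine Matrix.ext_of_mulVec_single fun j => ?_
    obtain ⟨u, hu⟩ := h (M.mulVec (Pi.single j 1)) ⟨_, rfl⟩
    have hu : α.mulVec u = (s.P.map (algebraMap ℂ F)).mulVec (M.mulVec (Pi.single j 1)) := hu
    rw [← Matrix.mulVec_mulVec, ← Matrix.mulVec_mulVec, ← Matrix.mulVec_mulVec, ← hu,
      Matrix.mulVec_mulVec u β, hβ, Matrix.one_mulVec]
  obtain ⟨M', L', D, h₁, h₂, h₃, h₄⟩ := exists_matrix_deformation hσ hL hα
  have hβ' : β.map PowerSeries.C * α.map PowerSeries.C = 1 := by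
    rw [← Matrix.map_mul, hβ]
    simp
  have hP : s.P.map (algebraMap ℂ (PowerSeries F)) =
      (s.P.map (algebraMap ℂ F)).map PowerSeries.C := by
    ext1 i j
    simp [PowerSeries.algebraMap_apply]
  refine ⟨framePt (R := CommAlgCat.of ℂ (PowerSeries F)) _ _ hβ',
    framePt (R := CommAlgCat.of ℂ (PowerSeries F)) _ _ h₁, ?_, ?_, ?_, ?_⟩
  · rintro _ ⟨u, rfl⟩
    refine ⟨D.mulVec u, ?_⟩
    have : (α.map PowerSeries.C).mulVec (D.mulVec u) =
        (s.P.map (algebraMap ℂ (PowerSeries F))).mulVec (M'.mulVec u) := by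
      rw [Matrix.mulVec_mulVec, Matrix.mulVec_mulVec, hP, h₃]
    exact this
  · refine framePt_map_eq _ hβ' hβ (Matrix.ext fun i j => ?_)
    exact PowerSeries.constantCoeff_C (α i j)
  · exact framePt_map_eq _ h₁ hL h₂
  · rw [framePt_map]
    let ι := (toFrac (CommAlgCat.of ℂ (PowerSeries F))).hom
    have hD : IsUnit (D.map ι).det := by
      rw [isUnit_iff_ne_zero]
      intro h0
      refine h₄ (toFrac_injective (CommAlgCat.of ℂ (PowerSeries F)) ?_)
      rw [map_zero, ← h0]
      exact AlgHom.map_det ι D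
    refine Gr.mem_injOn_framePt (W := (D.map ι)⁻¹ * (β.map PowerSeries.C).map ι) ?_
    have hPι : s.P.map (algebraMap ℂ (FractionRing (PowerSeries F))) =
        (s.P.map (algebraMap ℂ (PowerSeries F))).map ι := by
      ext1 i j
      exact (ι.commutes _).symm
    have e₁ : s.P.map (algebraMap ℂ (FractionRing (PowerSeries F))) * M'.map ι =
        (α.map PowerSeries.C).map ι * D.map ι := by
      rw [hPι, hP]
      exact Matrix.map_mul.symm.trans ((congrArg (fun T => T.map ι) h₃).trans Matrix.map_mul)
    have e₂ : (β.map PowerSeries.C).map ι * (α.map PowerSeries.C).map ι = 1 :=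
      map_mul_eq_one (toFrac (CommAlgCat.of ℂ (PowerSeries F))) hβ'
    have e₃ : (D.map ι)⁻¹ * (β.map PowerSeries.C).map ι *
        ((α.map PowerSeries.C).map ι * D.map ι) = 1 := by
      rw [Matrix.mul_assoc, ← Matrix.mul_assoc _ _ (D.map ι), e₂, Matrix.one_mul,
        Matrix.nonsing_inv_mul _ hD]
    exact (congrArg (_ * ·) e₁).trans e₃

end Deformation

variable (s : Splitting m k n)

/-- A nonempty open `W` has a point over a residue field. Deform it over the disc: `W` contains the
special point, hence the generic one, and that point also lies over the locus of injectivity. -/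
theorem Splitting.isDenseSub_preimage : IsDenseSub ((Gr.injOn a s.P).preimage
    (sndOn (VectorBundle.zeroLocus (boxSec a m a n s.P)))) := by
  intro W hW hne hempty
  refine hne fun R _ => ⟨fun x => ?_⟩
  obtain ⟨p, hp⟩ := Ideal.exists_maximal R
  let : Field (R ⧸ p) := Ideal.Quotient.field p
  let f : R ⟶ CommAlgCat.of ℂ (R ⧸ p) := residue R p
  let y := W.toFunctor.map f x
  obtain ⟨⟨⟨A, B⟩, hAB⟩, hy⟩ := y
  obtain ⟨A', B', h', hA, hB, hinj⟩ := s.exists_deformation A B (mem_zeroLocus_boxSec.1 hAB)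
  let z : (VectorBundle.zeroLocus (boxSec a m a n s.P)).toFunctor.obj
    (CommAlgCat.of ℂ (PowerSeries (R ⧸ p))) := ⟨(A', B'), mem_zeroLocus_boxSec.2 h'⟩
  have hz : (VectorBundle.zeroLocus (boxSec a m a n s.P)).toFunctor.map (specialPt (R ⧸ p)) z =
      ⟨(A, B), hAB⟩ := Subtype.ext (Prod.ext hA hB)
  obtain ⟨I, hI⟩ := hW _ z
  -- The special point lies in `W`, so the ideal defining the complement of `W` on the disc is the
  -- unit ideal.
  have h1 : I = ⊤ := eq_top_of_map_specialPt ((hI _ _).1 (hz ▸ hy))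
  have h2 := (hI _ (toFrac (CommAlgCat.of ℂ (PowerSeries (R ⧸ p))))).2 (by rw [h1, Ideal.map_top])
  exact (hempty _ (inferInstanceAs (Nontrivial (FractionRing (PowerSeries (R ⧸ p)))))).false
    ⟨_, hinj, h2⟩

/-- As `a ≤ m`, over a field `P(B)` lies in some `a`-dimensional `A`, so every field point lifts to
the zero locus. Nonempty opens thus have nonempty preimages, and density descends from the zero
locus. -/
theorem Splitting.isDenseSub_injOn (ham : a ≤ m) : IsDenseSub (Gr.injOn a s.P) := by
  intro W hW hne hempty
  refine s.isDenseSub_preimage (a := a) (W.preimage (sndOn _)) (hW.preimage _) (fun h => ?_)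
    fun R _ => ⟨fun x => ?_⟩
  · refine hne fun R _ => ⟨fun x => ?_⟩
    obtain ⟨p, hp⟩ := Ideal.exists_maximal R
    let : Field (R ⧸ p) := Ideal.Quotient.field p
    let f : R ⟶ CommAlgCat.of ℂ (R ⧸ p) := residue R p
    obtain ⟨B, hB⟩ := W.toFunctor.map f x
    let B₀ : Submodule (R ⧸ p) (Fin n → R ⧸ p) := Gr.toSubmodule B
    let P₀ : (Fin n → R ⧸ p) →ₗ[R ⧸ p] (Fin m → R ⧸ p) := act (CommAlgCat.of ℂ (R ⧸ p)) s.P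
    obtain ⟨A, hA, -, hA'⟩ := exists_between_finrank (b := a) (W := B₀.map P₀) (D := ⊤) le_top
      ((Submodule.finrank_map_le P₀ B₀).trans (Gr.finrank_eq B).le) (by simpa using ham)
    exact (h (CommAlgCat.of ℂ (R ⧸ p)) (inferInstanceAs (Nontrivial (R ⧸ p)))).false
      ⟨⟨(Gr.ofFinrank A hA', B), mem_zeroLocus_boxSec.2 (Submodule.map_le_iff_le_comap.1 hA)⟩, hB⟩
  · exact (hempty R ‹_›).false ⟨_, x.2⟩

theorem Splitting.isBirational (ham : a ≤ m) :
    IsBirational (sndOn (VectorBundle.zeroLocus (boxSec a m a n s.P))) :=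
  ⟨Gr.injOn a s.P, Gr.isOpenSub_injOn a s.P, s.isDenseSub_injOn ham, s.isDenseSub_preimage,
    isIso_fromPreimage s.P⟩

end Birational

/-! ### Orthogonal complements -/

section Perp

/-! ### Ranks of duals and of invertible modules -/

section Rank

variable {R : Type} [CommRing R]

theorem isBaseChangeAlong_mk (R S M : Type) [CommRing R] [CommRing S] [Algebra R S]
    [AddCommGroup M] [Module R M] [Module.Finite R M] [Module.Projective R M] :
    ∃ ψ : M →ₛₗ[algebraMap R S] (S ⊗[R] M), IsBaseChangeAlong ψ := by
  obtain ⟨k, e, ε, he⟩ := exists_dualBasis R M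
  let ψ : M →ₛₗ[algebraMap R S] (S ⊗[R] M) :=
    { toFun := fun v => 1 ⊗ₜ v
      map_add' := fun v w => TensorProduct.tmul_add _ _ _
      map_smul' := fun r v => by simp }
  refine ⟨ψ, .of_dualBasis e ε
    (fun i => LinearMap.liftBaseChange S ((Algebra.linearMap R S).comp (ε i))) he
    (fun i v => by simp [ψ]) fun w => ?_⟩
  induction w with
  | zero => simp
  | add x y hx hy => simp only [map_add, add_smul, Finset.sum_add_distrib, hx, hy]
  | tmul s v =>
    conv_rhs => rw [← he v, TensorProduct.tmul_sum]
    refine Finset.sum_congr rfl fun i _ => ?_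
    simp [ψ, TensorProduct.smul_tmul', Algebra.smul_def, mul_comm]

theorem IsBaseChangeAlong.rankAtStalk_comap {S M N : Type} [CommRing S] {φ : R →+* S}
    [AddCommGroup M] [Module R M] [AddCommGroup N] [Module S N]
    [Module.Finite R M] [Module.Projective R M] {ψ : M →ₛₗ[φ] N} (h : IsBaseChangeAlong ψ)
    (p : PrimeSpectrum S) :
    Module.rankAtStalk (R := S) N p = Module.rankAtStalk (R := R) M (p.comap φ) := by
  let : Algebra R S := φ.toAlgebra
  let : Module R N := Module.compHom N φ
  have : IsScalarTower R S N := ⟨fun r s v => mul_smul (φ r) s v⟩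
  exact Module.rankAtStalk_isBaseChange h p

/-- The rank at `p` can be computed over the residue field of `p`, and dualising commutes with this
base change; there it is the dimension of a dual vector space. -/
theorem rankAtStalk_dual {M : Type} [AddCommGroup M] [Module R M] [Module.Finite R M]
    [Module.Projective R M] (p : PrimeSpectrum R) :
    Module.rankAtStalk (R := R) (Module.Dual R M) p = Module.rankAtStalk (R := R) M p := by
  obtain ⟨ψ, hψ⟩ := isBaseChangeAlong_mk R p.asIdeal.ResidueField M
  let q : PrimeSpectrum p.asIdeal.ResidueField := ⊥
  have hq : q.comap (algebraMap R p.asIdeal.ResidueField) = p := by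
    ext1
    exact Ideal.ker_algebraMap_residueField p.asIdeal
  have h1 := hψ.rankAtStalk_comap q
  have h2 := hψ.dual.rankAtStalk_comap q
  rw [hq] at h1 h2
  rw [← h1, ← h2, Module.rankAtStalk_eq_finrank_of_free, Module.rankAtStalk_eq_finrank_of_free]
  exact Subspace.dual_finrank_eq

/-- The ranks of the module and of its dual multiply to the rank 1 of `R`. -/
theorem rankAtStalk_invertible {M : Type} [AddCommGroup M] [Module R M] [Module.Invertible R M]
    (p : PrimeSpectrum R) : Module.rankAtStalk (R := R) M p = 1 := by
  have : Nontrivial R := p.nontrivial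
  have h := Module.rankAtStalk_eq_of_equiv (R := R) (M := Module.Dual R M ⊗[R] M) (N := R)
    (Module.Invertible.linearEquiv R M)
  rw [Module.rankAtStalk_tensorProduct, Module.rankAtStalk_self] at h
  exact Nat.eq_one_of_mul_eq_one_left (congrFun h p)

end Rank

variable {R : Type} [CommRing R] {n k : ℕ}

/-- The orthogonal complement of a submodule. -/
def perp (L : Submodule R (Fin n → R)) : Submodule R (Fin n → R) where
  carrier := {q | Annihilates q L}
  add_mem' hq hq' w hw := by rw [add_dotProduct, hq w hw, hq' w hw, add_zero]
  zero_mem' w _ := zero_dotProduct w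
  smul_mem' c q hq w hw := by rw [smul_dotProduct, hq w hw, smul_zero]

theorem perp_anti {L L' : Submodule R (Fin n → R)} (h : L ≤ L') : perp L' ≤ perp L :=
  fun _ hq w hw => hq w (h hw)

theorem le_perp_perp (L : Submodule R (Fin n → R)) : L ≤ perp (perp L) := fun v hv q hq => by
  rw [dotProduct_comm]
  exact hq v hv

theorem IsSummand.perp_perp {L : Submodule R (Fin n → R)} (h : IsSummand k L) :
    perp (perp L) = L := by
  have := h.1
  refine le_antisymm (fun v hv => ?_) (le_perp_perp L)
  refine mem_of_forall_annihilates fun q hq => ?_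
  rw [dotProduct_comm]
  exact hv q hq

/-- The orthogonal complement is the dual of the quotient. -/
def perpEquiv (L : Submodule R (Fin n → R)) :
    perp L ≃ₗ[R] Module.Dual R ((Fin n → R) ⧸ L) :=
  LinearEquiv.ofBijective
    ({ toFun := fun q => annForm L q q.2
       map_add' := fun q q' => annForm_add q.2 q'.2
       map_smul' := fun c q => annForm_smul q.2 c } :
      perp L →ₗ[R] Module.Dual R ((Fin n → R) ⧸ L))
    ⟨fun q q' h => by
      refine Subtype.ext (funext fun i => ?_)
      have := LinearMap.congr_fun h (Submodule.Quotient.mk (Pi.single i 1))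
      have h' : (q : Fin n → R) ⬝ᵥ Pi.single i 1 = (q' : Fin n → R) ⬝ᵥ Pi.single i 1 := this
      simpa using h', fun l => by
      obtain ⟨q, hq, rfl⟩ := dual_quot_eq_annForm l
      exact ⟨⟨q, hq⟩, rfl⟩⟩

/-- If `E` is the matrix of a projection onto `L`, then `q ↦ q (1 - E)` is a projection onto `L^⊥`.
The rank comes from identifying `L^⊥` with the dual of the quotient. -/
theorem IsSummand.perp {L : Submodule R (Fin n → R)} (h : IsSummand k L) {k' : ℕ}
    (hk : k + k' = n) : IsSummand k' (perp L) := by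
  have hL := h.1
  obtain ⟨π, hπ⟩ := exists_projection L
  let E : Matrix (Fin n) (Fin n) R := LinearMap.toMatrix' (L.subtype ∘ₗ π)
  have hE : ∀ v, E.mulVec v = π v := fun v => by rw [LinearMap.toMatrix'_mulVec]; rfl
  refine ⟨projective_quot_of_retraction _ (1 - E).vecMulLinear (fun q w hw => ?_)
    fun q hq => ?_, fun p => ?_⟩
  · rw [Matrix.vecMulLinear_apply, ← Matrix.dotProduct_mulVec, Matrix.sub_mulVec,
      Matrix.one_mulVec, hE]
    rw [show (π w : Fin n → R) = w from congrArg Subtype.val (hπ ⟨w, hw⟩), sub_self,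
      dotProduct_zero]
  · rw [Matrix.vecMulLinear_apply, Matrix.vecMul_sub, Matrix.vecMul_one, sub_eq_self]
    ext i
    rw [← dotProduct_single_one (Matrix.vecMul q E) i, ← Matrix.dotProduct_mulVec, hE]
    exact hq _ (π _).2
  · rw [Module.rankAtStalk_eq_of_equiv (perpEquiv L), rankAtStalk_dual]
    have := (isSummand_iff_rank_quot.1 h).2 p
    omega

end Perp

/-! ### The incidence ideal -/

section Incidence

variable {a m n : ℕ} {R S : CommAlgCat.{0} ℂ}

/-- The ideal generated by the values on a vector of the linear forms vanishing on a subspace. -/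
def incidenceIdeal {R : Type} [CommRing R] (L : Submodule R (Fin n → R)) (k : Fin n → R) :
    Ideal R :=
  (perp L).map ((dotProductBilin R R).flip k)

/-- The coordinates of `k - π k`, for a projection `π` onto `B`, are values at `k` of forms
vanishing on `B`. If they become zero, then `k` and `π k` have the same image. So the incidence
ideal cuts out the condition that `k` lies in the subspace. -/
theorem vmap_mem_map_iff (f : R ⟶ S) (B : (Gr a n).obj R) (k : Fin n → R) :
    vmap n f k ∈ Gr.toSubmodule ((Gr a n).map f B) ↔
      incidenceIdeal (Gr.toSubmodule B) k ≤ RingHom.ker f.hom := by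
  constructor
  · rintro h _ ⟨q, hq, rfl⟩
    have hq' : Annihilates q (Gr.toSubmodule B) := hq
    have := hq'.map f _ h
    rwa [vmap_dotProduct] at this
  · intro h
    obtain ⟨π, hπ⟩ := exists_projection (Gr.toSubmodule B)
    have : vmap n f k = vmap n f (π k) := by
      ext i
      rw [← sub_eq_zero, vmap_apply, vmap_apply, ← map_sub]
      let l : (Fin n → R) →ₗ[R] R := LinearMap.proj i ∘ₗ (LinearMap.id - (Gr.toSubmodule B).subtype ∘ₗ π)
      have hl : ∀ v, (LinearMap.toMatrix' (LinearMap.pi fun _ : Fin 1 => l)) 0 ⬝ᵥ v = l v :=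
        fun v => congrFun (LinearMap.toMatrix'_mulVec (LinearMap.pi fun _ : Fin 1 => l) v) 0
      refine h ⟨LinearMap.toMatrix' (LinearMap.pi fun _ : Fin 1 => l) 0, fun w hw => ?_, hl k⟩
      rw [hl]
      simp [l, show (π w : Fin n → R) = w from congrArg Subtype.val (hπ ⟨w, hw⟩)]
    rw [this]
    exact Gr.map_mem f B (π k).2

/-- Testing one ideal on the quotient by the other gives both inclusions. The Cartier condition can
thus be read on the incidence ideal. -/
theorem PreimageIsCutBy.unique {X : Space} {C : Subfunctor X} {x : X.obj R} {I J : Ideal R}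
    (hI : PreimageIsCutBy C x I) (hJ : PreimageIsCutBy C x J) : I = J := by
  have key : ∀ {I J : Ideal R}, PreimageIsCutBy C x I → PreimageIsCutBy C x J → J ≤ I := by
    intro I J hI hJ
    have h : ∀ I : Ideal R, RingHom.ker (residue R I).hom = I := fun I => Ideal.Quotient.mkₐ_ker ℂ I
    have := (hJ _ (residue R I)).1 ((hI _ (residue R I)).2 (h I).ge)
    rwa [h] at this
  exact le_antisymm (key hJ hI) (key hI hJ)

variable (s : Splitting m 1 n)

theorem Splitting.mem_containing_iff {B : (Gr a n).obj R} :
    B ∈ (Gr.containing a n s.ker).obj R ↔ cvec R (s.τ.col 0) ∈ Gr.toSubmodule B := by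
  rw [mem_containing]
  constructor
  · exact fun h => h (s.cvec_mem_ker 0)
  · intro h
    refine s.ker_act_P_le fun i => ?_
    rwa [Subsingleton.elim i 0]

theorem Splitting.preimageIsCutBy (B : (Gr a n).obj R) :
    PreimageIsCutBy (Gr.containing a n s.ker) B
      (incidenceIdeal (Gr.toSubmodule B) (cvec R (s.τ.col 0))) := fun S f => by
  rw [s.mem_containing_iff, ← vmap_mem_map_iff, vmap_cvec]

theorem Splitting.isCartierAt_iff {B : (Gr a n).obj R} :
    IsCartierAt (Gr.containing a n s.ker) B ↔
      Module.Invertible R (incidenceIdeal (Gr.toSubmodule B) (cvec R (s.τ.col 0))) := by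
  constructor
  · rintro ⟨I, hI, h⟩
    rwa [(s.preimageIsCutBy B).unique hI]
  · exact fun h => ⟨_, s.preimageIsCutBy B, h⟩

/-! ### The universal property of the blow-up -/

/-- Evaluation at `k` maps `B^⊥` onto the incidence ideal with kernel `(B + R k)^⊥`. An invertible
ideal is projective of rank 1, so the kernel is a summand of rank one less. `B + R k` itself need
not be a summand, hence the passage to annihilators. -/
theorem isSummand_perp_sup {R : Type} [CommRing R] {c : ℕ} {B : Submodule R (Fin n → R)}
    (hB : IsSummand a B) (k : Fin n → R) [Module.Invertible R (incidenceIdeal B k)]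
    (hc : a + 1 + c = n) : IsSummand c (perp (B ⊔ R ∙ k)) := by
  have hp : IsSummand (c + 1) (perp B) := hB.perp (by omega)
  have h1 := hp.1
  have h2 := finite_sub (perp B)
  have h3 := projective_sub (perp B)
  have hle : perp (B ⊔ R ∙ k) ≤ perp B := perp_anti le_sup_left
  let e := ((dotProductBilin R R).flip k).submoduleMap (perp B)
  have he : LinearMap.ker e = (perp (B ⊔ R ∙ k)).comap (perp B).subtype := by
    ext ⟨q, hq⟩
    rw [LinearMap.mem_ker, Submodule.mem_comap, ← Subtype.val_inj]
    constructor
    · intro h w hw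
      obtain ⟨b, hb, y, hy, rfl⟩ := Submodule.mem_sup.1 hw
      obtain ⟨c, rfl⟩ := Submodule.mem_span_singleton.1 hy
      have h : q ⬝ᵥ k = 0 := h
      simp [hq b hb, h]
    · exact fun h => h k (Submodule.mem_sup_right (Submodule.mem_span_singleton_self k))
  let E : (perp B ⧸ (perp (B ⊔ R ∙ k)).comap (perp B).subtype) ≃ₗ[R] incidenceIdeal B k :=
    (Submodule.quotEquivOfEq _ _ he.symm).trans
      (e.quotKerEquivOfSurjective (LinearMap.submoduleMap_surjective _ _))
  have h4 : Module.Projective R (perp B ⧸ (perp (B ⊔ R ∙ k)).comap (perp B).subtype) :=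
    Module.Projective.of_equiv E.symm
  refine ⟨projective_quot_trans hle, fun p => ?_⟩
  have h5 := rank_add_rank_quot ((perp (B ⊔ R ∙ k)).comap (perp B).subtype) p
  rw [Module.rankAtStalk_eq_of_equiv (Submodule.comapSubtypeEquivOfLe hle),
    Module.rankAtStalk_eq_of_equiv E,
    rankAtStalk_invertible (M := incidenceIdeal B k), hp.2] at h5
  omega

/-- The saturation `(B + R k)^⊥⊥` is a summand of rank `a + 1` containing `ker P`, so it is `P⁻¹(A)`
for some `A`. For any other solution `A'`, the summand `P⁻¹(A')` contains `B + R k` and equals its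
double annihilator. It therefore contains the saturation, and equality of ranks gives uniqueness. -/
theorem Splitting.existsUnique_of_isCartierAt (ham : a ≤ m) (hmn : m + 1 = n) (B : (Gr a n).obj R)
    (hB : IsCartierAt (Gr.containing a n s.ker) B) :
    ∃! y, (sndOn (VectorBundle.zeroLocus (boxSec a m a n s.P))).app R y = B := by
  have := s.isCartierAt_iff.1 hB
  let k := cvec R (s.τ.col 0)
  have hc : a + 1 + m = a + n := by omega
  have hC : IsSummand (a + 1) (perp (perp (Gr.toSubmodule B ⊔ R ∙ k))) :=
    (isSummand_perp_sup (c := n - (a + 1)) (Gr.isSummand B) k (by omega)).perp (by omega)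
  have hle := le_perp_perp (Gr.toSubmodule B ⊔ R ∙ k)
  have hker : LinearMap.ker (act R s.P) ≤ perp (perp (Gr.toSubmodule B ⊔ R ∙ k)) :=
    s.ker_act_P_le fun i => hle (by
      rw [Subsingleton.elim i 0]
      exact Submodule.mem_sup_right (Submodule.mem_span_singleton_self k))
  obtain ⟨A, hA⟩ := s.exists_comapPt_eq hc (Gr.mk _ hC) hker
  have hA' : Gr.toSubmodule B ≤ Gr.toSubmodule (s.comapPt hc A) := by
    rw [hA]
    exact le_sup_left.trans hle
  refine ⟨⟨(A, B), mem_zeroLocus_boxSec.2 hA'⟩, rfl, ?_⟩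
  rintro ⟨⟨A', B'⟩, h⟩ hB'
  obtain rfl : B' = B := hB'
  have h := mem_zeroLocus_boxSec.1 h
  refine Subtype.ext (Prod.ext ?_ rfl)
  refine s.comapPt_injective hc ?_
  rw [hA]
  refine (Gr.ext_of_le ?_).symm
  rw [← (Gr.isSummand (s.comapPt hc A')).perp_perp]
  refine perp_anti (perp_anti (sup_le h ?_))
  rw [Submodule.span_singleton_le_iff_mem]
  exact s.ker_le_comapPt hc A' (s.cvec_mem_ker 0)

end Incidence

/-! ### Affine charts -/

section Charts

variable {R S : CommAlgCat.{0} ℂ} {a c m n : ℕ}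

/-- A complex matrix as a matrix over an algebra. -/
def cmat (R : CommAlgCat.{0} ℂ) (P : Matrix (Fin m) (Fin n) ℂ) : Matrix (Fin m) (Fin n) R :=
  P.map (algebraMap ℂ R)

theorem cmat_mul {l : ℕ} (P : Matrix (Fin m) (Fin n) ℂ) (Q : Matrix (Fin n) (Fin l) ℂ) :
    cmat R (P * Q) = cmat R P * cmat R Q := Matrix.map_mul

theorem cmat_add (P Q : Matrix (Fin m) (Fin n) ℂ) :
    cmat R (P + Q) = cmat R P + cmat R Q := Matrix.map_add _ (map_add _) _ _

theorem cmat_one : cmat R (1 : Matrix (Fin n) (Fin n) ℂ) = 1 :=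
  Matrix.map_one _ (map_zero _) (map_one _)

theorem cmat_zero : cmat R (0 : Matrix (Fin m) (Fin n) ℂ) = 0 :=
  Matrix.map_zero _ (map_zero _)

theorem cmat_map (f : R ⟶ S) (P : Matrix (Fin m) (Fin n) ℂ) :
    (cmat R P).map f.hom = cmat S P := by
  ext i j
  exact f.hom.commutes _

theorem mul_map {l : ℕ} (f : R ⟶ S) (M : Matrix (Fin m) (Fin n) R) (N : Matrix (Fin n) (Fin l) R) :
    (M * N).map f.hom = M.map f.hom * N.map f.hom := Matrix.map_mul

theorem cmat_mulVec (P : Matrix (Fin m) (Fin n) ℂ) (v : Fin n → R) :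
    (cmat R P).mulVec v = act R P v := rfl

theorem framePt_congr {M M' : Matrix (Fin n) (Fin a) R} {L L' : Matrix (Fin a) (Fin n) R}
    {h : L * M = 1} {h' : L' * M' = 1} (e : M = M') : framePt M L h = framePt M' L' h' := by
  subst e
  exact Gr.ext rfl

/-- A common left inverse `L` normalises the frame: if `M' u` is a column of `M`, applying `L`
determines `u`. -/
theorem framePt_injective {M M' : Matrix (Fin n) (Fin a) R} {L : Matrix (Fin a) (Fin n) R}
    {h : L * M = 1} {h' : L * M' = 1} (e : framePt M L h = framePt M' L h') : M = M' := by
  refine Matrix.ext_of_mulVec_single fun j => ?_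
  have h1 : M.mulVec (Pi.single j 1) ∈ Gr.toSubmodule (framePt M' L h') := e ▸ ⟨_, rfl⟩
  obtain ⟨u, hu⟩ := h1
  have hu : M'.mulVec u = M.mulVec (Pi.single j 1) := hu
  have h2 := congrArg L.mulVec hu
  rw [Matrix.mulVec_mulVec, Matrix.mulVec_mulVec, h, h', Matrix.one_mulVec, Matrix.one_mulVec] at h2
  rw [← hu, h2]

/-- The image of `B` in `R^a` is a summand of rank `a`, hence everything. Preimages in `B` of the
standard basis form a frame with left inverse `Q`. -/
theorem exists_framePt_of_mem_injOn {Q : Matrix (Fin a) (Fin n) ℂ} {B : (Gr a n).obj R}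
    (hB : B ∈ (Gr.injOn a Q).obj R) : ∃ M h, B = framePt M (cmat R Q) h := by
  have h1 : (Gr.toSubmodule B).map (act R Q) = ⊤ :=
    (isSummand_map_act hB).eq_of_le isSummand_top le_top
  have h2 : ∀ j : Fin a, ∃ v ∈ Gr.toSubmodule B, act R Q v = Pi.single j 1 := fun j => by
    have : Pi.single j 1 ∈ (Gr.toSubmodule B).map (act R Q) := h1 ▸ Submodule.mem_top
    exact this
  choose v hv hv' using h2
  let M : Matrix (Fin n) (Fin a) R := Matrix.of fun i j => v j i
  have hM : ∀ u, M.mulVec u = ∑ j, u j • v j := fun u => by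
    ext i
    simp [M, Matrix.mulVec, dotProduct, Finset.sum_apply, mul_comm]
  have h3 : cmat R Q * M = 1 := by
    refine Matrix.ext_of_mulVec_single fun j => ?_
    rw [← Matrix.mulVec_mulVec, hM, Matrix.one_mulVec, ← hv' j, cmat_mulVec]
    congr 1
    rw [Finset.sum_eq_single j (fun i _ hi => by rw [hv' j, Pi.single_eq_of_ne hi, zero_smul])
      (by simp), hv' j, Pi.single_eq_same, one_smul]
  refine ⟨M, h3, (Gr.ext_of_le ?_).symm⟩
  rintro _ ⟨u, rfl⟩
  rw [Matrix.mulVecLin_apply, hM]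
  exact sum_mem fun j _ => Submodule.smul_mem _ _ (hv j)

/-- Over a field, every subspace projects isomorphically under some coordinate projection. -/
theorem exists_splitting_injOn {F : Type} [Field F] [Algebra ℂ F] (hc : a + c = m)
    (A : (Gr a m).obj (CommAlgCat.of ℂ F)) :
    ∃ t : Splitting a c m, A ∈ (Gr.injOn a t.P).obj (CommAlgCat.of ℂ F) := by
  have h1 : minorIdeal (1 : Matrix (Fin m) (Fin m) ℂ) A = ⊤ :=
    Gr.mem_injOn_iff_minorIdeal.1 ⟨1, fun v _ => by rw [act_one, Matrix.one_mulVec]⟩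
  obtain ⟨r, v, hv, h2⟩ : ∃ (r : Fin a → Fin m) (v : Fin a → Fin m → F),
      (∀ j, v j ∈ Gr.toSubmodule A) ∧ minor (CommAlgCat.of ℂ F) 1 r v ≠ 0 := by
    by_contra! h
    have : minorIdeal (1 : Matrix (Fin m) (Fin m) ℂ) A ≤ ⊥ := by
      refine Ideal.span_le.2 ?_
      rintro _ ⟨r, v, hv, rfl⟩
      exact h r v hv
    rw [h1] at this
    exact bot_ne_top (α := Ideal F) (top_le_iff.1 this).symm.symm
  -- A repeated index would give the nonzero minor two equal columns. Injectivity makes the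
  -- selection of the rows `r` a surjection, with its transpose as right inverse.
  have hr : Function.Injective r := fun i j hij => by
    by_contra hne
    refine h2 ((minor_apply _ _ _).trans (Matrix.det_zero_of_column_eq hne fun x => ?_))
    simp only [Matrix.of_apply, hij]
  have h3 : (1 : Matrix (Fin m) (Fin m) ℂ).submatrix r id *
      (1 : Matrix (Fin m) (Fin m) ℂ).submatrix id r = 1 := by
    ext i j
    simp [Matrix.mul_apply, Matrix.one_apply, hr.eq_iff]
  obtain ⟨t, ht, -⟩ := exists_splitting hc h3
  refine ⟨t, Gr.mem_injOn_iff_minorIdeal.2 ?_⟩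
  have h4 : minor (CommAlgCat.of ℂ F) t.P id v = minor (CommAlgCat.of ℂ F) 1 r v := by
    rw [minor_apply, minor_apply]
    refine congrArg Matrix.det (Matrix.ext fun i j => ?_)
    rw [Matrix.of_apply, Matrix.of_apply, ht, act_one]
    refine (act_apply (CommAlgCat.of ℂ F) _ (v i) j).trans ?_
    simp [Matrix.one_apply]
  exact Ideal.eq_top_of_isUnit_mem (α := F) _ (minor_mem id hv) (h4 ▸ Ne.isUnit h2)

/-- The graph of a matrix with respect to a splitting. -/
def Splitting.frame (t : Splitting a c m) (γ : Matrix (Fin c) (Fin a) R) :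
    Matrix (Fin m) (Fin a) R :=
  cmat R t.σ + cmat R t.τ * γ

section

variable (t : Splitting a c m)

theorem Splitting.P_mul_frame (γ : Matrix (Fin c) (Fin a) R) : cmat R t.P * t.frame γ = 1 := by
  rw [frame, Matrix.mul_add, ← Matrix.mul_assoc, ← cmat_mul, ← cmat_mul, t.P_mul_σ, t.P_mul_τ,
    cmat_one, cmat_zero, Matrix.zero_mul, add_zero]

theorem Splitting.ρ_mul_frame (γ : Matrix (Fin c) (Fin a) R) : cmat R t.ρ * t.frame γ = γ := by
  rw [frame, Matrix.mul_add, ← Matrix.mul_assoc, ← cmat_mul, ← cmat_mul, t.ρ_mul_σ, t.ρ_mul_τ,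
    cmat_one, cmat_zero, Matrix.one_mul, zero_add]

theorem Splitting.frame_injective : Function.Injective (t.frame (R := R)) := fun γ γ' h => by
  rw [← t.ρ_mul_frame γ, h, t.ρ_mul_frame]

theorem Splitting.frame_ρ_mul {M : Matrix (Fin m) (Fin a) R} (h : cmat R t.P * M = 1) :
    t.frame (cmat R t.ρ * M) = M := by
  have h1 : cmat R t.σ * cmat R t.P + cmat R t.τ * cmat R t.ρ = 1 := by
    rw [← cmat_mul, ← cmat_mul, ← cmat_add, t.add_eq_one, cmat_one]
  have h2 := congrArg (· * M) h1
  simp only [Matrix.add_mul, Matrix.mul_assoc, h, Matrix.mul_one, Matrix.one_mul] at h2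
  exact h2

theorem Splitting.frame_map (f : R ⟶ S) (γ : Matrix (Fin c) (Fin a) R) :
    (t.frame γ).map f.hom = t.frame (γ.map f.hom) := by
  rw [frame, Matrix.map_add _ (map_add _), mul_map, cmat_map, cmat_map]
  rfl

end

/-! ### Charts of the zero locus by pairs of graphs -/

variable (s : Splitting m 1 n) (t : Splitting a c m) (t' : Splitting a 1 (a + 1))

/-- Complex coordinates on the preimage of a graph. -/
def chartCoord : Matrix (Fin (a + 1)) (Fin n) ℂ :=
  (Matrix.fromRows (t.P * s.P) s.ρ).submatrix finSumFinEquiv.symm id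

/-- A frame of the preimage of a graph. -/
def chartEmb (γ : Matrix (Fin c) (Fin a) R) : Matrix (Fin n) (Fin (a + 1)) R :=
  (Matrix.fromCols (cmat R s.σ * t.frame γ) (cmat R s.τ)).submatrix id finSumFinEquiv.symm

theorem cmat_chartCoord : cmat R (chartCoord s t) =
    (Matrix.fromRows (cmat R (t.P * s.P)) (cmat R s.ρ)).submatrix finSumFinEquiv.symm id := by
  ext i j
  obtain ⟨i, rfl⟩ := finSumFinEquiv.surjective i
  rcases i with i | i <;> simp [chartCoord, cmat, -Matrix.map_mul]

/-- The four blocks follow from the relations of the two splittings. The coordinates on `P⁻¹(A)` are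
complex and do not involve `γ`, although the embedding does. -/
theorem chartCoord_mul_chartEmb (γ : Matrix (Fin c) (Fin a) R) :
    cmat R (chartCoord s t) * chartEmb s t γ = 1 := by
  rw [cmat_chartCoord, chartEmb, ← Matrix.submatrix_mul _ _ _ _ _ Function.bijective_id,
    Matrix.fromRows_mul_fromCols]
  have h1 : cmat R (t.P * s.P) * (cmat R s.σ * t.frame γ) = 1 := by
    rw [← Matrix.mul_assoc, ← cmat_mul, Matrix.mul_assoc, s.P_mul_σ, Matrix.mul_one, t.P_mul_frame]
  have h2 : cmat R (t.P * s.P) * cmat R s.τ = 0 := by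
    rw [← cmat_mul, Matrix.mul_assoc, s.P_mul_τ, Matrix.mul_zero, cmat_zero]
  have h3 : cmat R s.ρ * (cmat R s.σ * t.frame γ) = 0 := by
    rw [← Matrix.mul_assoc, ← cmat_mul, s.ρ_mul_σ, cmat_zero, Matrix.zero_mul]
  have h4 : cmat R s.ρ * cmat R s.τ = 1 := by
    rw [← cmat_mul, s.ρ_mul_τ, cmat_one]
  rw [h1, h2, h3, h4, Matrix.fromBlocks_one, Matrix.submatrix_one_equiv]

theorem chartEmb_mul_chartCoord (γ : Matrix (Fin c) (Fin a) R) :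
    chartEmb s t γ * cmat R (chartCoord s t) =
      cmat R s.σ * t.frame γ * cmat R (t.P * s.P) + cmat R s.τ * cmat R s.ρ := by
  rw [cmat_chartCoord, chartEmb, Matrix.submatrix_mul_equiv, Matrix.fromCols_mul_fromRows,
    Matrix.submatrix_id_id]

theorem exists_P_mul_chartEmb (γ : Matrix (Fin c) (Fin a) R) :
    ∃ J : Matrix (Fin a) (Fin (a + 1)) R, cmat R s.P * chartEmb s t γ = t.frame γ * J := by
  refine ⟨((Matrix.fromCols (1 : Matrix (Fin a) (Fin a) R)
    (0 : Matrix (Fin a) (Fin 1) R)).submatrix id finSumFinEquiv.symm :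
      Matrix (Fin a) (Fin (a + 1)) R), ?_⟩
  have h1 : cmat R s.P * chartEmb s t γ =
      (cmat R s.P * Matrix.fromCols (cmat R s.σ * t.frame γ) (cmat R s.τ)).submatrix id
        finSumFinEquiv.symm := rfl
  have h2 : Matrix.fromCols (t.frame γ) (0 : Matrix (Fin m) (Fin 1) R) =
      t.frame γ * (Matrix.fromCols (1 : Matrix (Fin a) (Fin a) R) (0 : Matrix (Fin a) (Fin 1) R) :
        Matrix (Fin a) (Fin a ⊕ Fin 1) R) := by
    rw [Matrix.mul_fromCols, Matrix.mul_one, Matrix.mul_zero]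
  rw [h1, Matrix.mul_fromCols, ← Matrix.mul_assoc, ← cmat_mul, ← cmat_mul,
    s.P_mul_σ, s.P_mul_τ, cmat_one, cmat_zero, Matrix.one_mul, h2]
  rfl

theorem chartEmb_map (f : R ⟶ S) (γ : Matrix (Fin c) (Fin a) R) :
    (chartEmb s t γ).map f.hom = chartEmb s t (γ.map f.hom) := by
  rw [chartEmb, chartEmb, ← t.frame_map, ← cmat_map f s.σ, ← cmat_map f s.τ, ← mul_map]
  ext i j
  obtain ⟨j, rfl⟩ := finSumFinEquiv.surjective j
  rcases j with j | j <;> simp [-Matrix.map_mul]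

/-- The product of embedding and coordinates is `σ (α t.P) P + τ ρ`, where `α` is the frame of the
graph. Since `α t.P` is the identity on the graph, this is `σ P + τ ρ = 1` on its preimage. -/
theorem chartEmb_mulVec_chartCoord {γ : Matrix (Fin c) (Fin a) R} {v : Fin n → R}
    (hv : ∃ u, (t.frame γ).mulVec u = act R s.P v) :
    (chartEmb s t γ).mulVec ((cmat R (chartCoord s t)).mulVec v) = v := by
  obtain ⟨u, hu⟩ := hv
  rw [Matrix.mulVec_mulVec, chartEmb_mul_chartCoord, Matrix.add_mulVec, cmat_mul,
    ← Matrix.mulVec_mulVec, ← Matrix.mulVec_mulVec, ← Matrix.mulVec_mulVec, ← Matrix.mulVec_mulVec,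
    cmat_mulVec s.P, ← hu, Matrix.mulVec_mulVec u (cmat R t.P), t.P_mul_frame, Matrix.one_mulVec, hu]
  exact s.act_add_eq R v

theorem chart_left_inverse (γ : Matrix (Fin c) (Fin a) R) (y : Matrix (Fin 1) (Fin a) R) :
    cmat R (t'.P * chartCoord s t) * (chartEmb s t γ * t'.frame y) = 1 := by
  rw [cmat_mul, Matrix.mul_assoc, ← Matrix.mul_assoc (cmat R (chartCoord s t)),
    chartCoord_mul_chartEmb, Matrix.one_mul, t'.P_mul_frame]

/-- The point of the first Grassmannian in a chart of the zero locus. -/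
def chartFst (γ : Matrix (Fin c) (Fin a) R) : (Gr a m).obj R :=
  framePt (t.frame γ) (cmat R t.P) (t.P_mul_frame γ)

/-- The point of the second Grassmannian in a chart of the zero locus. -/
def chartSnd (γ : Matrix (Fin c) (Fin a) R) (y : Matrix (Fin 1) (Fin a) R) : (Gr a n).obj R :=
  framePt (chartEmb s t γ * t'.frame y) (cmat R (t'.P * chartCoord s t))
    (chart_left_inverse s t t' γ y)

/-- The point of the zero locus with given coordinates in a chart. -/
def chartPt (γ : Matrix (Fin c) (Fin a) R) (y : Matrix (Fin 1) (Fin a) R) :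
    (VectorBundle.zeroLocus (boxSec a m a n s.P)).toFunctor.obj R :=
  ⟨(chartFst t γ, chartSnd s t t' γ y), mem_zeroLocus_boxSec.2 (by
    rintro _ ⟨u, rfl⟩
    obtain ⟨J, hJ⟩ := exists_P_mul_chartEmb s t γ
    refine ⟨J.mulVec ((t'.frame y).mulVec u), ?_⟩
    rw [Matrix.mulVecLin_apply, Matrix.mulVecLin_apply, Matrix.mulVec_mulVec, ← hJ, ← cmat_mulVec,
      Matrix.mulVec_mulVec, Matrix.mulVec_mulVec, Matrix.mul_assoc])⟩

theorem chartPt_map (f : R ⟶ S) (γ : Matrix (Fin c) (Fin a) R) (y : Matrix (Fin 1) (Fin a) R) :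
    (VectorBundle.zeroLocus (boxSec a m a n s.P)).toFunctor.map f (chartPt s t t' γ y) =
      chartPt s t t' (γ.map f.hom) (y.map f.hom) := by
  refine Subtype.ext (Prod.ext ?_ ?_)
  · exact framePt_map_eq f (t.P_mul_frame γ) (t.P_mul_frame _) (t.frame_map f γ)
  · refine framePt_map_eq f (chart_left_inverse s t t' γ y) (chart_left_inverse s t t' _ _) ?_
    rw [mul_map, chartEmb_map, t'.frame_map]

theorem chartPt_injective {γ γ' : Matrix (Fin c) (Fin a) R} {y y' : Matrix (Fin 1) (Fin a) R}
    (h : chartPt s t t' γ y = chartPt s t t' γ' y') : γ = γ' ∧ y = y' := by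
  have h := congrArg Subtype.val h
  obtain rfl : γ = γ' := t.frame_injective (framePt_injective (h := t.P_mul_frame γ)
    (h' := t.P_mul_frame γ') (congrArg Prod.fst h))
  refine ⟨rfl, t'.frame_injective ?_⟩
  have h2 := congrArg (cmat R (chartCoord s t) * ·) (framePt_injective
    (h := chart_left_inverse s t t' γ y) (h' := chart_left_inverse s t t' γ y')
    (congrArg Prod.snd h))
  simpa only [← Matrix.mul_assoc, chartCoord_mul_chartEmb, Matrix.one_mul] using h2

/-- The image of a chart. -/
def chartImage : Subfunctor (VectorBundle.zeroLocus (boxSec a m a n s.P)).toFunctor :=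
  (Gr.injOn a t.P).preimage (fstOn _) ⊓ (Gr.injOn a (t'.P * chartCoord s t)).preimage (sndOn _)

theorem isOpenSub_chartImage : IsOpenSub (chartImage s t t') :=
  ((Gr.isOpenSub_injOn a _).preimage _).inf ((Gr.isOpenSub_injOn a _).preimage _)

theorem chartPt_mem (γ : Matrix (Fin c) (Fin a) R) (y : Matrix (Fin 1) (Fin a) R) :
    chartPt s t t' γ y ∈ (chartImage s t t').obj R :=
  ⟨Gr.mem_injOn_framePt (h := t.P_mul_frame γ) (W := 1) ((Matrix.one_mul _).trans (t.P_mul_frame γ)),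
    Gr.mem_injOn_framePt (h := chart_left_inverse s t t' γ y) (W := 1)
      ((Matrix.one_mul _).trans (chart_left_inverse s t t' γ y))⟩

theorem exists_chartPt_eq {z : (VectorBundle.zeroLocus (boxSec a m a n s.P)).toFunctor.obj R}
    (hz : z ∈ (chartImage s t t').obj R) : ∃ γ y, chartPt s t t' γ y = z := by
  obtain ⟨⟨A, B⟩, h⟩ := z
  have h := mem_zeroLocus_boxSec.1 h
  obtain ⟨M, hM, rfl⟩ := exists_framePt_of_mem_injOn hz.1
  obtain ⟨N, hN, rfl⟩ := exists_framePt_of_mem_injOn hz.2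
  have hM' := t.frame_ρ_mul hM
  have hN' : cmat R t'.P * (cmat R (chartCoord s t) * N) = 1 := by
    rw [← Matrix.mul_assoc, ← cmat_mul, hN]
  refine ⟨cmat R t.ρ * M, cmat R t'.ρ * (cmat R (chartCoord s t) * N),
    Subtype.ext (Prod.ext (framePt_congr (h := t.P_mul_frame _) (h' := hM) hM')
      (framePt_congr (h := chart_left_inverse s t t' _ _) (h' := hN) ?_))⟩
  rw [t'.frame_ρ_mul hN']
  refine Matrix.ext_of_mulVec_single fun j => ?_
  rw [← Matrix.mulVec_mulVec, ← Matrix.mulVec_mulVec]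
  refine chartEmb_mulVec_chartCoord s t ?_
  rw [hM']
  exact h _ ⟨_, rfl⟩

/-- Choose a big cell containing `A`. The coordinates then identify `P⁻¹(A)` with `F^(a+1)` and `B`
with a hyperplane there, for which a second big cell is chosen. -/
theorem exists_mem_chartImage {F : Type} [Field F] [Algebra ℂ F] (hc : a + c = m)
    (z : (VectorBundle.zeroLocus (boxSec a m a n s.P)).toFunctor.obj (CommAlgCat.of ℂ F)) :
    ∃ (t : Splitting a c m) (t' : Splitting a 1 (a + 1)),
      z ∈ (chartImage s t t').obj (CommAlgCat.of ℂ F) := by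
  obtain ⟨⟨A, B⟩, h⟩ := z
  have h := mem_zeroLocus_boxSec.1 h
  obtain ⟨t, ht⟩ := exists_splitting_injOn hc A
  obtain ⟨M, hM, rfl⟩ := exists_framePt_of_mem_injOn ht
  have hM' := t.frame_ρ_mul hM
  let γ := cmat (CommAlgCat.of ℂ F) t.ρ * M
  have key : ∀ v ∈ Gr.toSubmodule B, (chartEmb s t γ).mulVec
      ((cmat (CommAlgCat.of ℂ F) (chartCoord s t)).mulVec v) = v := fun v hv =>
    chartEmb_mulVec_chartCoord s t (by rw [hM']; exact h v hv)
  have hB := (Gr.isSummand B).comap (chartEmb s t γ).mulVecLin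
    (cmat (CommAlgCat.of ℂ F) (chartCoord s t)).mulVecLin
    (fun v => by
      rw [Matrix.mulVecLin_apply, Matrix.mulVecLin_apply, Matrix.mulVec_mulVec,
        chartCoord_mul_chartEmb, Matrix.one_mulVec])
    (fun v hv => ⟨_, key v hv⟩)
  obtain ⟨t', G, hG⟩ := exists_splitting_injOn (c := 1) rfl (Gr.mk _ hB)
  refine ⟨t, t', ht, chartEmb s t γ * G, fun v hv => ?_⟩
  have h1 : (cmat (CommAlgCat.of ℂ F) (chartCoord s t)).mulVec v ∈
      Gr.toSubmodule (Gr.mk (R := CommAlgCat.of ℂ F) _ hB) := by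
    show (chartEmb s t γ).mulVec _ ∈ Gr.toSubmodule B
    rw [key v hv]
    exact hv
  have h2 := hG _ h1
  rw [act_mul, ← Matrix.mulVec_mulVec]
  exact (congrArg (chartEmb s t γ).mulVec h2).trans (key v hv)

end Charts

/-! ### The zero locus as a blow-up -/

section BlowUp

variable {R S : CommAlgCat.{0} ℂ} {a c m n : ℕ}
  (s : Splitting m 1 n) (t : Splitting a c m) (t' : Splitting a 1 (a + 1))

/-- The coordinate ring of a chart. -/
def chartRing (a c : ℕ) : CommAlgCat.{0} ℂ :=
  CommAlgCat.of ℂ (MvPolynomial ((Fin c × Fin a) ⊕ (Fin 1 × Fin a)) ℂ)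

/-- The first set of coordinates. -/
def chartγ (a c : ℕ) : Matrix (Fin c) (Fin a) (chartRing a c) :=
  Matrix.of fun i j => (MvPolynomial.X (Sum.inl (i, j)) : MvPolynomial _ ℂ)

/-- The second set of coordinates. -/
def chartY (a c : ℕ) : Matrix (Fin 1) (Fin a) (chartRing a c) :=
  Matrix.of fun i j => (MvPolynomial.X (Sum.inr (i, j)) : MvPolynomial _ ℂ)

/-- The morphism with given coordinates. -/
def chartMap (γ : Matrix (Fin c) (Fin a) R) (y : Matrix (Fin 1) (Fin a) R) : chartRing a c ⟶ R :=
  CommAlgCat.ofHom (MvPolynomial.aeval (Sum.elim (fun x => γ x.1 x.2) fun x => y x.1 x.2))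

theorem chartγ_map (γ : Matrix (Fin c) (Fin a) R) (y : Matrix (Fin 1) (Fin a) R) :
    (chartγ a c).map (chartMap γ y).hom = γ :=
  Matrix.ext fun _ _ => MvPolynomial.aeval_X _ _

theorem chartY_map (γ : Matrix (Fin c) (Fin a) R) (y : Matrix (Fin 1) (Fin a) R) :
    (chartY a c).map (chartMap γ y).hom = y :=
  Matrix.ext fun _ _ => MvPolynomial.aeval_X _ _

theorem chartRing_hom_ext {f g : chartRing a c ⟶ S}
    (h : (chartγ a c).map f.hom = (chartγ a c).map g.hom)
    (h' : (chartY a c).map f.hom = (chartY a c).map g.hom) : f = g := by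
  refine CommAlgCat.hom_ext (MvPolynomial.algHom_ext fun x => ?_)
  rcases x with ⟨i, j⟩ | ⟨i, j⟩
  · exact congrFun (congrFun h i) j
  · exact congrFun (congrFun h' i) j

/-- The universal point of a chart. -/
def univPt : (VectorBundle.zeroLocus (boxSec a m a n s.P)).toFunctor.obj (chartRing a c) :=
  chartPt s t t' (chartγ a c) (chartY a c)

theorem univPt_map_chartMap (γ : Matrix (Fin c) (Fin a) R) (y : Matrix (Fin 1) (Fin a) R) :
    (VectorBundle.zeroLocus (boxSec a m a n s.P)).toFunctor.map (chartMap γ y) (univPt s t t') =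
      chartPt s t t' γ y := by
  rw [univPt, chartPt_map, chartγ_map, chartY_map]

theorem exists_univPt_map_eq {z : (VectorBundle.zeroLocus (boxSec a m a n s.P)).toFunctor.obj R}
    (hz : z ∈ (chartImage s t t').obj R) : ∃ f : chartRing a c ⟶ R,
      (VectorBundle.zeroLocus (boxSec a m a n s.P)).toFunctor.map f (univPt s t t') = z := by
  obtain ⟨γ, y, h⟩ := exists_chartPt_eq s t t' hz
  exact ⟨chartMap γ y, (univPt_map_chartMap s t t' γ y).trans h⟩

theorem isAffineChart_univPt : IsAffineChart (univPt s t t') := by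
  refine ⟨fun S f g h => ?_, chartImage s t t', isOpenSub_chartImage s t t', fun S => ?_⟩
  · rw [univPt, chartPt_map, chartPt_map] at h
    obtain ⟨h₁, h₂⟩ := chartPt_injective s t t' h
    exact chartRing_hom_ext h₁ h₂
  · ext z
    constructor
    · exact fun hz => exists_univPt_map_eq s t t' hz
    · rintro ⟨f, rfl⟩
      rw [univPt, chartPt_map]
      exact chartPt_mem s t t' _ _

/-- The coordinates of the generator of the kernel. -/
def kerCoord : Fin (a + 1) → ℂ := (chartCoord s t).mulVec (s.τ.col 0)

/-- The last coordinate is `ρ τ = 1`. -/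
theorem kerCoord_ne_zero : kerCoord s t ≠ 0 := by
  intro h
  have h1 := congrFun h (finSumFinEquiv (Sum.inr 0))
  have h2 : kerCoord s t (finSumFinEquiv (Sum.inr 0)) = (s.ρ * s.τ) 0 0 := by
    simp only [kerCoord, chartCoord, Matrix.mulVec, Matrix.mul_apply, dotProduct,
      Matrix.submatrix_apply, Equiv.symm_apply_apply, Matrix.fromRows_apply_inr]
    rfl
  rw [h2, s.ρ_mul_τ] at h1
  simp at h1

theorem chartEmb_mulVec_kerCoord (γ : Matrix (Fin c) (Fin a) R) :
    (chartEmb s t γ).mulVec (cvec R (kerCoord s t)) = cvec R (s.τ.col 0) := by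
  rw [kerCoord, ← act_cvec]
  refine chartEmb_mulVec_chartCoord s t ⟨0, ?_⟩
  rw [Matrix.mulVec_zero]
  exact (s.cvec_mem_ker 0).symm

/-- The equation of the exceptional divisor in a chart. -/
def chartEqn (y : Matrix (Fin 1) (Fin a) R) : R :=
  cvec R (t'.ρ.mulVec (kerCoord s t)) 0 - y.mulVec (cvec R (t'.P.mulVec (kerCoord s t))) 0

/-- Decompose along the graph of `y` and the complementary direction `τ`. The coefficient of the
latter, which obstructs membership in the graph, is the equation. -/
theorem cvec_kerCoord (y : Matrix (Fin 1) (Fin a) R) :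
    cvec R (kerCoord s t) = (t'.frame y).mulVec (cvec R (t'.P.mulVec (kerCoord s t))) +
      chartEqn s t t' y • (cmat R t'.τ).mulVec (Pi.single 0 1) := by
  have h1 : chartEqn s t t' y • (cmat R t'.τ).mulVec (Pi.single 0 1) =
      (cmat R t'.τ).mulVec (cvec R (t'.ρ.mulVec (kerCoord s t)) -
        y.mulVec (cvec R (t'.P.mulVec (kerCoord s t)))) := by
    rw [← Matrix.mulVec_smul]
    congr 1
    ext i
    rw [Subsingleton.elim i 0]
    simp [chartEqn]
  rw [h1, Matrix.mulVec_sub, Splitting.frame, Matrix.add_mulVec, ← Matrix.mulVec_mulVec,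
    ← act_cvec, ← act_cvec, cmat_mulVec, cmat_mulVec, add_assoc, add_sub_cancel]
  exact (t'.act_add_eq R _).symm

/-- A form vanishing on `B` kills the graph component of the generator of the kernel, so its value
is a multiple of the equation. The form `ρ' - y P'` in the chart coordinates vanishes on `B` and
attains the equation itself. -/
theorem incidenceIdeal_chartSnd (γ : Matrix (Fin c) (Fin a) R) (y : Matrix (Fin 1) (Fin a) R) :
    incidenceIdeal (Gr.toSubmodule (chartSnd s t t' γ y)) (cvec R (s.τ.col 0)) =
      Ideal.span {chartEqn s t t' y} := by
  have hk := chartEmb_mulVec_kerCoord s t γ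
  apply le_antisymm
  · rintro _ ⟨q, hq, rfl⟩
    rw [Ideal.mem_span_singleton']
    have h1 : q ⬝ᵥ (chartEmb s t γ).mulVec
        ((t'.frame y).mulVec (cvec R (t'.P.mulVec (kerCoord s t)))) = 0 :=
      hq _ ⟨cvec R (t'.P.mulVec (kerCoord s t)), by
        rw [Matrix.mulVecLin_apply, Matrix.mulVec_mulVec]⟩
    refine ⟨q ⬝ᵥ (chartEmb s t γ).mulVec ((cmat R t'.τ).mulVec (Pi.single 0 1)), ?_⟩
    rw [LinearMap.flip_apply, dotProductBilin_apply_apply, ← hk, cvec_kerCoord s t t' y,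
      Matrix.mulVec_add, Matrix.mulVec_smul, dotProduct_add, h1, dotProduct_smul, zero_add,
      smul_eq_mul, mul_comm]
  · rw [Ideal.span_singleton_le_iff_mem]
    let r : Matrix (Fin 1) (Fin (a + 1)) R := cmat R t'.ρ - y * cmat R t'.P
    have hr : r * t'.frame y = 0 := by
      rw [Matrix.sub_mul, Matrix.mul_assoc, t'.ρ_mul_frame, t'.P_mul_frame, Matrix.mul_one, sub_self]
    have hq : ∀ w, Matrix.vecMul (r 0) (cmat R (chartCoord s t)) ⬝ᵥ (chartEmb s t γ).mulVec w =
        r.mulVec w 0 := fun w => by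
      rw [← Matrix.dotProduct_mulVec, Matrix.mulVec_mulVec, chartCoord_mul_chartEmb,
        Matrix.one_mulVec]
      rfl
    refine ⟨Matrix.vecMul (r 0) (cmat R (chartCoord s t)), ?_, ?_⟩
    · rintro _ ⟨u, rfl⟩
      rw [Matrix.mulVecLin_apply, ← Matrix.mulVec_mulVec, hq, Matrix.mulVec_mulVec, hr,
        Matrix.zero_mulVec]
      rfl
    · rw [LinearMap.flip_apply, dotProductBilin_apply_apply, ← hk, hq, Matrix.sub_mulVec,
        ← Matrix.mulVec_mulVec, cmat_mulVec, cmat_mulVec, act_cvec, act_cvec]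
      rfl

/-- The equation is affine-linear in `y`. If it were identically zero, specialising to `y = 0` and
to the unit vectors would make both components of the kernel coordinates vanish. -/
theorem chartEqn_ne_zero : chartEqn s t t' (chartY a c) ≠ 0 := by
  intro h
  have key : ∀ y : Fin a → ℂ, t'.ρ.mulVec (kerCoord s t) 0 =
      ∑ j, y j * t'.P.mulVec (kerCoord s t) j := fun y => by
    have h1 := congrArg (chartMap (R := CommAlgCat.of ℂ ℂ) (0 : Matrix (Fin c) (Fin a) ℂ)
      (Matrix.of fun _ j => y j)).hom h
    rw [map_zero, chartEqn, map_sub, sub_eq_zero] at h1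
    have h2 := vmap_mulVec (chartMap (R := CommAlgCat.of ℂ ℂ) (0 : Matrix (Fin c) (Fin a) ℂ)
      (Matrix.of fun _ j => y j)) (chartY a c) (cvec _ (t'.P.mulVec (kerCoord s t)))
    rw [chartY_map, vmap_cvec] at h2
    refine Eq.trans ?_ (h1.trans (congrFun h2 0))
    exact (congrFun (vmap_cvec (chartMap (R := CommAlgCat.of ℂ ℂ) (0 : Matrix (Fin c) (Fin a) ℂ)
      (Matrix.of fun _ j => y j)) (t'.ρ.mulVec (kerCoord s t))) 0).symm
  have h0 : t'.ρ.mulVec (kerCoord s t) = 0 := by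
    ext i
    rw [Subsingleton.elim i 0, key 0]
    simp
  have h1 : t'.P.mulVec (kerCoord s t) = 0 := by
    ext j
    have := key (Pi.single j 1)
    rw [h0] at this
    simpa [Pi.single_apply] using this.symm
  have h2 := t'.act_add_eq (CommAlgCat.of ℂ ℂ) (kerCoord s t)
  have h3 : act (CommAlgCat.of ℂ ℂ) t'.P (kerCoord s t) = 0 := h1
  have h4 : act (CommAlgCat.of ℂ ℂ) t'.ρ (kerCoord s t) = 0 := h0
  rw [h3, h4, map_zero, map_zero, add_zero] at h2
  exact kerCoord_ne_zero s t h2.symm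

/-- The chart ring is a domain, so the ideal generated by the nonzero equation is free of rank 1. -/
theorem isCartierAt_univPt : IsCartierAt (Gr.containing a n s.ker)
    ((sndOn (VectorBundle.zeroLocus (boxSec a m a n s.P))).app _ (univPt s t t')) := by
  refine s.isCartierAt_iff.2 ?_
  have h := incidenceIdeal_chartSnd s t t' (chartγ a c) (chartY a c)
  have : IsDomain (chartRing a c) :=
    inferInstanceAs (IsDomain (MvPolynomial ((Fin c × Fin a) ⊕ (Fin 1 × Fin a)) ℂ))
  have hinv : Module.Invertible (chartRing a c) (Ideal.span {chartEqn s t t' (chartY a c)}) :=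
    .congr (LinearEquiv.toSpanNonzeroSingleton _ _ _ (chartEqn_ne_zero s t t'))
  rw [← h] at hinv
  exact hinv

theorem Splitting.isBlowUp (ham : a ≤ m) (hmn : m + 1 = n) :
    IsBlowUp (sndOn (VectorBundle.zeroLocus (boxSec a m a n s.P))) (Gr.containing a n s.ker) where
  isClosed _ B := ⟨_, s.preimageIsCutBy B⟩
  cartier := by
    -- The cover uses one affine space for every pair of complex splittings; by
    -- `exists_mem_chartImage` these charts reach every field-valued point.
    refine ⟨Splitting a (m - a) m × Splitting a 1 (a + 1), fun _ => chartRing a (m - a),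
      fun i => univPt s i.1 i.2, fun i => isAffineChart_univPt s i.1 i.2, fun F hF z => ?_,
      fun i => isCartierAt_univPt s i.1 i.2⟩
    obtain ⟨F, _, _⟩ := F
    let := hF.toField
    obtain ⟨t, t', h⟩ := exists_mem_chartImage (F := F) s (c := m - a) (by omega) z
    obtain ⟨f, hf⟩ := exists_univPt_map_eq s t t' h
    exact ⟨(t, t'), f, hf⟩
  universal _ B hB := s.existsUnique_of_isCartierAt ham hmn B hB

end BlowUp

end FunctorOfPoints

end

theorem mainTheorem3 (a b m n : ℕ) (ham : a ≤ m) (hbn : b ≤ n) (hmn : m ≤ n) :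
    ForGeneral fun s : (QBoxUDual a m b n).sections =>
      (∃ e : (VectorBundle.zeroLocus s).toFunctor ≅
          GrassBundle b ((U a m).directSum (VectorBundle.trivial (Gr a m) (n - m))),
        e.hom ≫ GrassBundle.proj b _ = fstOn (VectorBundle.zeroLocus s)) ∧
      (ForGeneral fun t : ((Fl.Q₂ b (a + n - m) n).power (n - m)).sections =>
        Nonempty ((VectorBundle.zeroLocus s).toFunctor ≅
          (VectorBundle.zeroLocus t).toFunctor)) ∧
      (a + n < b + m → IsEmptySpace (VectorBundle.zeroLocus s).toFunctor) ∧
      (a = b → ∃ K : Submodule ℂ (Fin n → ℂ), Module.finrank ℂ K = n - m ∧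
        IsBirational (sndOn (VectorBundle.zeroLocus s)) ∧
        (∀ (B : (Gr b n).obj (CommAlgCat.of ℂ ℂ)) (d : ℕ),
          Module.finrank ℂ ((Gr.toSubmodule B : Submodule ℂ (Fin n → ℂ)) ⊓ K : Submodule ℂ _) = d →
            Nonempty ((fiber (sndOn (VectorBundle.zeroLocus s)) B).toFunctor ≅
              Gr d (m - a + d))) ∧
        (m + 1 = n → 1 ≤ a →
          IsBlowUp (sndOn (VectorBundle.zeroLocus s)) (Gr.containing b n K) ∧
            Nonempty ((Gr.containing b n K).toFunctor ≅ Gr (a - 1) (n - 1)))) := by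
  have hk : m + (n - m) = n := by omega
  -- All sections come from matrices, so generality may be imposed on `P`, where it provides a
  -- splitting.
  refine ForGeneral.of_surjective (boxSec a m b n) boxSec_surjective
    ((forGeneral_splitting_P hk).mono ?_)
  rintro _ ⟨s, rfl⟩
  refine ⟨⟨s.bundleIso b, s.bundleIso_hom_proj b⟩, ?_, fun h => s.isEmpty_zeroLocus h hk, ?_⟩
  -- Likewise `τ` is general independently of `P`, which yields a second, unrelated splitting.
  · refine ForGeneral.of_surjective (flSec b (a + n - m) n (n - m)) flSec_surjective
      ((forGeneral_splitting_τ hk).mono ?_)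
    rintro _ ⟨s', rfl⟩
    exact s.nonempty_flagIso s' b (by omega)
  · rintro rfl
    refine ⟨s.ker, s.finrank_ker hk, s.isBirational ham,
      fun B d hd => s.nonempty_fiberIso ham B hd, fun h1 ha => ?_⟩
    obtain ⟨c, rfl⟩ : ∃ c, c + 1 = a := ⟨a - 1, by omega⟩
    subst h1
    have hs : m + 1 - m = 1 := by omega
    -- The second summand of the splitting has dimension `m + 1 - m`, which must be rewritten to 1
    -- in the type of `s` before the results for a line apply.
    revert s
    rw [hs]
    intro s
    exact ⟨s.isBlowUp ham rfl, s.nonempty_containingIso (a := c) (m := m) (by omega)⟩
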